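/- **Conventions.** A quantum algorithm is a family $\{A_\lambda\}_{\lambda\in\mathbb N}$ of generalized quantum circuits over the gate set $\{\mathrm{CNOT},H,T\}$: some input qubits may be initialized to $|0\rangle$, and some output qubits may be traced out. The size of a circuit is its number of gates plus its numbers of input and output qubits. The algorithm is QPT if the size of $A_\lambda$ is bounded by a polynomial in $\lambda$. It is non-uniform with advice if, in addition, $A_\lambda$ receives a density matrix $\rho_\lambda$ depending only on $\lambda$. A function is negligible if it is eventually smaller than every inverse polynomial in $\lambda$. **PRFS.** Let $d(\lambda),n(\lambda)=O(\log\lambda)$; for instance $n(\lambda)=\lceil 3\log\lambda\rceil$ and $d(\lambda)=\lceil\log(3\lambda/n(\lambda))\rceil$. Let $G$ be a (selectively secure) $(d,n)$-PRFS generator. That is, $G$ is a QPT algorithm mapping $k\in\{0,1\}^\lambda$, $x\in\{0,1\}^{d(\lambda)}$ to an $n(\lambda)$-qubit state $G_\lambda(k,x)$ such that, for all polynomially bounded $s,t$, all families of distinct inputs $x_1,\dots,x_{s(\lambda)}\in\{0,1\}^{d(\lambda)}$, and all non-uniform QPT distinguishers $A$ with quantum advice, the difference $$\Big|\Pr_{k}\big[A_\lambda(x_1,\dots,x_s,G_\lambda(k,x_1)^{\otimes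 t},\dots,G_\lambda(k,x_s)^{\otimes t})=1\big]-\Pr_{\vartheta_1,\dots,\vartheta_s}\big[A_\lambda(x_1,\dots,x_s,|\vartheta_1\rangle^{\otimes t},\dots,|\vartheta_s\rangle^{\otimes t})=1\big]\Big|$$ is negligible. Here $k$ is uniform in $\{0,1\}^\lambda$, and the $|\vartheta_i\rangle$ are independent Haar random $n(\lambda)$-qubit states. Assume that $G$ has the strongly recognizable abort property. That is, there are a QPT algorithm $\widehat G$ and, for each $\lambda$, a state $|\bot\rangle=|1\rangle|\widehat\bot\rangle$ of $n(\lambda)+1$ qubits such that, for all $k,x$, $$\widehat G_\lambda(k,x)=\eta\,|0\rangle\langle 0|\otimes|\psi\rangle\langle\psi|+(1-\eta)|\bot\rangle\langle\bot|$$ for some $\eta\in[0,1]$ and some $n(\lambda)$-qubit pure state $|\psi\rangle$ (both depending on $\lambda$, $k$, $x$), and $G_\lambda(k,x)$ is obtained from $\widehat G_\lambda(k,x)$ by tracing out the first qubit. **Commit phase.** Let $L(\lambda)=3^8\,2^{3n(\lambda)+5}\lambda$, and let $\mathsf{Tomography}$ be any QPT algorithm that takes $L(\lambda)$ copies of an $(n(\lambda)+1)$-qubit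 state and outputs a classical string obtained by measurement. To commit to $b\in\{0,1\}$, the committer and the receiver do the following. 1. The receiver sends a classical message $P=(P_x)_{x\in\{0,1\}^{d(\lambda)}}$, where each $P_x$ is (the label of) an $n(\lambda)$-qubit Pauli operator in $\{I,X,Y,Z\}^{\otimes n(\lambda)}$. 2. The committer samples one key $k\leftarrow\{0,1\}^\lambda$ uniformly. For every $x\in\{0,1\}^{d(\lambda)}$ it independently computes $M_x\leftarrow\mathsf{Tomography}\big(\sigma_x^{\otimes L(\lambda)}\big)$ with $\sigma_x=(I\otimes P_x^b)\,\widehat G_\lambda(k,x)\,(I\otimes P_x^b)$. It sends the classical message $M=(M_x)_x$. **Lemma (Computational Hiding).** The scheme is computationally hiding. That is, for every malicious QPT receiver $R^*=\{R^*_\lambda\}$ (possibly with polynomial-size quantum advice; it may choose $P$ arbitrarily and keep an entangled private register) and every QPT distinguisher $D=\{D_\lambda\}$, the function $$\lambda\mapsto\Big|\Pr\big[D_\lambda(\sigma^{0}_{R^*})=1\big]-\Pr\big[D_\lambda(\sigma^{1}_{R^*})=1\big]\Big|$$ is negligible, where $\sigma^{b}_{R^*}$ denotes the final state of $R^*_\lambda$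 after the commit phase with a committer committing to $b$. -/

import Mathlib

/-! ### Qubit registers

A register is a finite type `Q` of qubits. Its computational basis is `Q → Bool` (`false` is the
basis vector `0`, `true` the basis vector `1`), and its states are density matrices over that
basis. The register made of `A` and `B` side by side is `A ⊕ B`. -/

/-- Operators on the register `Q`, written in the computational basis. -/
abbrev QOp (Q : Type) : Type := Matrix (Q → Bool) (Q → Bool) ℂ

namespace QOp

open scoped ComplexOrder in
/-- Density matrices. -/
def IsDensity {Q : Type} [Fintype Q] [DecidableEq Q] (ρ : QOp Q) : Prop :=
  ρ.PosSemidef ∧ ρ.trace = 1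

/-- The classical string `x`, as the density matrix of a computational basis state. -/
def basis {Q : Type} [Fintype Q] [DecidableEq Q] (x : Q → Bool) : QOp Q :=
  Matrix.single x x 1

/-- The density matrix of a pure state. -/
def pure {Q : Type} [Fintype Q] (v : EuclideanSpace ℂ (Q → Bool)) : QOp Q :=
  Matrix.of fun x y => v x * (starRingEnd ℂ) (v y)

/-- The tensor product of two operators. -/
def tensor {A B : Type} (ρ : QOp A) (σ : QOp B) : QOp (A ⊕ B) :=
  Matrix.of fun x y => ρ (x ∘ Sum.inl) (y ∘ Sum.inl) * σ (x ∘ Sum.inr) (y ∘ Sum.inr)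

/-- The tensor product of a finite family of operators; the register `J × Q` consists of one copy
of `Q` for each `j : J`. -/
def tensorFamily {J Q : Type} [Fintype J] (ρ : J → QOp Q) : QOp (J × Q) :=
  Matrix.of fun x y => ∏ j, ρ j (fun q => x (j, q)) (fun q => y (j, q))

/-- The partial trace over the first of two registers. -/
def traceLeft {A B : Type} [Fintype A] [DecidableEq A] (ρ : QOp (A ⊕ B)) : QOp B :=
  Matrix.of fun x y => ∑ a : A → Bool, ρ (Sum.elim a x) (Sum.elim a y)

/-- The unnormalised state of the second register, given that a measurement of the first register
in the computational basis gives `m`. Its trace is the probability of `m`. -/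
def postMeasure {A B : Type} (ρ : QOp (A ⊕ B)) (m : A → Bool) : QOp B :=
  Matrix.of fun x y => ρ (Sum.elim m x) (Sum.elim m y)

/-- The result of measuring a whole register in the computational basis: the outcome `m` occurs
with probability `ρ m m`. -/
def measured {Q : Type} [Fintype Q] [DecidableEq Q] (ρ : QOp Q) : QOp Q :=
  Matrix.diagonal fun m => ρ m m

/-- The probability that a measurement of a single output qubit gives `1`. -/
def probOne (ρ : QOp Unit) : ℝ := (ρ (fun _ => true) (fun _ => true)).re

end QOp

/-! ### Generalized quantum circuits -/

/-- The gates over the wires `Q`, with gate set `CNOT`, `H`, `T`. -/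
inductive QGate (Q : Type) : Type
  | hadamard (i : Q) : QGate Q
  | tGate (i : Q) : QGate Q
  | cnot (control target : Q) (h : control ≠ target) : QGate Q

/-- The unitary of a gate on all the wires. -/
noncomputable def QGate.toOp {Q : Type} [Fintype Q] [DecidableEq Q] : QGate Q → QOp Q
  | .hadamard i => Matrix.of fun x y =>
      if ∀ j, j ≠ i → x j = y j then
        (if x i && y i then -1 else 1) * ((Real.sqrt 2 : ℝ) : ℂ)⁻¹
      else 0
  | .tGate i => Matrix.diagonal fun x =>
      if x i then Complex.exp (Complex.I * (Real.pi / 4)) else 1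
  | .cnot c t _ => Matrix.of fun x y =>
      if x = Function.update y t (xor (y t) (y c)) then 1 else 0

/-- A generalized circuit with input register `A` and output register `B`. The wires that do not
carry an input qubit are initialized to zero, and the wires that do not carry an output qubit are
traced out at the end. Gates are applied from the head of the list on. -/
structure QCircuit (A B : Type) where
  wires : ℕ
  gates : List (QGate (Fin wires))
  input : A ↪ Fin wires
  output : B ↪ Fin wires

namespace QCircuit

/-- The number of gates plus the number of all input qubits (the ones initialized to zero
included) and of all output qubits (the ones traced out included). -/
def size {A B : Type} (C : QCircuit A B) : ℕ := C.gates.length + C.wires + C.wires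

/-- The unitary part of a circuit. -/
noncomputable def unitary {A B : Type} (C : QCircuit A B) : QOp (Fin C.wires) :=
  C.gates.foldl (fun U g => g.toOp * U) 1

open Classical in
/-- The input on the input wires, zeroes on all the others. -/
noncomputable def initialState {A B : Type} (C : QCircuit A B) (ρ : QOp A) :
    QOp (Fin C.wires) :=
  Matrix.of fun x y =>
    if ∀ i, i ∉ Set.range C.input → x i = false ∧ y i = false then
      ρ (x ∘ C.input) (y ∘ C.input)
    else 0

open Classical in
/-- The partial trace over the wires that do not carry an output qubit. -/
noncomputable def finalState {A B : Type} (C : QCircuit A B) (σ : QOp (Fin C.wires)) : QOp B :=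
  Matrix.of fun u v => ∑ x : Fin C.wires → Bool, ∑ y : Fin C.wires → Bool,
    if x ∘ C.output = u ∧ y ∘ C.output = v ∧ ∀ i, i ∉ Set.range C.output → x i = y i then
      σ x y
    else 0

/-- The channel that a circuit computes. -/
noncomputable def run {A B : Type} (C : QCircuit A B) (ρ : QOp A) : QOp B :=
  C.finalState (C.unitary * C.initialState ρ * C.unitary.conjTranspose)

end QCircuit

/-! ### Asymptotics -/

/-- Bounded by a polynomial in the security parameter. -/
def PolyBounded (f : ℕ → ℕ) : Prop :=
  ∃ p : Polynomial ℕ, ∀ lam, f lam ≤ p.eval lam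

/-- Negligible functions: smaller than any inverse polynomial. -/
def Negligible (ε : ℕ → ℝ) : Prop :=
  Asymptotics.SuperpolynomialDecay Filter.atTop (fun lam : ℕ => (lam : ℝ)) ε

/-- Quantum polynomial-time algorithms: families of circuits of polynomial size. -/
def IsQPT {A B : ℕ → Type} (C : ∀ lam, QCircuit (A lam) (B lam)) : Prop :=
  PolyBounded fun lam => (C lam).size

/-! ### Pseudorandom function-like states -/

/-- The Haar measure on pure states of `n` qubits: the normalised surface measure on the unit
sphere. -/
noncomputable def haarState (n : ℕ) :
    MeasureTheory.Measure (Metric.sphere (0 : EuclideanSpace ℂ (Fin n → Bool)) 1) :=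
  ((MeasureTheory.volume : MeasureTheory.Measure (EuclideanSpace ℂ (Fin n → Bool))).toSphere
    Set.univ)⁻¹ •
  (MeasureTheory.volume : MeasureTheory.Measure (EuclideanSpace ℂ (Fin n → Bool))).toSphere

/-- A state generator takes a key of `lam` bits and an input of `d lam` bits to a state on the
register `Out lam`. -/
abbrev StateGenerator (d : ℕ → ℕ) (Out : ℕ → Type) : Type :=
  ∀ lam : ℕ, QCircuit (Fin lam ⊕ Fin (d lam)) (Out lam)

/-- The output of a state generator on key `k` and input `x`. -/
noncomputable def StateGenerator.gen {d : ℕ → ℕ} {Out : ℕ → Type} (G : StateGenerator d Out)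
    (lam : ℕ) (k : Fin lam → Bool) (x : Fin (d lam) → Bool) : QOp (Out lam) :=
  (G lam).run (QOp.basis (Sum.elim k x))

/-- What a distinguisher against a state generator receives: the inputs `x 0, …, x (s - 1)`, then
`t` copies of each of the states `σ 0, …, σ (s - 1)`, then its quantum advice `ρ`. -/
noncomputable def challenge {s d t n a : ℕ} (x : Fin s → Fin d → Bool) (σ : Fin s → QOp (Fin n))
    (ρ : QOp (Fin a)) : QOp (((Fin s × Fin d) ⊕ (Fin s × (Fin t × Fin n))) ⊕ Fin a) :=
  QOp.tensor
    (QOp.tensor (QOp.basis fun q : Fin s × Fin d => x q.1 q.2)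
      (QOp.tensorFamily fun i => QOp.tensorFamily fun _ : Fin t => σ i))
    ρ

/-- Selectively secure `(d, n)`-PRFS generators. The distinguishers are non-uniform, with quantum
advice `ρ`, and the inputs queried are distinct and fixed in advance. -/
def IsPRFS {d n : ℕ → ℕ} (G : StateGenerator d fun lam => Fin (n lam)) : Prop :=
  IsQPT G ∧
  ∀ s t a : ℕ → ℕ, PolyBounded s → PolyBounded t →
  ∀ x : ∀ lam, Fin (s lam) → Fin (d lam) → Bool, (∀ lam, Function.Injective (x lam)) →
  ∀ D : ∀ lam, QCircuit
    (((Fin (s lam) × Fin (d lam)) ⊕ (Fin (s lam) × (Fin (t lam) × Fin (n lam)))) ⊕ Fin (a lam))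
    Unit, IsQPT D →
  ∀ ρ : ∀ lam, QOp (Fin (a lam)), (∀ lam, (ρ lam).IsDensity) →
  Negligible fun lam =>
    |(∑ k : Fin lam → Bool,
          ((D lam).run (challenge (x lam) (fun i => G.gen lam k (x lam i)) (ρ lam))).probOne)
        / 2 ^ lam
      - ∫ v, ((D lam).run (challenge (x lam) (fun i => QOp.pure (v i).1) (ρ lam))).probOne
          ∂(MeasureTheory.Measure.pi fun _ : Fin (s lam) => haarState (n lam))|

/-- `Ghat` witnesses that `G` has the (strongly) recognizable abort property. The output of `Ghat`
has one flag qubit in front: it is a mixture of a state with flag `0` and of the fixed abort state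
`1 ⊗ bot`. Tracing out the flag gives the output of `G`. -/
def RecognizableAbort {d n : ℕ → ℕ} (G : StateGenerator d fun lam => Fin (n lam))
    (Ghat : StateGenerator d fun lam => Unit ⊕ Fin (n lam)) : Prop :=
  IsQPT Ghat ∧
  ∀ lam, ∃ bot : EuclideanSpace ℂ (Fin (n lam) → Bool), ‖bot‖ = 1 ∧
    ∀ (k : Fin lam → Bool) (x : Fin (d lam) → Bool),
      (∃ (η : ℝ) (ψ : EuclideanSpace ℂ (Fin (n lam) → Bool)), 0 ≤ η ∧ η ≤ 1 ∧ ‖ψ‖ = 1 ∧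
        Ghat.gen lam k x =
          (η : ℂ) • QOp.tensor (QOp.basis fun _ : Unit => false) (QOp.pure ψ) +
          ((1 - η : ℝ) : ℂ) • QOp.tensor (QOp.basis fun _ : Unit => true) (QOp.pure bot)) ∧
      G.gen lam k x = (Ghat.gen lam k x).traceLeft

/-! ### Commitments with one classical message in each direction -/

/-- The committer's side of the commit phase: on security parameter `lam`, bit `b` and the
receiver's classical message `m`, the (classical, possibly random) reply, as a density matrix that
is diagonal in the computational basis, averaged over the private coins of the committer. -/
abbrev CommitterReply (M R : ℕ → Type) : Type :=
  ∀ lam : ℕ, Bool → (M lam → Bool) → QOp (R lam)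

/-- The state of a malicious receiver after the commit phase, the committer being traced out. The
receiver starts from its advice `ρ` and runs `R₁`, which yields a message register, measured when
it is sent, and a private register. On the private register and on the committer's reply it then
runs `R₂`. -/
noncomputable def receiverState {M R : Type} [Fintype M] [DecidableEq M] {a r o : ℕ}
    (reply : (M → Bool) → QOp R) (ρ : QOp (Fin a)) (R₁ : QCircuit (Fin a) (M ⊕ Fin r))
    (R₂ : QCircuit (Fin r ⊕ R) (Fin o)) : QOp (Fin o) :=
  R₂.run (∑ m : M → Bool, QOp.tensor ((R₁.run ρ).postMeasure m) (reply m))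

/-- Computational hiding: no QPT malicious receiver, not even one with quantum advice, reaches
states in the two executions that a QPT distinguisher `D` tells apart. -/
def ComputationallyHiding {M R : ℕ → Type} [∀ lam, Fintype (M lam)] [∀ lam, DecidableEq (M lam)]
    (commit : CommitterReply M R) : Prop :=
  ∀ a r o : ℕ → ℕ,
  ∀ ρ : ∀ lam, QOp (Fin (a lam)), (∀ lam, (ρ lam).IsDensity) →
  ∀ R₁ : ∀ lam, QCircuit (Fin (a lam)) (M lam ⊕ Fin (r lam)), IsQPT R₁ →
  ∀ R₂ : ∀ lam, QCircuit (Fin (r lam) ⊕ R lam) (Fin (o lam)), IsQPT R₂ →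
  ∀ D : ∀ lam, QCircuit (Fin (o lam)) Unit, IsQPT D →
  Negligible fun lam =>
    |((D lam).run (receiverState (commit lam false) (ρ lam) (R₁ lam) (R₂ lam))).probOne
      - ((D lam).run (receiverState (commit lam true) (ρ lam) (R₁ lam) (R₂ lam))).probOne|

/-! ### The commitment scheme -/

/-- The Pauli matrix with label `(a, c)`, which is `X ^ a * Z ^ c` up to a phase:
`I`, `Z`, `X`, `Y` for `00`, `01`, `10`, `11`. Rows and columns are indexed by `Bool`. -/
noncomputable def pauli1 : Bool → Bool → Matrix Bool Bool ℂ
  | false, false => 1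
  | false, true => Matrix.diagonal fun x => if x then -1 else 1
  | true, false => Matrix.of fun x y => if x = y then 0 else 1
  | true, true => Matrix.of fun x y =>
      if x = y then 0 else if x then Complex.I else -Complex.I

/-- The `n`-qubit Pauli operator whose `i`-th tensor factor has label `(p (i, 0), p (i, 1))`. -/
noncomputable def pauliOp {n : ℕ} (p : Fin n × Fin 2 → Bool) : QOp (Fin n) :=
  Matrix.of fun x y => ∏ i, pauli1 (p (i, 0)) (p (i, 1)) (x i) (y i)

/-- The operator `I ⊗ P ^ b` on a flag qubit and `n` further qubits. -/
noncomputable def pauliMask {n : ℕ} (p : Fin n × Fin 2 → Bool) (b : Bool) : QOp (Unit ⊕ Fin n) :=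
  QOp.tensor 1 (if b then pauliOp p else 1)

/-- The channel output `(I ⊗ P ^ b) Ghat(k, x) (I ⊗ P ^ b)`. -/
noncomputable def maskedState {d n : ℕ → ℕ}
    (Ghat : StateGenerator d fun lam => Unit ⊕ Fin (n lam)) (lam : ℕ)
    (p : Fin (n lam) × Fin 2 → Bool) (k : Fin lam → Bool) (x : Fin (d lam) → Bool) (b : Bool) :
    QOp (Unit ⊕ Fin (n lam)) :=
  pauliMask p b * Ghat.gen lam k x * pauliMask p b

/-- The number of copies on which the tomography procedure is run. -/
def tomographyCopies (n : ℕ → ℕ) (lam : ℕ) : ℕ := 3 ^ 8 * 2 ^ (3 * n lam + 5) * lam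

/-- A family of procedures that measure `tomographyCopies n lam` copies of a state of `n lam + 1`
qubits and output a string of `u lam` bits. -/
abbrev Tomography (n u : ℕ → ℕ) : Type :=
  ∀ lam : ℕ, QCircuit (Fin (tomographyCopies n lam) × (Unit ⊕ Fin (n lam))) (Fin (u lam))

/-- The committer of the scheme. The receiver's message holds an `n`-qubit Pauli `P_x` for each
`x`. The committer samples one key `k`, and for each `x` it runs the tomography procedure on
copies of `(I ⊗ P_x ^ b) Ghat(k, x) (I ⊗ P_x ^ b)` and sends the measured outcome. -/
noncomputable def tomographyCommitment {d n u : ℕ → ℕ}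
    (Ghat : StateGenerator d fun lam => Unit ⊕ Fin (n lam)) (T : Tomography n u) :
    CommitterReply (fun lam => (Fin (d lam) → Bool) × (Fin (n lam) × Fin 2))
      (fun lam => (Fin (d lam) → Bool) × Fin (u lam)) :=
  fun lam b P =>
    ((2 : ℂ) ^ lam)⁻¹ • ∑ k : Fin lam → Bool,
      QOp.tensorFamily fun x : Fin (d lam) → Bool =>
        ((T lam).run (QOp.tensorFamily fun _ : Fin (tomographyCopies n lam) =>
          maskedState Ghat lam (fun q => P (x, q)) k x b)).measured

/-! Since d = O(log λ), a reduction to PRFS security can afford to query all 2^d inputs x. By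
averaging (`exists_message`), some fixed message P and fixed private state τ of the receiver do at
least as well as the random outcome, and a non-uniform distinguisher may have P built into its
circuit and take τ as quantum advice. Given L copies of a state for each x, it prepends a flag qubit
0, applies the masks P_x^b, and runs the tomography, the measurement and the rest of the attack
(`exists_distinguisher`). On Haar random states the result does not depend on b, because the Haar
measure is unitarily invariant (`integral_pauliUnitary`). PRFS security transfers this to the states
G(k, x), up to a negligible error.

The simulation is inexact only in the abort branch, whose true flag is 1. Correcting the flag one
copy at a time (`abs_probOne_sub_le`) costs at most L times the sum over x of the abort weights 1 -
η. It remains to see that aborts are rare on average over k (`abort_negligible`).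

For this, write ρ = η ψ + (1 - η) bot for G(k, x) and use two swap tests as PRFS distinguishers. Two
copies of ρ against each other: Haar states are pure, so ρ is nearly pure on average. Next, t copies
of ρ against t copies of bot, given as advice: a Haar state is rarely close to bot
(`integral_overlap_pow_le`), so ⟨bot|ρ|bot⟩^t is small on average. A nearly pure mixture with a
large weight on bot would be close to bot; `abort_le` makes this quantitative. For n = 0 all states
coincide and nothing bounds the aborts, but then the masks are trivial.

The rest is a calculus of circuits. Each circuit acts by Kraus operators
(`QCircuit.run_eq_krausMap`); compositions, Pauli masks, measurements and swap tests are realised by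
explicit gate lists with size bounds, which makes the distinguishers QPT. -/

set_option linter.unusedSectionVars false

/-! ### Gluing assignments along an equivalence -/

section Glue

variable {A B W : Type}

/-- The assignment on `W ≃ A ⊕ B` made of an assignment on `A` and one on `B`. -/
def glue (e : A ⊕ B ≃ W) (p : A → Bool) (q : B → Bool) : W → Bool :=
  Sum.elim p q ∘ e.symm

@[simp] lemma glue_inl (e : A ⊕ B ≃ W) (p : A → Bool) (q : B → Bool) (a : A) :
    glue e p q (e (Sum.inl a)) = p a := by simp [glue]

@[simp] lemma glue_inr (e : A ⊕ B ≃ W) (p : A → Bool) (q : B → Bool) (b : B) :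
    glue e p q (e (Sum.inr b)) = q b := by simp [glue]

/-- Gluing, as an equivalence. -/
def glueEquiv (e : A ⊕ B ≃ W) : (A → Bool) × (B → Bool) ≃ (W → Bool) where
  toFun z := glue e z.1 z.2
  invFun w := (fun a => w (e (Sum.inl a)), fun b => w (e (Sum.inr b)))
  left_inv z := by ext <;> simp
  right_inv w := by
    funext i
    obtain ⟨j, rfl⟩ := e.surjective i
    cases j <;> simp

lemma glue_eq_iff (e : A ⊕ B ≃ W) (p : A → Bool) (q : B → Bool) (w : W → Bool) :
    w = glue e p q ↔ (fun a => w (e (Sum.inl a))) = p ∧ (fun b => w (e (Sum.inr b))) = q := by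
  rw [← Prod.mk_inj]
  exact (glueEquiv e).symm_apply_eq (x := w) (y := (p, q)) |>.symm

lemma glue_inj (e : A ⊕ B ≃ W) (p p' : A → Bool) (q q' : B → Bool) :
    glue e p q = glue e p' q' ↔ p = p' ∧ q = q' := by
  rw [glue_eq_iff]; simp

lemma sum_glue [Fintype A] [Fintype B] [Fintype W] [DecidableEq A] [DecidableEq B] [DecidableEq W]
    {M : Type*} [AddCommMonoid M] (e : A ⊕ B ≃ W) (f : (W → Bool) → M) :
    ∑ w, f w = ∑ p : A → Bool, ∑ q : B → Bool, f (glue e p q) := by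
  rw [← Fintype.sum_prod_type']
  exact (Equiv.sum_comp (glueEquiv e) f).symm

/-- The wires outside the range of an embedding. -/
noncomputable def embedCompl (f : A ↪ W) : A ⊕ {w // w ∉ Set.range f} ≃ W := by
  classical
  exact (Equiv.sumCongr (Equiv.ofInjective f f.injective) (Equiv.refl _)).trans
    (Equiv.Set.sumCompl (Set.range f))

@[simp] lemma embedCompl_inl (f : A ↪ W) (a : A) : embedCompl f (Sum.inl a) = f a := by
  classical
  exact Equiv.Set.sumCompl_apply_inl (Set.range f) ⟨f a, a, rfl⟩

end Glue

/-! ### Extending operators by the identity -/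

section Extend

variable {V W X : Type} [Fintype V] [Fintype W] [DecidableEq V] [DecidableEq W]

open Classical in
/-- The operator on `W` that acts as `M` on the image of `V` and as the identity elsewhere. -/
noncomputable def extendOp (f : V ↪ W) (M : QOp V) : QOp W :=
  Matrix.of fun x y => if ∀ j, j ∉ Set.range f → x j = y j then M (x ∘ f) (y ∘ f) else 0

/-- Once the wires are split into the image of `f` and the rest, the extended operator is M ⊗ 1. The
algebraic identities for `extendOp` below are read off from these entries. -/
lemma extendOp_apply_glue (e : V ⊕ X ≃ W) (M : QOp V) (p p' : V → Bool) (q q' : X → Bool)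
    (f : V ↪ W) (hf : ∀ v, f v = e (Sum.inl v)) [Decidable (q = q')] :
    extendOp f M (glue e p q) (glue e p' q') = if q = q' then M p p' else 0 := by
  classical
  have h : (∀ j, j ∉ Set.range f → glue e p q j = glue e p' q' j) ↔ q = q' := by
    constructor
    · intro h
      funext i
      have := h (e (Sum.inr i)) (by rintro ⟨v, hv⟩; rw [hf] at hv; simpa using e.injective hv)
      simpa using this
    · rintro rfl j hj
      obtain ⟨i, rfl⟩ := e.surjective j
      cases i with
      | inl v => exact absurd ⟨v, hf v⟩ hj
      | inr v => simp
  have h1 : glue e p q ∘ f = p := by funext i; simp [hf]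
  have h2 : glue e p' q' ∘ f = p' := by funext i; simp [hf]
  simp only [extendOp, Matrix.of_apply, h, h1, h2]

lemma qop_ext_glue {A B : Type} (e : A ⊕ B ≃ W) {M N : QOp W}
    (h : ∀ p q p' q', M (glue e p q) (glue e p' q') = N (glue e p q) (glue e p' q')) : M = N := by
  ext x y
  obtain ⟨⟨p, q⟩, rfl⟩ := (glueEquiv e).surjective x
  obtain ⟨⟨p', q'⟩, rfl⟩ := (glueEquiv e).surjective y
  exact h p q p' q'

lemma extendOp_mul (f : V ↪ W) (M N : QOp V) :
    extendOp f (M * N) = extendOp f M * extendOp f N := by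
  classical
  refine qop_ext_glue (embedCompl f) fun p q p' q' => ?_
  rw [Matrix.mul_apply, sum_glue (embedCompl f)]
  simp only [extendOp_apply_glue (embedCompl f) _ _ _ _ _ f (by simp)]
  simp [Matrix.mul_apply]

lemma extendOp_one (f : V ↪ W) : extendOp f (1 : QOp V) = 1 := by
  classical
  refine qop_ext_glue (embedCompl f) fun p q p' q' => ?_
  rw [extendOp_apply_glue (embedCompl f) _ _ _ _ _ f (by simp)]
  simp only [Matrix.one_apply, glue_inj]
  by_cases h : q = q' <;> simp [h]

lemma extendOp_conjTranspose (f : V ↪ W) (M : QOp V) :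
    (extendOp f M).conjTranspose = extendOp f M.conjTranspose := by
  classical
  refine qop_ext_glue (embedCompl f) fun p q p' q' => ?_
  rw [Matrix.conjTranspose_apply]
  simp only [extendOp_apply_glue (embedCompl f) _ _ _ _ _ f (by simp)]
  simp only [eq_comm (a := q')]
  split_ifs <;> simp [Matrix.conjTranspose_apply]

lemma extendOp_equiv_apply (e : V ≃ W) (M : QOp V) (x y : W → Bool) :
    extendOp e.toEmbedding M x y = M (x ∘ e) (y ∘ e) := by
  classical
  have : ∀ j, j ∉ Set.range e.toEmbedding → x j = y j := fun j hj => absurd (by simp) hj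
  simp only [extendOp, Matrix.of_apply, if_pos this]
  rfl

lemma extendOp_inr {R : Type} [Fintype R] [DecidableEq R] (M : QOp V) :
    extendOp (Function.Embedding.inr (α := R)) M = QOp.tensor 1 M := by
  classical
  ext x y
  have : (∀ j, j ∉ Set.range (Function.Embedding.inr (α := R) (β := V)) → x j = y j) ↔
      x ∘ Sum.inl = y ∘ Sum.inl := by
    simp [funext_iff]
  simp only [extendOp, Matrix.of_apply, this, QOp.tensor, Matrix.one_apply]
  split_ifs
  · simp; rfl
  · simp

end Extend

/-! ### Gate lists -/

section Gates

variable {V W : Type} [Fintype V] [Fintype W] [DecidableEq V] [DecidableEq W]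

/-- Relocating a gate along an embedding of wires. -/
def QGate.map {V W : Type} (f : V ↪ W) : QGate V → QGate W
  | .hadamard i => .hadamard (f i)
  | .tGate i => .tGate (f i)
  | .cnot c t h => .cnot (f c) (f t) (f.injective.ne h)

lemma ite_extend {f : V ↪ W} {x y : W → Bool} [Decidable (∀ j, j ∉ Set.range f → x j = y j)]
    (P : Prop) [Decidable P] (Q : Prop) [Decidable Q]
    (h : Q ↔ ((∀ j, j ∉ Set.range f → x j = y j) ∧ P)) (c : ℂ) :
    (if (∀ j, j ∉ Set.range f → x j = y j) then (if P then c else 0) else 0) =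
      if Q then c else 0 := by
  rw [← ite_and]; simp only [h]

/-- A gate depends only on the wires it names, so relocating it tensors its unitary with the
identity. This allows a circuit to be embedded in a larger set of wires. -/
lemma QGate.toOp_map (f : V ↪ W) (g : QGate V) : (g.map f).toOp = extendOp f g.toOp := by
  classical
  ext x y
  cases g with
  | hadamard i =>
    simp only [QGate.map, QGate.toOp, extendOp, Matrix.of_apply, Function.comp]
    refine (ite_extend _ _ ?_ _).symm
    constructor
    · intro h
      refine ⟨fun j hj => h j ?_, fun j hj => h _ (f.injective.ne hj)⟩
      rintro rfl; exact hj ⟨i, rfl⟩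
    · rintro ⟨h1, h2⟩ j hj
      by_cases hr : j ∈ Set.range f
      · obtain ⟨k, rfl⟩ := hr
        exact h2 k (fun h => hj (by rw [h]))
      · exact h1 j hr
  | tGate i =>
    simp only [QGate.map, QGate.toOp, extendOp, Matrix.of_apply, Function.comp,
      Matrix.diagonal_apply]
    refine (ite_extend _ _ ?_ _).symm
    constructor
    · rintro rfl; simp
    · rintro ⟨h1, h2⟩
      funext j
      by_cases hr : j ∈ Set.range f
      · obtain ⟨k, rfl⟩ := hr
        exact congrFun h2 k
      · exact h1 j hr
  | cnot c t h =>
    simp only [QGate.map, QGate.toOp, extendOp, Matrix.of_apply, Function.comp]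
    refine (ite_extend _ _ ?_ _).symm
    constructor
    · intro hxy
      subst hxy
      refine ⟨fun j hj => ?_, ?_⟩
      · rw [Function.update_of_ne]; rintro rfl; exact hj ⟨t, rfl⟩
      · funext j
        by_cases hj : j = t
        · subst hj; simp
        · simp [hj, f.injective.ne hj]
    · rintro ⟨h1, h2⟩
      funext j
      by_cases hr : j ∈ Set.range f
      · obtain ⟨k, rfl⟩ := hr
        have := congrFun h2 k
        by_cases hj : k = t
        · subst hj; simpa using this
        · simpa [hj, f.injective.ne hj] using this
      · rw [Function.update_of_ne]
        · exact h1 j hr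
        · rintro rfl; exact hr ⟨t, rfl⟩

/-- The operator of a list of gates, applied from the head on. -/
noncomputable def gatesOp (l : List (QGate W)) : QOp W := l.foldl (fun U g => g.toOp * U) 1

lemma foldl_gates (l : List (QGate W)) (U : QOp W) :
    l.foldl (fun U g => g.toOp * U) U = gatesOp l * U := by
  induction l generalizing U with
  | nil => simp [gatesOp]
  | cons g l ih => simp only [gatesOp, List.foldl_cons]; rw [ih, ih]; simp [Matrix.mul_assoc]

@[simp] lemma gatesOp_nil : gatesOp ([] : List (QGate W)) = 1 := rfl

lemma gatesOp_cons (g : QGate W) (l : List (QGate W)) :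
    gatesOp (g :: l) = gatesOp l * g.toOp := by
  simp only [gatesOp, List.foldl_cons]; rw [foldl_gates]; simp [gatesOp]

lemma gatesOp_append (l m : List (QGate W)) : gatesOp (l ++ m) = gatesOp m * gatesOp l := by
  simp only [gatesOp, List.foldl_append]; rw [foldl_gates]; simp [gatesOp]

lemma gatesOp_map (f : V ↪ W) (l : List (QGate V)) :
    gatesOp (l.map (QGate.map f)) = extendOp f (gatesOp l) := by
  induction l with
  | nil => simp [extendOp_one]
  | cons g l ih => rw [List.map_cons, gatesOp_cons, gatesOp_cons, ih, extendOp_mul, QGate.toOp_map]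

lemma sum_unit_bool {M : Type*} [AddCommMonoid M] (f : (Unit → Bool) → M) :
    ∑ x, f x = f (fun _ => false) + f (fun _ => true) := by
  rw [← Equiv.sum_comp (Equiv.funUnique Unit Bool).symm f, Fintype.sum_bool, add_comm]
  rfl

lemma QGate.hadamard_unit_unitary :
    (QGate.hadamard ()).toOp.conjTranspose * (QGate.hadamard ()).toOp = 1 := by
  have h2 : ((Real.sqrt 2 : ℝ) : ℂ) * ((Real.sqrt 2 : ℝ) : ℂ) = 2 := by
    rw [← Complex.ofReal_mul, Real.mul_self_sqrt (by norm_num)]; norm_num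
  have h3 : ((Real.sqrt 2 : ℝ) : ℂ)⁻¹ * ((Real.sqrt 2 : ℝ) : ℂ)⁻¹ = 2⁻¹ := by
    rw [← mul_inv, h2]
  ext x y
  obtain ⟨a, rfl⟩ := (Equiv.funUnique Unit Bool).symm.surjective x
  obtain ⟨b, rfl⟩ := (Equiv.funUnique Unit Bool).symm.surjective y
  rw [Matrix.mul_apply, sum_unit_bool]
  have : ∀ c : Bool, ((Equiv.funUnique Unit Bool).symm c) = fun _ => c := fun _ => rfl
  simp only [this]
  have h4 : (fun _ : Unit => a) = (fun _ => b) ↔ a = b := by simp [funext_iff]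
  cases a <;> cases b <;>
    simp [QGate.toOp, Matrix.conjTranspose_apply, funext_iff, h3] <;> norm_num

lemma QGate.toOp_unitary (g : QGate W) : g.toOp.conjTranspose * g.toOp = 1 := by
  cases g with
  | hadamard i =>
    -- Relocation reduces the claim to a 2 × 2 computation on a single wire.
    have : QGate.hadamard i = (QGate.hadamard ()).map ⟨fun _ : Unit => i, fun _ _ _ => rfl⟩ := rfl
    rw [this, QGate.toOp_map, extendOp_conjTranspose, ← extendOp_mul, hadamard_unit_unitary,
      extendOp_one]
  | tGate i =>
    have : ∀ t : ℂ, (starRingEnd ℂ) (Complex.exp (Complex.I * (Real.pi / 4))) *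
        Complex.exp (Complex.I * (Real.pi / 4)) = 1 := fun _ => by
      rw [← Complex.exp_conj, ← Complex.exp_add]
      simp [Complex.conj_ofNat]
    simp only [QGate.toOp, Matrix.diagonal_conjTranspose, Matrix.diagonal_mul_diagonal]
    rw [← Matrix.diagonal_one]
    congr 1
    funext x
    cases h : x i <;> simp [h, this 0]
  | cnot c t h =>
    have hinv : ∀ y : W → Bool, Function.update (Function.update y t (xor (y t) (y c))) t
        (xor (Function.update y t (xor (y t) (y c)) t) (Function.update y t (xor (y t) (y c)) c))
        = y := by
      intro y
      simp [Function.update_of_ne h]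
    ext x y
    simp only [QGate.toOp, Matrix.mul_apply, Matrix.conjTranspose_apply, Matrix.of_apply,
      Matrix.one_apply]
    simp only [mul_ite, mul_one, mul_zero, Finset.sum_ite_eq', Finset.mem_univ, if_true]
    have : (Function.update y t (xor (y t) (y c)) = Function.update x t (xor (x t) (x c))) ↔
        x = y := by
      constructor
      · intro hxy
        rw [← hinv x, ← hxy, hinv y]
      · rintro rfl; rfl
    simp only [this]
    split_ifs <;> simp

lemma gatesOp_unitary (l : List (QGate W)) : (gatesOp l).conjTranspose * gatesOp l = 1 := by
  induction l with
  | nil => simp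
  | cons g l ih =>
    rw [gatesOp_cons, Matrix.conjTranspose_mul, Matrix.mul_assoc,
      ← Matrix.mul_assoc (gatesOp l).conjTranspose, ih, Matrix.one_mul, QGate.toOp_unitary]

end Gates

/-! ### Kraus form of generalized circuits -/

section Kraus

variable {A B C R J Z E W : Type}
variable [Fintype A] [Fintype B] [Fintype C] [Fintype R] [Fintype J] [Fintype Z] [Fintype E]
  [Fintype W]
variable [DecidableEq A] [DecidableEq B] [DecidableEq C] [DecidableEq R] [DecidableEq J]
  [DecidableEq Z] [DecidableEq E] [DecidableEq W]

/-- The Kraus operators of a unitary `U` on wires `W`, split as input wires and zeroes by `ein`, and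
as output wires and environment by `eout`. -/
def krausOp (ein : A ⊕ Z ≃ W) (eout : B ⊕ E ≃ W) (U : QOp W) (e : E → Bool) :
    Matrix (B → Bool) (A → Bool) ℂ :=
  Matrix.of fun u a => U (glue eout u e) (glue ein a fun _ => false)

/-- The channel with given Kraus operators. -/
noncomputable def krausMap {ι : Type} [Fintype ι] (K : ι → Matrix (B → Bool) (A → Bool) ℂ)
    (ρ : QOp A) : QOp B :=
  ∑ e, K e * ρ * (K e).conjTranspose

lemma krausMap_apply {ι : Type} [Fintype ι] (K : ι → Matrix (B → Bool) (A → Bool) ℂ) (ρ : QOp A)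
    (u v : B → Bool) :
    krausMap K ρ u v = ∑ e, ∑ a, ∑ a', K e u a * ρ a a' * (starRingEnd ℂ) (K e v a') := by
  simp only [krausMap, Matrix.sum_apply, Matrix.mul_apply, Matrix.conjTranspose_apply,
    Finset.sum_mul]
  exact Finset.sum_congr rfl fun e _ => Finset.sum_comm

/-- The channel of a circuit, in Kraus form. -/
lemma QCircuit.run_eq_krausMap (D : QCircuit A B) (ein : A ⊕ Z ≃ Fin D.wires)
    (eout : B ⊕ E ≃ Fin D.wires) (hin : ∀ a, ein (Sum.inl a) = D.input a)
    (hout : ∀ b, eout (Sum.inl b) = D.output b) (ρ : QOp A) :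
    D.run ρ = krausMap (krausOp ein eout (gatesOp D.gates)) ρ := by
  classical
  have hinr : ∀ i, i ∉ Set.range D.input ↔ ∃ z, i = ein (Sum.inr z) := by
    intro i
    obtain ⟨j, rfl⟩ := ein.surjective i
    cases j with
    | inl a => exact iff_of_false (by simp [hin]) fun ⟨z, h⟩ => by simpa using ein.injective h
    | inr z => simp [← hin]
  have houtr : ∀ i, i ∉ Set.range D.output ↔ ∃ z, i = eout (Sum.inr z) := by
    intro i
    obtain ⟨j, rfl⟩ := eout.surjective i
    cases j with
    | inl a => exact iff_of_false (by simp [hout]) fun ⟨z, h⟩ => by simpa using eout.injective h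
    | inr z => simp [← hout]
  have hinit : ∀ p q p' q', D.initialState ρ (glue ein p q) (glue ein p' q') =
      if q = (fun _ => false) then if q' = (fun _ => false) then ρ p p' else 0 else 0 := by
    intro p q p' q'
    have h1 : glue ein p q ∘ D.input = p := by funext a; simp [← hin]
    have h2 : glue ein p' q' ∘ D.input = p' := by funext a; simp [← hin]
    simp only [QCircuit.initialState, Matrix.of_apply, hinr, h1, h2, ← ite_and, forall_exists_index,
      forall_eq_apply_imp_iff, glue_inr, funext_iff, ← forall_and]
  ext u v
  rw [krausMap_apply]
  simp only [QCircuit.run, QCircuit.finalState, Matrix.of_apply]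
  simp only [sum_glue eout]
  have hcond : ∀ p q p' q', ((glue eout p q ∘ D.output = u ∧ glue eout p' q' ∘ D.output = v ∧
      ∀ i, i ∉ Set.range D.output → glue eout p q i = glue eout p' q' i) ↔
      (p = u ∧ p' = v ∧ q = q')) := by
    intro p q p' q'
    have h1 : glue eout p q ∘ D.output = p := by funext a; simp [← hout]
    have h2 : glue eout p' q' ∘ D.output = p' := by funext a; simp [← hout]
    simp only [houtr, h1, h2, forall_exists_index, forall_eq_apply_imp_iff, glue_inr, funext_iff]
  simp only [hcond, ite_and, Finset.sum_ite_eq, Finset.sum_ite_eq', Finset.mem_univ, if_true,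
    Finset.sum_ite_irrel, Finset.sum_const_zero]
  refine Finset.sum_congr rfl fun q _ => ?_
  have hU : D.unitary = gatesOp D.gates := rfl
  simp only [Matrix.mul_apply, Finset.sum_mul, hU]
  rw [Finset.sum_comm]
  simp only [sum_glue ein, hinit]
  simp only [mul_ite, ite_mul, mul_zero, zero_mul, Finset.sum_ite_irrel, Finset.sum_const_zero,
    Finset.sum_ite_eq', Finset.mem_univ, if_true, Matrix.conjTranspose_apply]
  rfl

/-- A gate list on arbitrary wires gives a circuit. -/
lemma exists_circuit_kraus (ein : A ⊕ Z ≃ W) (eout : B ⊕ E ≃ W) (l : List (QGate W)) :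
    ∃ D : QCircuit A B, D.size = l.length + 2 * Fintype.card W ∧
      ∀ ρ, D.run ρ = krausMap (krausOp ein eout (gatesOp l)) ρ := by
  classical
  let e := Fintype.equivFin W
  refine ⟨⟨Fintype.card W, l.map (QGate.map e.toEmbedding),
    Function.Embedding.inl.trans (ein.trans e).toEmbedding,
    Function.Embedding.inl.trans (eout.trans e).toEmbedding⟩, ?_, fun ρ => ?_⟩
  · simp [QCircuit.size]; ring
  · rw [QCircuit.run_eq_krausMap _ (ein.trans e) (eout.trans e) (fun _ => rfl) (fun _ => rfl)]
    congr 1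
    funext q
    ext u a
    simp only [krausOp, Matrix.of_apply]
    rw [gatesOp_map, extendOp_equiv_apply]
    congr 1 <;> (funext i; simp [glue])

lemma card_of_equiv_sum {X Y : Type} [Fintype X] [Fintype Y] (e : X ⊕ Y ≃ W) :
    Fintype.card X + Fintype.card Y = Fintype.card W := by
  rw [← Fintype.card_sum]; exact Fintype.card_congr e

/-- Sequential composition. -/
theorem QCircuit.exists_seq (D₁ : QCircuit A B) (D₂ : QCircuit B C) :
    ∃ D : QCircuit A C, D.size ≤ D₁.size + D₂.size ∧ ∀ ρ, D.run ρ = D₂.run (D₁.run ρ) := by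
  classical
  let Z₁ := {w // w ∉ Set.range D₁.input}
  let Z₂ := {w // w ∉ Set.range D₂.input}
  let E₁ := {w // w ∉ Set.range D₁.output}
  let E₂ := {w // w ∉ Set.range D₂.output}
  let i₁ : A ⊕ Z₁ ≃ _ := embedCompl D₁.input
  let i₂ : B ⊕ Z₂ ≃ _ := embedCompl D₂.input
  let o₁ : B ⊕ E₁ ≃ _ := embedCompl D₁.output
  let o₂ : C ⊕ E₂ ≃ _ := embedCompl D₂.output
  -- Two descriptions of the same wires: the inputs B of `D₂` are the outputs of `D₁`, the ancillas
  -- `Z₂` of `D₂` are added from the start, and the environment `E₁` of `D₁` stays idle until the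
  -- end.
  let g : Fin D₂.wires ⊕ E₁ ≃ Fin D₁.wires ⊕ Z₂ :=
    ((i₂.symm.sumCongr (Equiv.refl E₁)).trans (Equiv.sumAssoc _ _ _)).trans
      (((Equiv.refl B).sumCongr (Equiv.sumComm _ _)).trans
        ((Equiv.sumAssoc _ _ _).symm.trans (o₁.sumCongr (Equiv.refl Z₂))))
  let f₁ : Fin D₁.wires ↪ Fin D₁.wires ⊕ Z₂ := Function.Embedding.inl
  let f₂ : Fin D₂.wires ↪ Fin D₁.wires ⊕ Z₂ := Function.Embedding.inl.trans g.toEmbedding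
  let ein : A ⊕ (Z₁ ⊕ Z₂) ≃ Fin D₁.wires ⊕ Z₂ :=
    (Equiv.sumAssoc _ _ _).symm.trans (i₁.sumCongr (Equiv.refl Z₂))
  let eout : C ⊕ (E₂ ⊕ E₁) ≃ Fin D₁.wires ⊕ Z₂ :=
    ((Equiv.sumAssoc _ _ _).symm.trans (o₂.sumCongr (Equiv.refl E₁))).trans g
  obtain ⟨D, hs, hr⟩ := exists_circuit_kraus ein eout
    (D₁.gates.map (QGate.map f₁) ++ D₂.gates.map (QGate.map f₂))
  refine ⟨D, ?_, fun ρ => ?_⟩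
  · have := card_of_equiv_sum i₂
    simp only [Fintype.card_sum, Fintype.card_fin] at hs this
    rw [hs]
    simp only [QCircuit.size, List.length_append, List.length_map]
    omega
  rw [hr, QCircuit.run_eq_krausMap D₁ i₁ o₁ (embedCompl_inl _) (embedCompl_inl _),
    QCircuit.run_eq_krausMap D₂ i₂ o₂ (embedCompl_inl _) (embedCompl_inl _)]
  -- Tracing out `E₁` can be deferred, so the Kraus operators of the composite are the products of
  -- those of the two circuits.
  have hK : ∀ (e₂ : E₂ → Bool) (e₁ : E₁ → Bool),
      krausOp ein eout (gatesOp (D₁.gates.map (QGate.map f₁) ++ D₂.gates.map (QGate.map f₂)))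
        (Sum.elim e₂ e₁) =
      krausOp i₂ o₂ (gatesOp D₂.gates) e₂ * krausOp i₁ o₁ (gatesOp D₁.gates) e₁ := by
    intro e₂ e₁
    ext c a
    rw [gatesOp_append, gatesOp_map, gatesOp_map]
    simp only [krausOp, Matrix.of_apply, Matrix.mul_apply]
    have h1 : glue eout c (Sum.elim e₂ e₁) = glue g (glue o₂ c e₂) e₁ := by
      rw [glue_eq_iff]
      constructor
      · funext w
        obtain ⟨j, rfl⟩ := o₂.surjective w
        cases j with
        | inl j => exact (glue_inl eout c (Sum.elim e₂ e₁) j).trans (by simp)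
        | inr j => exact (glue_inr eout c (Sum.elim e₂ e₁) (Sum.inl j)).trans (by simp)
      · funext w
        exact (glue_inr eout c (Sum.elim e₂ e₁) (Sum.inr w)).trans (by simp)
    have h2 : glue ein a (fun _ => false) =
        glue (Equiv.refl _) (glue i₁ a fun _ => false) (fun _ => false) := by
      rw [glue_eq_iff]
      constructor
      · funext w
        obtain ⟨j, rfl⟩ := i₁.surjective w
        cases j with
        | inl j => exact (glue_inl ein a (fun _ => false) j).trans (by simp)
        | inr j => exact (glue_inr ein a (fun _ => false) (Sum.inl j)).trans (by simp)
      · funext w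
        exact (glue_inr ein a (fun _ => false) (Sum.inr w)).trans (by simp)
    have h3 : ∀ (b : B → Bool) (e : E₁ → Bool) (z : Z₂ → Bool),
        glue (Equiv.refl (Fin D₁.wires ⊕ Z₂)) (glue o₁ b e) z = glue g (glue i₂ b z) e := by
      intro b e z
      rw [glue_eq_iff]
      constructor
      · funext w
        obtain ⟨j, rfl⟩ := i₂.surjective w
        cases j with
        | inl j => simp [g, glue]
        | inr j => simp [g, glue]
      · funext w
        simp [g, glue]
    rw [sum_glue (Equiv.refl (Fin D₁.wires ⊕ Z₂)), sum_glue o₁]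
    simp only [h1, h2, extendOp_apply_glue (Equiv.refl (Fin D₁.wires ⊕ Z₂)) _ _ _ _ _ f₁
      (fun _ => rfl)]
    simp only [h3, extendOp_apply_glue g _ _ _ _ _ f₂ (fun _ => rfl)]
    refine Finset.sum_congr rfl fun b _ => ?_
    -- The second unitary is the identity on `E₁` and the first is the identity on `Z₂`; only the
    -- output b of the first circuit remains to be summed over.
    rw [Finset.sum_eq_single e₁ (fun e _ he => by simp [he.symm]) (by simp),
      Finset.sum_eq_single (fun _ => false) (fun z _ hz => by simp [hz]) (by simp)]
    simp
  simp only [krausMap, Matrix.mul_sum, Matrix.sum_mul]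
  rw [sum_glue (Equiv.refl (E₂ ⊕ E₁))]
  refine Finset.sum_congr rfl fun e₂ _ => Finset.sum_congr rfl fun e₁ _ => ?_
  have : glue (Equiv.refl (E₂ ⊕ E₁)) e₂ e₁ = Sum.elim e₂ e₁ := rfl
  rw [this, hK, Matrix.conjTranspose_mul]
  simp only [Matrix.mul_assoc]

/-- Kraus operators 1 ⊗ K act on the second factor alone. Product inputs are enough for the
reduction: once the message is fixed, the receiver's private register and the committer's reply are
in a product state. -/
lemma krausMap_tensor_one (K : (E → Bool) → Matrix (B → Bool) (A → Bool) ℂ)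
    (L : (E → Bool) → Matrix (R ⊕ B → Bool) (R ⊕ A → Bool) ℂ)
    (h : ∀ e u a, L e u a =
      if u ∘ Sum.inl = a ∘ Sum.inl then K e (u ∘ Sum.inr) (a ∘ Sum.inr) else 0)
    (ρ : QOp R) (σ : QOp A) :
    krausMap L (QOp.tensor ρ σ) = QOp.tensor ρ (krausMap K σ) := by
  ext u v
  simp only [QOp.tensor, Matrix.of_apply, krausMap_apply, Finset.mul_sum, h]
  refine Finset.sum_congr rfl fun e _ => ?_
  rw [sum_glue (Equiv.refl (R ⊕ A)), Finset.sum_comm]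
  refine Finset.sum_congr rfl fun a _ => ?_
  simp only [sum_glue (Equiv.refl (R ⊕ A)) (fun y => _ * (_ : ℂ))]
  have h1 : ∀ (p : R → Bool) (q : A → Bool), glue (Equiv.refl (R ⊕ A)) p q ∘ Sum.inl = p :=
    fun _ _ => rfl
  have h2 : ∀ (p : R → Bool) (q : A → Bool), glue (Equiv.refl (R ⊕ A)) p q ∘ Sum.inr = q :=
    fun _ _ => rfl
  simp only [h1, h2, apply_ite (starRingEnd ℂ), map_zero, mul_ite, ite_mul, mul_zero, zero_mul,
    Finset.sum_ite_irrel, Finset.sum_const_zero, Finset.sum_ite_eq, Finset.mem_univ, if_true]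
  exact Finset.sum_congr rfl fun _ _ => by ring

/-- Running a circuit next to an idle register. -/
theorem QCircuit.exists_idle (R : Type) [Fintype R] [DecidableEq R] (D : QCircuit A B) :
    ∃ D' : QCircuit (R ⊕ A) (R ⊕ B), D'.size ≤ D.size + 2 * Fintype.card R ∧
      ∀ ρ σ, D'.run (QOp.tensor ρ σ) = QOp.tensor ρ (D.run σ) := by
  classical
  let Z := {w // w ∉ Set.range D.input}
  let E := {w // w ∉ Set.range D.output}
  let i : A ⊕ Z ≃ _ := embedCompl D.input
  let o : B ⊕ E ≃ _ := embedCompl D.output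
  let ein : (R ⊕ A) ⊕ Z ≃ R ⊕ Fin D.wires :=
    (Equiv.sumAssoc _ _ _).trans ((Equiv.refl R).sumCongr i)
  let eout : (R ⊕ B) ⊕ E ≃ R ⊕ Fin D.wires :=
    (Equiv.sumAssoc _ _ _).trans ((Equiv.refl R).sumCongr o)
  obtain ⟨D', hs, hr⟩ := exists_circuit_kraus ein eout
    (D.gates.map (QGate.map Function.Embedding.inr))
  refine ⟨D', ?_, fun ρ σ => ?_⟩
  · rw [hs]; simp [QCircuit.size]; omega
  rw [hr, QCircuit.run_eq_krausMap D i o (embedCompl_inl _) (embedCompl_inl _)]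
  refine krausMap_tensor_one _ _ (fun e u a => ?_) ρ σ
  rw [gatesOp_map, extendOp_inr]
  simp only [krausOp, QOp.tensor, Matrix.of_apply, Matrix.one_apply]
  have h1 : glue eout u e ∘ Sum.inl = u ∘ Sum.inl := by
    funext r; exact glue_inl eout u e (Sum.inl r)
  have h2 : glue ein a (fun _ => false) ∘ Sum.inl = a ∘ Sum.inl := by
    funext r; exact glue_inl ein a (fun _ => false) (Sum.inl r)
  have h3 : glue eout u e ∘ Sum.inr = glue o (u ∘ Sum.inr) e := by
    rw [glue_eq_iff]
    exact ⟨by funext b; exact glue_inl eout u e (Sum.inr b),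
      by funext b; exact glue_inr eout u e b⟩
  have h4 : glue ein a (fun _ => false) ∘ Sum.inr = glue i (a ∘ Sum.inr) (fun _ => false) := by
    rw [glue_eq_iff]
    exact ⟨by funext b; exact glue_inl ein a (fun _ => false) (Sum.inr b),
      by funext b; exact glue_inr ein a (fun _ => false) b⟩
  rw [h1, h2, h3, h4]
  split_ifs <;> simp

/-- Sums over assignments of a product register, factor by factor. -/
lemma sum_prod_curry {Q : Type} [Fintype Q] [DecidableEq Q] (f : J → (Q → Bool) → ℂ) :
    ∑ x : J × Q → Bool, ∏ j, f j (fun q => x (j, q)) = ∏ j, ∑ y, f j y := by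
  rw [Finset.prod_univ_sum, Fintype.piFinset_univ]
  exact Equiv.sum_comp (Equiv.curry J Q Bool) fun z => ∏ j, f j (z j)

/-- The gates `l j` on the `j`-th copy of the wires, for each `j`. -/
noncomputable def familyGates (l : J → List (QGate W)) : List (QGate (J × W)) :=
  (Finset.univ : Finset J).toList.flatMap fun j =>
    (l j).map (QGate.map ⟨fun w => (j, w), fun _ _ h => (Prod.mk.inj h).2⟩)

lemma length_familyGates_le (l : J → List (QGate W)) (c : ℕ) (h : ∀ j, (l j).length ≤ c) :
    (familyGates l).length ≤ Fintype.card J * c := by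
  rw [familyGates, List.length_flatMap]
  simp only [List.length_map]
  calc _ ≤ ((Finset.univ : Finset J).toList.map fun j => (l j).length).length • c :=
        List.sum_le_card_nsmul _ _ (by simp only [List.mem_map]; rintro x ⟨j, -, rfl⟩; exact h j)
    _ = _ := by simp [Finset.card_univ]

/-- Gates on different copies act on different tensor factors, with the identity on copies not yet
visited. The sum over intermediate basis states in a matrix product therefore splits into one sum
per copy. -/
lemma gatesOp_flatMap (l : J → List (QGate W)) (s : List J) (hs : s.Nodup) (x y : J × W → Bool) :
    gatesOp (s.flatMap fun j =>
      (l j).map (QGate.map ⟨fun w => (j, w), fun _ _ h => (Prod.mk.inj h).2⟩)) x y =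
    ∏ j, (if j ∈ s then gatesOp (l j) else 1) (fun w => x (j, w)) (fun w => y (j, w)) := by
  classical
  induction s generalizing x y with
  | nil =>
    simp only [List.flatMap_nil, gatesOp_nil, List.not_mem_nil, if_false, Matrix.one_apply]
    rw [Finset.prod_ite_zero]
    simp [funext_iff]
  | cons j s ih =>
    obtain ⟨hj, hs⟩ := List.nodup_cons.1 hs
    rw [List.flatMap_cons, gatesOp_append, gatesOp_map, Matrix.mul_apply]
    let M : J → QOp W := fun k => if k = j then gatesOp (l j) else 1
    have hM : ∀ z, extendOp ⟨fun w => (j, w), fun _ _ h => (Prod.mk.inj h).2⟩ (gatesOp (l j)) z y =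
        ∏ k, M k (fun w => z (k, w)) (fun w => y (k, w)) := by
      intro z
      rw [Fintype.prod_eq_mul_prod_compl j]
      simp only [extendOp, Matrix.of_apply, M, if_true]
      have : ∀ k ∈ ({j} : Finset J)ᶜ, (if k = j then gatesOp (l j) else 1)
          (fun w => z (k, w)) (fun w => y (k, w)) =
          if (fun w => z (k, w)) = (fun w => y (k, w)) then 1 else 0 := by
        intro k hk
        rw [if_neg (by simpa using hk), Matrix.one_apply]
      rw [Finset.prod_congr rfl this, Finset.prod_ite_zero]
      have hiff : (∀ i, i ∉ Set.range
          (⟨fun w => (j, w), fun _ _ h => (Prod.mk.inj h).2⟩ : W ↪ J × W) → z i = y i) ↔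
          ∀ k ∈ ({j} : Finset J)ᶜ, (fun w => z (k, w)) = fun w => y (k, w) := by
        constructor
        · intro h k hk
          funext w
          refine h (k, w) ?_
          rintro ⟨w', hw'⟩
          simp only [Finset.mem_compl, Finset.mem_singleton] at hk
          exact hk (Prod.mk.inj hw').1.symm
        · rintro h ⟨k, w⟩ hk
          refine congrFun (h k ?_) w
          simp only [Finset.mem_compl, Finset.mem_singleton]
          rintro rfl
          exact hk ⟨w, rfl⟩
      simp only [hiff]
      split_ifs
      · simp; rfl
      · simp
    simp only [ih hs, hM, ← Finset.prod_mul_distrib]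
    rw [sum_prod_curry (fun k z => (if k ∈ s then gatesOp (l k) else 1) (fun w => x (k, w)) z *
      M k z (fun w => y (k, w)))]
    refine Finset.prod_congr rfl fun k _ => ?_
    rw [← Matrix.mul_apply]
    by_cases hk : k = j
    · subst hk; simp [M, hj]
    · simp [M, hk]

lemma gatesOp_familyGates (l : J → List (QGate W)) :
    gatesOp (familyGates l) = QOp.tensorFamily fun j => gatesOp (l j) := by
  ext x y
  rw [familyGates, gatesOp_flatMap _ _ (Finset.nodup_toList _)]
  simp [QOp.tensorFamily]

/-- Running a circuit on each of a family of registers. -/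
theorem QCircuit.exists_family (J : Type) [Fintype J] [DecidableEq J] (D : QCircuit A B) :
    ∃ D' : QCircuit (J × A) (J × B), D'.size ≤ Fintype.card J * D.size ∧
      ∀ ρ : J → QOp A, D'.run (QOp.tensorFamily ρ) = QOp.tensorFamily fun j => D.run (ρ j) := by
  classical
  let Z := {w // w ∉ Set.range D.input}
  let E := {w // w ∉ Set.range D.output}
  let i : A ⊕ Z ≃ _ := embedCompl D.input
  let o : B ⊕ E ≃ _ := embedCompl D.output
  let ein : (J × A) ⊕ (J × Z) ≃ J × Fin D.wires :=
    (Equiv.prodSumDistrib _ _ _).symm.trans ((Equiv.refl J).prodCongr i)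
  let eout : (J × B) ⊕ (J × E) ≃ J × Fin D.wires :=
    (Equiv.prodSumDistrib _ _ _).symm.trans ((Equiv.refl J).prodCongr o)
  obtain ⟨D', hs, hr⟩ := exists_circuit_kraus ein eout (familyGates fun _ : J => D.gates)
  refine ⟨D', ?_, fun ρ => ?_⟩
  · have := length_familyGates_le (fun _ : J => D.gates) _ (fun _ => le_rfl)
    rw [hs]; simp only [QCircuit.size, Fintype.card_prod, Fintype.card_fin]; nlinarith
  rw [hr]
  ext u v
  have hin : ∀ (a : J × A → Bool) j, (fun w => glue ein a (fun _ => false) (j, w)) =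
      glue i (fun q => a (j, q)) (fun _ => false) := by
    intro a j
    rw [glue_eq_iff]
    exact ⟨by funext q; exact glue_inl ein a (fun _ => false) (j, q),
      by funext q; exact glue_inr ein a (fun _ => false) (j, q)⟩
  have hout : ∀ (a : J × B → Bool) (e : J × E → Bool) j, (fun w => glue eout a e (j, w)) =
      glue o (fun q => a (j, q)) (fun q => e (j, q)) := by
    intro a e j
    rw [glue_eq_iff]
    exact ⟨by funext q; exact glue_inl eout a e (j, q),
      by funext q; exact glue_inr eout a e (j, q)⟩
  simp only [krausMap_apply, gatesOp_familyGates, krausOp, QOp.tensorFamily, Matrix.of_apply, hin,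
    hout, QCircuit.run_eq_krausMap D i o (embedCompl_inl _) (embedCompl_inl _), map_prod,
    ← Finset.prod_mul_distrib]
  rw [← sum_prod_curry fun j (e : E → Bool) => ∑ a, ∑ a', gatesOp D.gates (glue o (fun q => u (j, q)) e)
    (glue i a fun _ => false) * ρ j a a' *
    (starRingEnd ℂ) (gatesOp D.gates (glue o (fun q => v (j, q)) e) (glue i a' fun _ => false))]
  refine Finset.sum_congr rfl fun e _ => ?_
  rw [← sum_prod_curry fun j a => ∑ a', gatesOp D.gates (glue o (fun q => u (j, q)) fun q => e (j, q))
    (glue i a fun _ => false) * ρ j a a' * (starRingEnd ℂ) (gatesOp D.gates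
    (glue o (fun q => v (j, q)) fun q => e (j, q)) (glue i a' fun _ => false))]
  refine Finset.sum_congr rfl fun a _ => ?_
  exact sum_prod_curry fun j a' => gatesOp D.gates (glue o (fun q => u (j, q)) fun q => e (j, q))
    (glue i (fun q => a (j, q)) fun _ => false) * ρ j (fun q => a (j, q)) a' *
    (starRingEnd ℂ) (gatesOp D.gates (glue o (fun q => v (j, q)) fun q => e (j, q))
    (glue i a' fun _ => false))

end Kraus

/-! ### Density matrices and channels -/

section Density

variable {A B J Q : Type} [Fintype A] [Fintype B] [Fintype J] [Fintype Q]
  [DecidableEq A] [DecidableEq B] [DecidableEq J] [DecidableEq Q]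

open scoped ComplexOrder MatrixOrder Matrix.Norms.L2Operator

/-- This factorisation is multiplicative under tensor products, which is how positivity passes to
them. -/
lemma Matrix.PosSemidef.exists_eq_conjTranspose_mul {n : Type*} [Fintype n] [DecidableEq n]
    {M : Matrix n n ℂ} (hM : M.PosSemidef) : ∃ N : Matrix n n ℂ, M = N.conjTranspose * N :=
  CStarAlgebra.nonneg_iff_eq_star_mul_self.mp hM.nonneg

lemma tensorFamily_mul (M N : J → QOp Q) :
    QOp.tensorFamily M * QOp.tensorFamily N = QOp.tensorFamily fun j => M j * N j := by
  ext x y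
  simp only [QOp.tensorFamily, Matrix.mul_apply, Matrix.of_apply, ← Finset.prod_mul_distrib]
  exact sum_prod_curry fun j z => M j (fun q => x (j, q)) z * N j z (fun q => y (j, q))

lemma tensorFamily_conjTranspose (M : J → QOp Q) :
    (QOp.tensorFamily M).conjTranspose = QOp.tensorFamily fun j => (M j).conjTranspose := by
  ext x y
  simp [QOp.tensorFamily, Matrix.conjTranspose_apply]

lemma tensorFamily_trace (M : J → QOp Q) :
    (QOp.tensorFamily M).trace = ∏ j, (M j).trace := by
  simp only [QOp.tensorFamily, Matrix.trace, Matrix.diag, Matrix.of_apply]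
  exact sum_prod_curry fun j z => M j z z

lemma sum_sum_type {M : Type*} [AddCommMonoid M] (f : (A ⊕ B → Bool) → M) :
    ∑ x, f x = ∑ p : A → Bool, ∑ q : B → Bool, f (Sum.elim p q) :=
  sum_glue (Equiv.refl (A ⊕ B)) f

lemma tensor_mul (M M' : QOp A) (N N' : QOp B) :
    QOp.tensor M N * QOp.tensor M' N' = QOp.tensor (M * M') (N * N') := by
  ext x y
  simp only [QOp.tensor, Matrix.mul_apply, Matrix.of_apply]
  rw [sum_sum_type, Finset.sum_mul_sum]
  simp only [Sum.elim_comp_inl, Sum.elim_comp_inr]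
  exact Finset.sum_congr rfl fun _ _ => Finset.sum_congr rfl fun _ _ => by ring

lemma tensor_conjTranspose (M : QOp A) (N : QOp B) :
    (QOp.tensor M N).conjTranspose = QOp.tensor M.conjTranspose N.conjTranspose := by
  ext x y
  simp [QOp.tensor, Matrix.conjTranspose_apply]

lemma tensor_trace (M : QOp A) (N : QOp B) :
    (QOp.tensor M N).trace = M.trace * N.trace := by
  simp only [QOp.tensor, Matrix.trace, Matrix.diag, Matrix.of_apply]
  rw [sum_sum_type, Finset.sum_mul_sum]
  simp

lemma tensor_one_one : QOp.tensor (1 : QOp A) (1 : QOp B) = 1 := by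
  rw [← extendOp_inr, extendOp_one]

lemma QOp.IsDensity.tensor {ρ : QOp A} {σ : QOp B} (hρ : ρ.IsDensity) (hσ : σ.IsDensity) :
    (QOp.tensor ρ σ).IsDensity := by
  refine ⟨?_, by rw [tensor_trace, hρ.2, hσ.2, one_mul]⟩
  obtain ⟨M, hM⟩ := hρ.1.exists_eq_conjTranspose_mul
  obtain ⟨N, hN⟩ := hσ.1.exists_eq_conjTranspose_mul
  rw [hM, hN, ← tensor_mul, ← tensor_conjTranspose]
  exact Matrix.posSemidef_conjTranspose_mul_self _

lemma QOp.IsDensity.tensorFamily {ρ : J → QOp Q} (hρ : ∀ j, (ρ j).IsDensity) :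
    (QOp.tensorFamily ρ).IsDensity := by
  refine ⟨?_, by rw [tensorFamily_trace]; exact Finset.prod_eq_one fun j _ => (hρ j).2⟩
  choose M hM using fun j => (hρ j).1.exists_eq_conjTranspose_mul
  have : ρ = fun j => (M j).conjTranspose * M j := funext hM
  rw [this, ← tensorFamily_mul, ← tensorFamily_conjTranspose]
  exact Matrix.posSemidef_conjTranspose_mul_self _

lemma QOp.pure_eq_vecMulVec (v : EuclideanSpace ℂ (Q → Bool)) :
    QOp.pure v = Matrix.vecMulVec v.ofLp (star v.ofLp) := by
  ext x y; simp [QOp.pure, Matrix.vecMulVec_apply]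

lemma QOp.pure_trace (v : EuclideanSpace ℂ (Q → Bool)) : (QOp.pure v).trace = (‖v‖ ^ 2 : ℝ) := by
  rw [EuclideanSpace.norm_sq_eq]
  simp [QOp.pure, Matrix.trace, Complex.mul_conj, Complex.normSq_eq_norm_sq]

lemma QOp.IsDensity.pure {v : EuclideanSpace ℂ (Q → Bool)} (hv : ‖v‖ = 1) :
    (QOp.pure v).IsDensity := by
  refine ⟨?_, by rw [QOp.pure_trace, hv]; simp⟩
  rw [QOp.pure_eq_vecMulVec]
  exact Matrix.posSemidef_vecMulVec_self_star _

lemma QOp.basis_apply (z x y : Q → Bool) :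
    QOp.basis z x y = if z = x ∧ z = y then 1 else 0 := by
  simp [QOp.basis, Matrix.single_apply]

lemma QOp.IsDensity.basis (x : Q → Bool) : (QOp.basis x).IsDensity := by
  refine ⟨?_, by simp [QOp.basis]⟩
  have : QOp.basis x = QOp.basis x * (QOp.basis x).conjTranspose := by simp [QOp.basis]
  rw [this]
  exact Matrix.posSemidef_self_mul_conjTranspose _

lemma QOp.IsDensity.submatrix {ρ : QOp A} (hρ : ρ.IsDensity) (e : A ≃ B) :
    QOp.IsDensity (Q := B) (Matrix.submatrix ρ (fun x => x ∘ e) fun x => x ∘ e) := by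
  refine ⟨hρ.1.submatrix _, ?_⟩
  rw [← hρ.2]
  exact Equiv.sum_comp (e.symm.arrowCongr (Equiv.refl Bool)) fun x => ρ x x

lemma QOp.IsDensity.convex {ρ σ : QOp Q} (hρ : ρ.IsDensity) (hσ : σ.IsDensity) {η : ℝ}
    (h0 : 0 ≤ η) (h1 : η ≤ 1) : ((η : ℂ) • ρ + ((1 - η : ℝ) : ℂ) • σ).IsDensity := by
  refine ⟨(hρ.1.smul (by exact_mod_cast h0)).add
    (hσ.1.smul (by exact_mod_cast sub_nonneg.2 h1)), ?_⟩
  rw [Matrix.trace_add, Matrix.trace_smul, Matrix.trace_smul, hρ.2, hσ.2]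
  simp

/-- The Kraus operators of a circuit with respect to the complements of its input and output. -/
noncomputable def QCircuit.kraus (D : QCircuit A B) :
    ({w // w ∉ Set.range D.output} → Bool) → Matrix (B → Bool) (A → Bool) ℂ :=
  krausOp (embedCompl D.input) (embedCompl D.output) (gatesOp D.gates)

open Classical in
lemma QCircuit.run_eq_sum (D : QCircuit A B) (ρ : QOp A) :
    D.run ρ = ∑ e, D.kraus e * ρ * (D.kraus e).conjTranspose := by
  have := D.run_eq_krausMap (embedCompl D.input) (embedCompl D.output) (embedCompl_inl _)
    (embedCompl_inl _) ρ
  rw [this]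
  rfl

lemma QCircuit.run_add (D : QCircuit A B) (ρ σ : QOp A) : D.run (ρ + σ) = D.run ρ + D.run σ := by
  classical
  simp only [D.run_eq_sum, Matrix.mul_add, Matrix.add_mul, Finset.sum_add_distrib]

lemma QCircuit.run_smul (D : QCircuit A B) (c : ℂ) (ρ : QOp A) : D.run (c • ρ) = c • D.run ρ := by
  classical
  simp only [D.run_eq_sum, Matrix.mul_smul, Matrix.smul_mul, Finset.smul_sum]

/-- The channel of a circuit as a linear map. -/
noncomputable def QCircuit.runLin (D : QCircuit A B) : QOp A →ₗ[ℂ] QOp B where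
  toFun := D.run
  map_add' := D.run_add
  map_smul' := D.run_smul

lemma QCircuit.run_sum {ι : Type*} (s : Finset ι) (D : QCircuit A B) (ρ : ι → QOp A) :
    D.run (∑ i ∈ s, ρ i) = ∑ i ∈ s, D.run (ρ i) := map_sum D.runLin ρ s

/-- The sum of the K_e† K_e is the block of U†U on the basis states whose ancillas are 0, hence the
identity. -/
lemma QCircuit.run_trace (D : QCircuit A B) (ρ : QOp A) : (D.run ρ).trace = ρ.trace := by
  classical
  have hK : ∑ e, (D.kraus e).conjTranspose * D.kraus e = 1 := by
    ext a a'
    have hU := congrFun (congrFun (gatesOp_unitary D.gates)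
      (glue (embedCompl D.input) a fun _ => false)) (glue (embedCompl D.input) a' fun _ => false)
    rw [Matrix.mul_apply, sum_glue (embedCompl D.output), Finset.sum_comm] at hU
    simp only [Matrix.sum_apply, Matrix.mul_apply]
    refine hU.trans ?_
    simp only [Matrix.one_apply, glue_inj, and_true]
  rw [D.run_eq_sum, Matrix.trace_sum]
  calc _ = ∑ e, (((D.kraus e).conjTranspose * D.kraus e) * ρ).trace :=
        Finset.sum_congr rfl fun e _ => by rw [Matrix.trace_mul_comm, Matrix.mul_assoc]
    _ = _ := by rw [← Matrix.trace_sum, ← Matrix.sum_mul, hK, Matrix.one_mul]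

lemma QCircuit.run_posSemidef (D : QCircuit A B) {ρ : QOp A} (hρ : ρ.PosSemidef) :
    (D.run ρ).PosSemidef := by
  classical
  rw [D.run_eq_sum]
  exact Matrix.posSemidef_sum _ fun e _ => hρ.mul_mul_conjTranspose_same _

lemma QOp.IsDensity.run {ρ : QOp A} (hρ : ρ.IsDensity) (D : QCircuit A B) :
    (D.run ρ).IsDensity :=
  ⟨D.run_posSemidef hρ.1, by rw [D.run_trace, hρ.2]⟩

lemma QOp.probOne_add (ρ σ : QOp Unit) : (ρ + σ).probOne = ρ.probOne + σ.probOne := by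
  simp [QOp.probOne]

lemma QOp.probOne_smul (c : ℝ) (ρ : QOp Unit) : ((c : ℂ) • ρ).probOne = c * ρ.probOne := by
  simp [QOp.probOne]

lemma QOp.probOne_sum {ι : Type*} (s : Finset ι) (ρ : ι → QOp Unit) :
    (∑ i ∈ s, ρ i).probOne = ∑ i ∈ s, (ρ i).probOne := by
  simp [QOp.probOne, Matrix.sum_apply]

lemma QOp.IsDensity.probOne_nonneg {ρ : QOp Unit} (hρ : ρ.IsDensity) : 0 ≤ ρ.probOne :=
  (Complex.le_def.1 hρ.1.diag_nonneg).1

lemma QOp.IsDensity.probOne_le_one {ρ : QOp Unit} (hρ : ρ.IsDensity) : ρ.probOne ≤ 1 := by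
  have h := hρ.2
  rw [Matrix.trace, sum_unit_bool] at h
  have h0 : 0 ≤ (ρ (fun _ => false) (fun _ => false)).re :=
    (Complex.le_def.1 (hρ.1.diag_nonneg (i := fun _ => false))).1
  have h1 := congrArg Complex.re h
  simp only [Matrix.diag_apply, Complex.add_re, Complex.one_re] at h1
  rw [QOp.probOne]; linarith

end Density

/-! ### Elementary circuits -/

section Elementary

variable {A B J Q W : Type} [Fintype A] [Fintype B] [Fintype J] [Fintype Q] [Fintype W]
  [DecidableEq A] [DecidableEq B] [DecidableEq J] [DecidableEq Q] [DecidableEq W]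

lemma sum_empty_bool {M : Type*} [AddCommMonoid M] (f : (Empty → Bool) → M) :
    ∑ x, f x = f Empty.elim := by
  rw [Fintype.sum_unique]; congr; exact Subsingleton.elim _ _

/-- Renaming the qubits of a register. -/
theorem QCircuit.exists_relabel (e : A ≃ B) :
    ∃ D : QCircuit A B, D.size ≤ 2 * Fintype.card A ∧
      ∀ ρ, D.run ρ = Matrix.of fun u v => ρ (u ∘ e) (v ∘ e) := by
  obtain ⟨D, hs, hr⟩ := exists_circuit_kraus (Equiv.sumEmpty A Empty)
    ((Equiv.sumEmpty B Empty).trans e.symm) []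
  refine ⟨D, by simp [hs], fun ρ => ?_⟩
  ext u v
  have h : ∀ (w : B → Bool) (q : Empty → Bool) (a : A → Bool) (z : Empty → Bool),
      glue ((Equiv.sumEmpty B Empty).trans e.symm) w q = glue (Equiv.sumEmpty A Empty) a z ↔
      a = w ∘ e := by
    intro w q a z
    rw [glue_eq_iff, eq_comm (a := a)]
    constructor
    · rintro ⟨h, -⟩
      rw [← h]
      funext i
      exact (glue_inl ((Equiv.sumEmpty B Empty).trans e.symm) w q (e i)).symm.trans (by simp)
    · rintro h
      refine ⟨?_, funext fun i => i.elim⟩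
      rw [← h]
      funext i
      exact Eq.trans (by simp) (glue_inl ((Equiv.sumEmpty B Empty).trans e.symm) w q (e i))
  simp [hr, krausMap_apply, krausOp, Matrix.one_apply, h]

/-- Discarding the first of two registers. -/
theorem QCircuit.exists_discard (A B : Type) [Fintype A] [Fintype B] [DecidableEq A]
    [DecidableEq B] :
    ∃ D : QCircuit (A ⊕ B) B, D.size ≤ 2 * (Fintype.card A + Fintype.card B) ∧
      ∀ (ρ : QOp A) (σ : QOp B), D.run (QOp.tensor ρ σ) = ρ.trace • σ := by
  obtain ⟨D, hs, hr⟩ := exists_circuit_kraus (Equiv.sumEmpty (A ⊕ B) Empty)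
    (Equiv.sumComm B A) []
  refine ⟨D, by simp [hs], fun ρ σ => ?_⟩
  ext u v
  have h : ∀ (w : B → Bool) (q : A → Bool) (a : A ⊕ B → Bool) (z : Empty → Bool),
      glue (Equiv.sumComm B A) w q = glue (Equiv.sumEmpty (A ⊕ B) Empty) a z ↔
      a = Sum.elim q w := by
    intro w q a z
    rw [glue_eq_iff, eq_comm (a := a)]
    have : (fun i => glue (Equiv.sumComm B A) w q (Equiv.sumEmpty (A ⊕ B) Empty (Sum.inl i)))
        = Sum.elim q w := by
      funext i
      cases i <;> rfl
    rw [this]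
    exact and_iff_left (funext fun i => i.elim)
  simp [hr, krausMap_apply, krausOp, Matrix.one_apply, h, QOp.tensor, Matrix.trace,
    Finset.sum_mul]

/-- Putting a fresh qubit in front of a register. -/
theorem QCircuit.exists_flag (A : Type) [Fintype A] [DecidableEq A] :
    ∃ D : QCircuit A (Unit ⊕ A), D.size ≤ 2 * (1 + Fintype.card A) ∧
      ∀ ρ : QOp A, D.run ρ = QOp.tensor (QOp.basis fun _ : Unit => false) ρ := by
  obtain ⟨D, hs, hr⟩ := exists_circuit_kraus (Equiv.sumComm A Unit)
    (Equiv.sumEmpty (Unit ⊕ A) Empty) []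
  refine ⟨D, by simp [hs], fun ρ => ?_⟩
  ext u v
  have h : ∀ (w : Unit ⊕ A → Bool) (q : Empty → Bool) (a : A → Bool) (z : Unit → Bool),
      glue (Equiv.sumEmpty (Unit ⊕ A) Empty) w q = glue (Equiv.sumComm A Unit) a z ↔
      w ∘ Sum.inr = a ∧ z = w ∘ Sum.inl := by
    intro w q a z
    rw [glue_eq_iff, eq_comm (a := z)]
    rfl
  simp only [hr, krausMap_apply, krausOp, Matrix.of_apply, gatesOp_nil, Matrix.one_apply, h,
    QOp.tensor, QOp.basis_apply]
  have key : ∀ (P P' : Prop) [Decidable P] [Decidable P'] (a b : A → Bool),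
      ∑ _ : Empty → Bool, ∑ x, ∑ x', (if a = x ∧ P then 1 else 0) * ρ x x' *
        (starRingEnd ℂ) (if b = x' ∧ P' then 1 else 0) = (if P ∧ P' then 1 else 0) * ρ a b := by
    intro P P' _ _ a b
    by_cases h1 : P <;> by_cases h2 : P' <;> simp [h1, h2]
  exact key _ _ _ _

/-- Applying a list of gates. -/
theorem QCircuit.exists_gates (l : List (QGate W)) :
    ∃ D : QCircuit W W, D.size ≤ l.length + 2 * Fintype.card W ∧
      ∀ ρ, D.run ρ = gatesOp l * ρ * (gatesOp l).conjTranspose := by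
  obtain ⟨D, hs, hr⟩ := exists_circuit_kraus (Equiv.sumEmpty W Empty) (Equiv.sumEmpty W Empty) l
  refine ⟨D, by simp [hs], fun ρ => ?_⟩
  rw [hr, krausMap, sum_empty_bool]
  have h : ∀ (w : W → Bool) (q : Empty → Bool), glue (Equiv.sumEmpty W Empty) w q = w := by
    intro w q
    rfl
  have : krausOp (Equiv.sumEmpty W Empty) (Equiv.sumEmpty W Empty) (gatesOp l) Empty.elim =
      gatesOp l := by
    ext x y; simp [krausOp, h]
  rw [this]

/-- The operator of a map of basis states. -/
noncomputable def basisMap (φ : (W → Bool) → W → Bool) : QOp W :=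
  Matrix.of fun x y => if x = φ y then 1 else 0

lemma basisMap_id : basisMap (id : (W → Bool) → W → Bool) = 1 := by
  ext x y; simp [basisMap, Matrix.one_apply]

lemma basisMap_mul (φ ψ : (W → Bool) → W → Bool) :
    basisMap φ * basisMap ψ = basisMap (φ ∘ ψ) := by
  ext x y
  simp [basisMap, Matrix.mul_apply]

lemma QGate.toOp_cnot (c t : W) (h : c ≠ t) :
    (QGate.cnot c t h).toOp = basisMap fun y => Function.update y t (xor (y t) (y c)) := rfl

/-- The controls never change and each target is hit at most once, so the gates do not interact. On
targets initialized to 0 the effect is to copy basis states. -/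
lemma gatesOp_copy (s : List Q) (hs : s.Nodup) :
    gatesOp (s.map fun q => QGate.cnot (Sum.inl q : Q ⊕ Q) (Sum.inr q) (by simp)) =
      basisMap fun y => Sum.elim (y ∘ Sum.inl)
        fun q => if q ∈ s then xor (y (Sum.inr q)) (y (Sum.inl q)) else y (Sum.inr q) := by
  induction s with
  | nil =>
    rw [List.map_nil, gatesOp_nil, ← basisMap_id]
    congr 1
    funext y i
    cases i <;> simp
  | cons q s ih =>
    obtain ⟨hq, hs⟩ := List.nodup_cons.1 hs
    rw [List.map_cons, gatesOp_cons, ih hs, QGate.toOp_cnot, basisMap_mul]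
    congr 1
    funext y i
    cases i with
    | inl i => simp
    | inr i =>
      by_cases hi : i = q
      · subst hi; simp [hq]
      · simp [hi]

/-- Measuring a register in the computational basis. -/
theorem QCircuit.exists_measured (Q : Type) [Fintype Q] [DecidableEq Q] :
    ∃ D : QCircuit Q Q, D.size ≤ 5 * Fintype.card Q ∧ ∀ ρ, D.run ρ = ρ.measured := by
  obtain ⟨D, hs, hr⟩ := exists_circuit_kraus (Equiv.refl (Q ⊕ Q)) (Equiv.refl (Q ⊕ Q))
    ((Finset.univ : Finset Q).toList.map fun q => QGate.cnot (Sum.inl q) (Sum.inr q) (by simp))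
  refine ⟨D, ?_, fun ρ => ?_⟩
  · simp only [hs, List.length_map, Finset.length_toList, Finset.card_univ, Fintype.card_sum]
    omega
  ext u v
  -- Copying onto fresh qubits and tracing the copies out has the projections |e⟩⟨e| as Kraus
  -- operators; conjugating by them and summing erases the off-diagonal entries.
  have h : ∀ u e a : Q → Bool, krausOp (Equiv.refl (Q ⊕ Q)) (Equiv.refl (Q ⊕ Q))
      (gatesOp ((Finset.univ : Finset Q).toList.map fun q =>
        QGate.cnot (Sum.inl q) (Sum.inr q) (by simp))) e u a =
      if u = e ∧ e = a then 1 else 0 := by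
    intro u e a
    rw [gatesOp_copy _ (Finset.nodup_toList _)]
    simp only [krausOp, basisMap, Matrix.of_apply]
    refine if_congr ?_ rfl rfl
    rw [eq_comm]
    refine (glue_eq_iff (Equiv.refl (Q ⊕ Q)) u e _).trans ?_
    have h1 : (fun q => Sum.elim ((glue (Equiv.refl (Q ⊕ Q)) a fun _ => false) ∘ Sum.inl)
        (fun q => if q ∈ (Finset.univ : Finset Q).toList then
          xor ((glue (Equiv.refl (Q ⊕ Q)) a fun _ => false) (Sum.inr q))
            ((glue (Equiv.refl (Q ⊕ Q)) a fun _ => false) (Sum.inl q))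
          else (glue (Equiv.refl (Q ⊕ Q)) a fun _ => false) (Sum.inr q))
        (Equiv.refl (Q ⊕ Q) (Sum.inl q))) = a := by
      funext q; rfl
    have h2 : (fun q => Sum.elim ((glue (Equiv.refl (Q ⊕ Q)) a fun _ => false) ∘ Sum.inl)
        (fun q => if q ∈ (Finset.univ : Finset Q).toList then
          xor ((glue (Equiv.refl (Q ⊕ Q)) a fun _ => false) (Sum.inr q))
            ((glue (Equiv.refl (Q ⊕ Q)) a fun _ => false) (Sum.inl q))
          else (glue (Equiv.refl (Q ⊕ Q)) a fun _ => false) (Sum.inr q))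
        (Equiv.refl (Q ⊕ Q) (Sum.inr q))) = a := by
      funext q
      simp [glue]
    rw [h1, h2]
    exact ⟨fun ⟨h1, h2⟩ => ⟨h1 ▸ h2, h2.symm⟩, fun ⟨h1, h2⟩ => ⟨(h1.trans h2).symm, h2.symm⟩⟩
  rw [hr, krausMap_apply]
  simp only [h, QOp.measured, Matrix.diagonal_apply]
  by_cases huv : u = v
  · subst huv
    rw [Finset.sum_eq_single u, Finset.sum_eq_single u, Finset.sum_eq_single u] <;>
      simp +contextual [eq_comm]
  · rw [if_neg huv]
    refine Finset.sum_eq_zero fun e _ => Finset.sum_eq_zero fun a _ =>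
      Finset.sum_eq_zero fun a' _ => ?_
    by_cases h1 : u = e
    · subst h1; simp [Ne.symm huv]
    · simp [h1]

end Elementary

/-! ### Pauli operators as gate lists -/

section Pauli

lemma exp_I_pi_div_four_pow_two : Complex.exp (Complex.I * (Real.pi / 4)) ^ 2 = Complex.I := by
  rw [← Complex.exp_nat_mul]
  convert Complex.exp_pi_div_two_mul_I using 2
  push_cast; ring

lemma exp_I_pi_div_four_pow_four : Complex.exp (Complex.I * (Real.pi / 4)) ^ 4 = -1 := by
  rw [show (4 : ℕ) = 2 * 2 from rfl, pow_mul, exp_I_pi_div_four_pow_two, Complex.I_sq]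

lemma gatesOp_replicate_tGate {W : Type} [Fintype W] [DecidableEq W] (i : W) (k : ℕ) :
    gatesOp (List.replicate k (QGate.tGate i)) =
      Matrix.diagonal fun x => if x i then Complex.exp (Complex.I * (Real.pi / 4)) ^ k else 1 := by
  induction k with
  | zero => simp
  | succ k ih =>
    rw [List.replicate_succ, gatesOp_cons, ih, QGate.toOp, Matrix.diagonal_mul_diagonal]
    congr 1
    funext x
    split_ifs <;> simp [pow_succ]

/-- A one-qubit matrix as an operator. -/
def unitOp (M : Matrix Bool Bool ℂ) : QOp Unit := Matrix.of fun x y => M (x ()) (y ())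

lemma unitOp_mul (M N : Matrix Bool Bool ℂ) : unitOp M * unitOp N = unitOp (M * N) := by
  ext x y
  simp [unitOp, Matrix.mul_apply, sum_unit_bool, add_comm]

lemma diagonal_unit (f : Bool → ℂ) :
    (Matrix.diagonal fun x : Unit → Bool => f (x ())) = unitOp (Matrix.diagonal f) := by
  ext x y
  have : x = y ↔ x () = y () := ⟨fun h => h ▸ rfl, fun h => funext fun _ => h⟩
  simp only [unitOp, Matrix.of_apply, Matrix.diagonal_apply, this]

lemma inv_sqrt_two_mul_self : ((Real.sqrt 2 : ℝ) : ℂ)⁻¹ * ((Real.sqrt 2 : ℝ) : ℂ)⁻¹ = 2⁻¹ := by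
  rw [← mul_inv, ← Complex.ofReal_mul, Real.mul_self_sqrt (by norm_num)]; norm_num

lemma QGate.toOp_hadamard_unit : (QGate.hadamard ()).toOp =
    unitOp (Matrix.of fun x y => (if x && y then -1 else 1) * ((Real.sqrt 2 : ℝ) : ℂ)⁻¹) := by
  ext x y
  simp [QGate.toOp, unitOp]

/-- Gates for the one-qubit Pauli operators. -/
def pauliGates1 : Bool → Bool → List (QGate Unit)
  | false, false => []
  | false, true => List.replicate 4 (.tGate ())
  | true, false => .hadamard () :: (List.replicate 4 (.tGate ()) ++ [.hadamard ()])
  | true, true => List.replicate 6 (.tGate ()) ++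
      (.hadamard () :: (List.replicate 4 (.tGate ()) ++ [.hadamard ()]) ++
        List.replicate 2 (.tGate ()))

lemma gatesOp_pauliX :
    gatesOp (.hadamard () :: (List.replicate 4 (.tGate ()) ++ [.hadamard ()])) =
      unitOp (pauli1 true false) := by
  rw [gatesOp_cons, gatesOp_append, gatesOp_replicate_tGate, gatesOp_cons, gatesOp_nil,
    Matrix.one_mul, exp_I_pi_div_four_pow_four,
    diagonal_unit (fun b => if b then (-1 : ℂ) else 1), QGate.toOp_hadamard_unit, unitOp_mul,
    unitOp_mul]
  congr 1
  ext a b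
  cases a <;> cases b <;>
    simp [Matrix.mul_apply, pauli1, Matrix.diagonal_apply, inv_sqrt_two_mul_self] <;> norm_num

/-- Z = T⁴, X = H Z H and Y = S X S⁻¹ with S = T² and S⁻¹ = T⁶, each without a leftover phase. -/
lemma gatesOp_pauliGates1 (a c : Bool) : gatesOp (pauliGates1 a c) = unitOp (pauli1 a c) := by
  have h6 : Complex.exp (Complex.I * (Real.pi / 4)) ^ 6 = -Complex.I := by
    rw [show (6 : ℕ) = 2 + 4 from rfl, pow_add, exp_I_pi_div_four_pow_two,
      exp_I_pi_div_four_pow_four]; ring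
  cases a <;> cases c
  · ext x y
    have : x = y ↔ x () = y () := ⟨fun h => h ▸ rfl, fun h => funext fun _ => h⟩
    simp only [pauliGates1, gatesOp_nil, unitOp, pauli1, Matrix.of_apply, Matrix.one_apply, this]
  · rw [pauliGates1, gatesOp_replicate_tGate, exp_I_pi_div_four_pow_four,
      diagonal_unit (fun b => if b then (-1 : ℂ) else 1), pauli1]
  · exact gatesOp_pauliX
  · rw [pauliGates1, gatesOp_append, gatesOp_append, gatesOp_pauliX, gatesOp_replicate_tGate,
      gatesOp_replicate_tGate, h6, exp_I_pi_div_four_pow_two,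
      diagonal_unit (fun b => if b then Complex.I else 1),
      diagonal_unit (fun b => if b then -Complex.I else 1), unitOp_mul, unitOp_mul]
    congr 1
    ext a b
    cases a <;> cases b <;> simp [Matrix.mul_apply, pauli1, Matrix.diagonal_apply]

variable {n : ℕ}

/-- Gates for the operator `I ⊗ P ^ b`. -/
noncomputable def pauliMaskGates (p : Fin n × Fin 2 → Bool) (b : Bool) :
    List (QGate (Unit ⊕ Fin n)) :=
  if b then
    ((familyGates fun i : Fin n => pauliGates1 (p (i, 0)) (p (i, 1))).map
      (QGate.map (Equiv.prodPUnit (Fin n)).toEmbedding)).map (QGate.map Function.Embedding.inr)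
  else []

lemma length_pauliMaskGates (p : Fin n × Fin 2 → Bool) (b : Bool) :
    (pauliMaskGates p b).length ≤ 14 * n := by
  cases b
  · simp [pauliMaskGates]
  -- The longest case is Y, with 6 + 6 + 2 gates.
  · have := length_familyGates_le (fun i : Fin n => pauliGates1 (p (i, 0)) (p (i, 1))) 14 (by
      intro i
      cases p (i, 0) <;> cases p (i, 1) <;> simp [pauliGates1])
    simp only [pauliMaskGates, if_true, List.length_map]
    simpa [mul_comm] using this

lemma gatesOp_pauliMaskGates (p : Fin n × Fin 2 → Bool) (b : Bool) :
    gatesOp (pauliMaskGates p b) = pauliMask p b := by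
  cases b
  · simp [pauliMaskGates, pauliMask, tensor_one_one]
  · simp only [pauliMaskGates, if_true, pauliMask]
    rw [gatesOp_map, extendOp_inr, gatesOp_map, gatesOp_familyGates]
    congr 1
    ext x y
    rw [extendOp_equiv_apply]
    simp only [QOp.tensorFamily, gatesOp_pauliGates1, unitOp, pauliOp, Matrix.of_apply]
    rfl

lemma pauli1_conjTranspose (a c : Bool) : (pauli1 a c).conjTranspose = pauli1 a c := by
  ext x y
  cases a <;> cases c <;> cases x <;> cases y <;>
    simp [pauli1, Matrix.conjTranspose_apply]

lemma pauliOp_conjTranspose (p : Fin n × Fin 2 → Bool) :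
    (pauliOp p).conjTranspose = pauliOp p := by
  ext x y
  simp only [Matrix.conjTranspose_apply, pauliOp, Matrix.of_apply, star_prod]
  refine Finset.prod_congr rfl fun i _ => ?_
  have := congrFun (congrFun (pauli1_conjTranspose (p (i, 0)) (p (i, 1))) (x i)) (y i)
  rwa [Matrix.conjTranspose_apply] at this

lemma pauliMask_conjTranspose (p : Fin n × Fin 2 → Bool) (b : Bool) :
    (pauliMask p b).conjTranspose = pauliMask p b := by
  rw [pauliMask, tensor_conjTranspose]
  cases b <;> simp [pauliOp_conjTranspose]

/-- The mask is unitary, being computed by gates, and it is Hermitian; hence it is an involution.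
Restricting to one value of the flag gives the claim for P. -/
lemma pauliOp_mul_self (p : Fin n × Fin 2 → Bool) : pauliOp p * pauliOp p = 1 := by
  have h := gatesOp_unitary (pauliMaskGates p true)
  rw [gatesOp_pauliMaskGates, pauliMask_conjTranspose, pauliMask, tensor_mul,
    ← tensor_one_one] at h
  ext x y
  have := congrFun (congrFun h (Sum.elim (fun _ => false) x)) (Sum.elim (fun _ => false) y)
  change (1 * 1 : QOp Unit) (fun _ => false) (fun _ => false) * (pauliOp p * pauliOp p) x y =
    (1 : QOp Unit) (fun _ => false) (fun _ => false) * (1 : QOp (Fin n)) x y at this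
  simpa using this

end Pauli

/-! ### The swap test -/

section SwapTest

variable {V W R : Type} [Fintype V] [Fintype W] [Fintype R] [DecidableEq V] [DecidableEq W]
  [DecidableEq R]

/-- The action of a list of `CNOT` and `T` gates on a basis state: the new basis state, and the
number of factors `exp (i π / 4)`. -/
def phaseAction : List (QGate W) → (W → Bool) → (W → Bool) × ℕ
  | [], y => (y, 0)
  | .hadamard _ :: l, y => phaseAction l y
  | .tGate i :: l, y => ((phaseAction l y).1, (phaseAction l y).2 + if y i then 1 else 0)
  | .cnot c t _ :: l, y => phaseAction l (Function.update y t (xor (y t) (y c)))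

/-- Whether a gate is a Hadamard gate. -/
def QGate.isHadamard : QGate W → Bool
  | .hadamard _ => true
  | _ => false

lemma gatesOp_eq_phaseAction (l : List (QGate W)) (h : ∀ g ∈ l, g.isHadamard = false) :
    gatesOp l = Matrix.of fun x y => if x = (phaseAction l y).1 then
      Complex.exp (Complex.I * (Real.pi / 4)) ^ (phaseAction l y).2 else 0 := by
  induction l with
  | nil => ext x y; simp [phaseAction, Matrix.one_apply]
  | cons g l ih =>
    rw [gatesOp_cons, ih fun g hg => h g (List.mem_cons_of_mem _ hg)]
    ext x y
    cases g with
    | hadamard i => simpa [QGate.isHadamard] using h _ List.mem_cons_self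
    | tGate i =>
      simp only [QGate.toOp, Matrix.mul_diagonal, Matrix.of_apply, phaseAction]
      split_ifs <;> simp [pow_succ]
    | cnot c t hct =>
      rw [QGate.toOp_cnot, Matrix.mul_apply]
      simp [basisMap, phaseAction]
      rfl

/-- Gates for the sign `(-1) ^ (a b c)` on three qubits. -/
def cczGates : List (QGate (Fin 3)) :=
  List.flatten [[.tGate 0, .tGate 1, .tGate 2, .cnot 0 1 zero_ne_one],
    List.replicate 7 (.tGate 1),
    [.cnot 1 2 (by decide), .tGate 2, .cnot 0 1 zero_ne_one, .cnot 1 2 (by decide)],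
    List.replicate 7 (.tGate 2), [.cnot 0 2 (by decide), .cnot 1 2 (by decide)],
    List.replicate 7 (.tGate 2), [.cnot 1 2 (by decide)]]

/-- With ω = exp(iπ/4) and ω⁴ = -1, the identity 4abc = a + b + c - (a⊕b) - (a⊕c) - (b⊕c) + (a⊕b⊕c)
writes the sign as a product of T and T⁻¹ phases on parities, which the `CNOT` gates compute in
place. Since T⁸ = 1, seven T gates serve as T⁻¹, and the count of phases matters only modulo 8. -/
lemma gatesOp_cczGates : gatesOp cczGates =
    Matrix.diagonal fun y => if y 0 && y 1 && y 2 then -1 else 1 := by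
  have h1 : ∀ y, (phaseAction cczGates y).1 = y := by decide +kernel
  have h2 : ∀ y, (phaseAction cczGates y).2 % 8 = if y 0 && y 1 && y 2 then 4 else 0 := by decide +kernel
  have h8 : Complex.exp (Complex.I * (Real.pi / 4)) ^ 8 = 1 := by
    rw [show (8 : ℕ) = 4 * 2 from rfl, pow_mul, exp_I_pi_div_four_pow_four]; norm_num
  rw [gatesOp_eq_phaseAction _ (by decide)]
  ext x y
  rw [Matrix.of_apply, h1, Matrix.diagonal_apply]
  by_cases hxy : x = y
  · subst hxy
    rw [if_pos rfl, if_pos rfl, ← Nat.div_add_mod (phaseAction cczGates x).2 8, pow_add, pow_mul,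
      h8, one_pow, one_mul, h2]
    split_ifs
    · exact exp_I_pi_div_four_pow_four
    · simp
  · rw [if_neg hxy, if_neg hxy]

lemma hadamard_mul_self (i : W) : (QGate.hadamard i).toOp * (QGate.hadamard i).toOp = 1 := by
  have h : (QGate.hadamard i).toOp.conjTranspose = (QGate.hadamard i).toOp := by
    ext x y
    simp only [QGate.toOp, Matrix.conjTranspose_apply, Matrix.of_apply, Bool.and_comm (y i),
      eq_comm (a := y _)]
    split_ifs <;> simp
  conv_lhs => rw [← h]
  rw [h]
  conv_lhs => arg 1; rw [← h]
  exact QGate.toOp_unitary _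

/-- Gates that swap the last two of three qubits if the first is `1`. -/
def cswapGates : List (QGate (Fin 3)) :=
  .cnot 2 1 (by decide) :: (.hadamard 2 :: (cczGates ++ [.hadamard 2]) ++
    [.cnot 2 1 (by decide)])

/-- The controlled swap on basis states. -/
def cswapMap (y : Fin 3 → Bool) : Fin 3 → Bool :=
  fun i => y (if y 0 then Equiv.swap 1 2 i else i)

lemma basisMap_mul_apply (φ ψ : (W → Bool) → W → Bool) (h : ∀ x y, x = φ y ↔ y = ψ x) (M : QOp W)
    (x y : W → Bool) : (basisMap φ * M) x y = M (ψ x) y := by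
  rw [Matrix.mul_apply, Finset.sum_eq_single (ψ x)]
  · rw [basisMap, Matrix.of_apply, if_pos ((h x _).2 rfl), one_mul]
  · intro z _ hz
    rw [basisMap, Matrix.of_apply, if_neg fun e => hz ((h x z).1 e), zero_mul]
  · simp

/-- Conjugation by a Hadamard gate on the target turns the doubly controlled Z into a doubly
controlled X. -/
lemma gatesOp_toffoli : gatesOp (.hadamard 2 :: (cczGates ++ [.hadamard 2])) =
    basisMap fun y : Fin 3 → Bool => Function.update y 2 (xor (y 2) (y 0 && y 1)) := by
  rw [gatesOp_cons, gatesOp_append, gatesOp_cczGates, gatesOp_cons, gatesOp_nil, Matrix.one_mul]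
  have hinv : ∀ x y : Fin 3 → Bool, x = Function.update y 2 (xor (y 2) (y 0 && y 1)) ↔
      y = Function.update x 2 (xor (x 2) (x 0 && x 1)) := by
    have : ∀ y : Fin 3 → Bool, Function.update (Function.update y 2 (xor (y 2) (y 0 && y 1))) 2
        (xor (xor (y 2) (y 0 && y 1)) (y 0 && y 1)) = y := by
      intro y; simp
    intro x y
    constructor <;> rintro rfl <;> simp
  have key : (QGate.hadamard 2).toOp * (Matrix.diagonal fun y : Fin 3 → Bool =>
      if y 0 && y 1 && y 2 then (-1 : ℂ) else 1) =
      (basisMap fun y : Fin 3 → Bool => Function.update y 2 (xor (y 2) (y 0 && y 1))) *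
        (QGate.hadamard 2).toOp := by
    ext x y
    rw [Matrix.mul_diagonal, basisMap_mul_apply _ _ hinv]
    simp only [QGate.toOp, Matrix.of_apply]
    have hc : (∀ j, j ≠ 2 → Function.update x 2 (xor (x 2) (x 0 && x 1)) j = y j) ↔
        ∀ j, j ≠ 2 → x j = y j :=
      forall₂_congr fun j hj => by rw [Function.update_of_ne hj]
    simp only [hc, Function.update_self]
    by_cases h : ∀ j, j ≠ 2 → x j = y j
    · rw [if_pos h, if_pos h, h 0 (by decide), h 1 (by decide)]
      cases y 0 <;> cases y 1 <;> cases y 2 <;> cases x 2 <;> simp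
    · simp [h]
  rw [key, Matrix.mul_assoc, hadamard_mul_self, Matrix.mul_one]

/-- A swap is three alternating `CNOT` gates. It is enough to control the middle one, since the
outer two cancel when the middle one is off. -/
lemma gatesOp_cswapGates : gatesOp cswapGates = basisMap cswapMap := by
  rw [cswapGates, gatesOp_cons, gatesOp_append, gatesOp_toffoli, gatesOp_cons, gatesOp_nil,
    Matrix.one_mul, QGate.toOp_cnot, basisMap_mul, basisMap_mul]
  congr 1
  funext y
  revert y
  decide +kernel

lemma extendOp_basisMap (f : V ↪ W) (φ : (V → Bool) → V → Bool) (ψ : (W → Bool) → W → Bool)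
    (h₁ : ∀ y, ψ y ∘ f = φ (y ∘ f)) (h₂ : ∀ y j, j ∉ Set.range f → ψ y j = y j) :
    extendOp f (basisMap φ) = basisMap ψ := by
  classical
  ext x y
  simp only [extendOp, basisMap, Matrix.of_apply, ← ite_and]
  refine if_congr ?_ rfl rfl
  constructor
  · rintro ⟨h, h'⟩
    funext j
    by_cases hj : j ∈ Set.range f
    · obtain ⟨v, rfl⟩ := hj
      exact congrFun (h'.trans (h₁ y).symm) v
    · rw [h j hj, h₂ y j hj]
  · rintro rfl
    exact ⟨fun j hj => h₂ y j hj, h₁ y⟩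

/-- The wires of the `r`-th controlled swap. -/
def swapWires (r : R) : Fin 3 ↪ (R ⊕ R) ⊕ Unit :=
  ⟨![Sum.inr (), Sum.inl (Sum.inl r), Sum.inl (Sum.inr r)],
    show Function.Injective _ from by
      intro i j h; fin_cases i <;> fin_cases j <;> simp_all⟩

/-- If the control is `1`, swap the qubits with indices in `s` of the two registers. -/
def swapOn (s : List R) (y : (R ⊕ R) ⊕ Unit → Bool) : (R ⊕ R) ⊕ Unit → Bool :=
  Sum.elim (Sum.elim
    (fun r => if y (Sum.inr ()) = true ∧ r ∈ s then y (Sum.inl (Sum.inr r))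
      else y (Sum.inl (Sum.inl r)))
    (fun r => if y (Sum.inr ()) = true ∧ r ∈ s then y (Sum.inl (Sum.inl r))
      else y (Sum.inl (Sum.inr r))))
    fun _ => y (Sum.inr ())

lemma extendOp_swapWires (r : R) :
    extendOp (swapWires r) (basisMap cswapMap) = basisMap (swapOn [r]) := by
  refine extendOp_basisMap _ _ _ (fun y => ?_) fun y j hj => ?_
  · funext i
    have h0 : swapWires r 0 = Sum.inr () := rfl
    have h1 : swapWires r 1 = Sum.inl (Sum.inl r) := rfl
    have h2 : swapWires r 2 = Sum.inl (Sum.inr r) := rfl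
    have h3 : Equiv.swap (1 : Fin 3) 2 0 = 0 := by decide
    simp only [cswapMap, Function.comp_apply, h0]
    cases h : y (Sum.inr ())
    · fin_cases i <;> simp [swapOn, h, h0, h1, h2]
    · fin_cases i <;> simp [swapOn, h, h0, h1, h2, h3]
  · have h1 : j ≠ Sum.inl (Sum.inl r) := fun h => hj ⟨1, h.symm⟩
    have h2 : j ≠ Sum.inl (Sum.inr r) := fun h => hj ⟨2, h.symm⟩
    rcases j with (j | j) | j
    · simp [swapOn]; intro _ h; simp [h] at h1
    · simp [swapOn]; intro _ h; simp [h] at h2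
    · rfl

lemma gatesOp_swapOn (s : List R) (hs : s.Nodup) :
    gatesOp (s.flatMap fun r => cswapGates.map (QGate.map (swapWires r))) =
      basisMap (swapOn s) := by
  induction s with
  | nil =>
    rw [List.flatMap_nil, gatesOp_nil, ← basisMap_id]
    congr 1
    funext y j
    rcases j with (j | j) | j <;> simp [swapOn]
  | cons r s ih =>
    obtain ⟨hr, hs⟩ := List.nodup_cons.1 hs
    rw [List.flatMap_cons, gatesOp_append, ih hs, gatesOp_map, gatesOp_cswapGates,
      extendOp_swapWires, basisMap_mul]
    congr 1
    funext y j
    rcases j with (j | j) | j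
    · by_cases hj : j = r
      · subst hj; simp [swapOn, hr]
      · simp [swapOn, hj]
    · by_cases hj : j = r
      · subst hj; simp [swapOn, hr]
      · simp [swapOn, hj]
    · rfl

/-- Exchanging two registers. -/
def swapMap (z : R ⊕ R → Bool) : R ⊕ R → Bool := z ∘ Sum.swap

lemma swapMap_swapMap (z : R ⊕ R → Bool) : swapMap (swapMap z) = z := by
  funext i; simp [swapMap]

lemma eq_swapMap_iff (z w : R ⊕ R → Bool) : z = swapMap w ↔ w = swapMap z :=
  ⟨fun h => by rw [h, swapMap_swapMap], fun h => by rw [h, swapMap_swapMap]⟩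

/-- The swap test. -/
theorem QCircuit.exists_swapTest (R : Type) [Fintype R] [DecidableEq R] :
    ∃ D : QCircuit (R ⊕ R) Unit, D.size ≤ 40 * Fintype.card R + 4 ∧
      ∀ ρ σ : QOp R, (D.run (QOp.tensor ρ σ)).probOne =
        (ρ.trace * σ.trace - (ρ * σ).trace).re / 2 := by
  let e : (R ⊕ R) ⊕ Unit ≃ (R ⊕ R) ⊕ Unit := Equiv.refl _
  let l : List (QGate ((R ⊕ R) ⊕ Unit)) := .hadamard (Sum.inr ()) ::
    (((Finset.univ : Finset R).toList.flatMap fun r =>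
      cswapGates.map (QGate.map (swapWires r))) ++ [.hadamard (Sum.inr ())])
  obtain ⟨D, hs, hr⟩ := exists_circuit_kraus e (Equiv.sumComm Unit (R ⊕ R)) l
  refine ⟨D, ?_, fun ρ σ => ?_⟩
  · rw [hs]
    have : cswapGates.length = 36 := rfl
    simp only [l, List.length_cons, List.length_append, List.length_flatMap, List.length_map, this,
      List.map_const', List.sum_replicate, Finset.length_toList, Finset.card_univ,
      Fintype.card_sum, smul_eq_mul, List.length_nil, Fintype.card_unit]
    omega
  have hH : ∀ (z z' : R ⊕ R → Bool) (c c' : Unit → Bool),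
      (QGate.hadamard (Sum.inr () : (R ⊕ R) ⊕ Unit)).toOp (glue e z c) (glue e z' c') =
      if z = z' then (if c () && c' () then -1 else 1) * ((Real.sqrt 2 : ℝ) : ℂ)⁻¹ else 0 := by
    intro z z' c c'
    simp only [QGate.toOp, Matrix.of_apply]
    refine if_congr ?_ rfl rfl
    rw [funext_iff]
    constructor
    · intro h i
      exact h (Sum.inl i) (by simp)
    · rintro h (j | j) hj
      · exact h j
      · exact absurd rfl hj
  have hP : ∀ (z z' : R ⊕ R → Bool) (c c' : Unit → Bool),
      basisMap (swapOn (Finset.univ : Finset R).toList) (glue e z c) (glue e z' c') =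
      if c = c' then (if z = if c' () then swapMap z' else z' then 1 else 0) else 0 := by
    intro z z' c c'
    simp only [basisMap, Matrix.of_apply]
    rw [← ite_and]
    refine if_congr ?_ rfl rfl
    rw [eq_comm, glue_eq_iff, and_comm]
    refine and_congr ?_ ?_
    · exact eq_comm
    · rw [eq_comm (a := z)]
      have : (fun a => swapOn (Finset.univ : Finset R).toList (glue e z' c') (e (Sum.inl a))) =
          if c' () then swapMap z' else z' := by
        funext a
        cases h : c' () <;> rcases a with a | a <;>
          simp [swapOn, e, h, glue, swapMap]
      rw [this]
  -- For the control outcome 1 the two Hadamard gates and the controlled swap S act on the registers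
  -- as (1 - S)/2. Conjugating by it gives four traces, two equal to tr ρ · tr σ and two to tr(ρσ).
  have hK : ∀ z a : R ⊕ R → Bool,
      krausOp e (Equiv.sumComm Unit (R ⊕ R)) (gatesOp l) z (fun _ => true) a =
      2⁻¹ * ((if a = z then 1 else 0) - if a = swapMap z then 1 else 0) := by
    intro z a
    have hz : glue (Equiv.sumComm Unit (R ⊕ R)) (fun _ => true) z = glue e z fun _ => true := by
      funext i; rcases i with i | i <;> rfl
    simp only [krausOp, Matrix.of_apply, hz, l]
    rw [gatesOp_cons, gatesOp_append, gatesOp_swapOn _ (Finset.nodup_toList _), gatesOp_cons,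
      gatesOp_nil, Matrix.one_mul]
    simp only [Matrix.mul_apply, sum_glue e, hH, hP, sum_unit_bool]
    have hft : (fun _ : Unit => false) ≠ fun _ => true := fun h => by simpa using congrFun h ()
    simp only [hft, hft.symm, if_true, if_false, Bool.and_false, Bool.and_true, Bool.false_eq_true,
      mul_zero, add_zero, zero_add, mul_ite, ite_mul, zero_mul, mul_one, one_mul,
      Finset.sum_add_distrib, Finset.sum_ite_eq', Finset.mem_univ, neg_mul,
      inv_sqrt_two_mul_self, eq_swapMap_iff z a]
    simp only [eq_comm (a := z) (b := a)]
    split_ifs <;> ring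
  have hsum : ∀ (F : (R ⊕ R → Bool) → ℂ) (z : R ⊕ R → Bool),
      ∑ a, ((if a = z then 1 else 0) - if a = swapMap z then 1 else 0) * F a =
      F z - F (swapMap z) := by
    intro F z
    simp [sub_mul, Finset.sum_sub_distrib]
  have hswap : ∑ z : R ⊕ R → Bool, QOp.tensor ρ σ z (swapMap z) = (ρ * σ).trace := by
    rw [sum_sum_type, Matrix.trace]
    simp only [Matrix.diag_apply, Matrix.mul_apply]
    exact Finset.sum_congr rfl fun _ _ => Finset.sum_congr rfl fun _ _ => rfl
  have hswap' : ∑ z : R ⊕ R → Bool, QOp.tensor ρ σ (swapMap z) z = (ρ * σ).trace := by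
    rw [← hswap]
    exact Finset.sum_bijective swapMap
      (Function.Involutive.bijective swapMap_swapMap) (by simp) fun z _ => by rw [swapMap_swapMap]
  have htr : ∑ z : R ⊕ R → Bool, QOp.tensor ρ σ z z = ρ.trace * σ.trace := tensor_trace ρ σ
  have htr' : ∑ z : R ⊕ R → Bool, QOp.tensor ρ σ (swapMap z) (swapMap z) = ρ.trace * σ.trace := by
    rw [← htr]
    exact Finset.sum_bijective swapMap
      (Function.Involutive.bijective swapMap_swapMap) (by simp) fun z _ => rfl
  have hall : D.run (QOp.tensor ρ σ) (fun _ => true) (fun _ => true) =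
      (ρ.trace * σ.trace - (ρ * σ).trace) / 2 := by
    rw [hr, krausMap_apply]
    simp only [hK]
    have : ∀ (F : (R ⊕ R → Bool) → (R ⊕ R → Bool) → ℂ) (z : R ⊕ R → Bool), ∑ a, ∑ a',
        2⁻¹ * ((if a = z then 1 else 0) - if a = swapMap z then 1 else 0) * F a a' *
          (starRingEnd ℂ) (2⁻¹ * ((if a' = z then 1 else 0) - if a' = swapMap z then 1 else 0)) =
        4⁻¹ * ((F z z - F z (swapMap z)) - (F (swapMap z) z - F (swapMap z) (swapMap z))) := by
      intro F z
      rw [← hsum (F z), ← hsum (F (swapMap z)),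
        ← hsum (fun a => ∑ a', ((if a' = z then 1 else 0) - if a' = swapMap z then 1 else 0) * F a a'),
        Finset.mul_sum]
      refine Finset.sum_congr rfl fun a _ => ?_
      rw [Finset.mul_sum, Finset.mul_sum]
      refine Finset.sum_congr rfl fun a' _ => ?_
      simp only [map_mul, map_sub, map_inv₀, Complex.conj_ofNat, apply_ite (starRingEnd ℂ), map_one,
        map_zero]
      ring
    refine (Finset.sum_congr rfl fun z _ => this (QOp.tensor ρ σ) z).trans ?_
    simp only [← Finset.mul_sum, Finset.sum_sub_distrib, hswap, hswap', htr, htr']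
    ring
  rw [QOp.probOne, hall, Complex.div_ofNat_re]

end SwapTest

/-! ### Haar random states -/

section Haar

open MeasureTheory
open scoped Pointwise

variable {n : ℕ}

instance haarState_isProbabilityMeasure : IsProbabilityMeasure (haarState n) := by
  refine ⟨?_⟩
  rw [haarState, Measure.smul_apply, smul_eq_mul]
  refine ENNReal.inv_mul_cancel ?_ (measure_ne_top _ _)
  rw [Measure.measure_univ_ne_zero]
  exact Measure.toSphere_ne_zero _

/-- The action of a unitary on pure states. -/
noncomputable def sphereMap (U : EuclideanSpace ℂ (Fin n → Bool) ≃ₗᵢ[ℂ] EuclideanSpace ℂ (Fin n → Bool))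
    (v : Metric.sphere (0 : EuclideanSpace ℂ (Fin n → Bool)) 1) :
    Metric.sphere (0 : EuclideanSpace ℂ (Fin n → Bool)) 1 :=
  ⟨U v.1, by simp⟩

lemma continuous_sphereMap
    (U : EuclideanSpace ℂ (Fin n → Bool) ≃ₗᵢ[ℂ] EuclideanSpace ℂ (Fin n → Bool)) :
    Continuous (sphereMap U) :=
  (U.continuous.comp continuous_subtype_val).subtype_mk _

/-- The sphere measure of a set is, up to a constant, the volume of the cone over it. A unitary
preserves volume and commutes with real scaling, so it carries cones to cones of the same volume. -/
lemma measurePreserving_sphereMap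
    (U : EuclideanSpace ℂ (Fin n → Bool) ≃ₗᵢ[ℂ] EuclideanSpace ℂ (Fin n → Bool)) :
    MeasurePreserving (sphereMap U) (haarState n) (haarState n) := by
  have hm := (continuous_sphereMap U).measurable
  refine ⟨hm, ?_⟩
  have hU : MeasurePreserving (U : EuclideanSpace ℂ (Fin n → Bool) → _) volume volume :=
    (⟨U.toLinearEquiv.restrictScalars ℝ, fun x => U.norm_map x⟩ :
      EuclideanSpace ℂ (Fin n → Bool) ≃ₗᵢ[ℝ] EuclideanSpace ℂ (Fin n → Bool)).measurePreserving
  have hUe : MeasurableEmbedding (U : EuclideanSpace ℂ (Fin n → Bool) → _) :=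
    U.toHomeomorph.measurableEmbedding
  rw [haarState, Measure.map_smul]
  congr 1
  ext s hs
  rw [Measure.map_apply hm hs, Measure.toSphere_apply' _ hs, Measure.toSphere_apply' _ (hm hs)]
  congr 1
  rw [← hU.measure_preimage_emb hUe (Set.Ioo (0 : ℝ) 1 • (Subtype.val '' s))]
  congr 1
  ext w
  simp only [Set.mem_smul, Set.mem_image, Set.mem_preimage]
  constructor
  · rintro ⟨r, hr, _, ⟨v, hv, rfl⟩, rfl⟩
    refine ⟨r, hr, _, ⟨_, hv, rfl⟩, ?_⟩
    change r • U v = U (r • v.1)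
    rw [← Complex.coe_smul, ← Complex.coe_smul, map_smul]
  · rintro ⟨r, hr, _, ⟨v, hv, rfl⟩, h⟩
    refine ⟨r, hr, _, ⟨sphereMap U.symm v, ?_, rfl⟩, ?_⟩
    · have : sphereMap U (sphereMap U.symm v) = v := Subtype.ext (by simp [sphereMap])
      rwa [this]
    · change r • U.symm v.1 = w
      rw [← U.symm_apply_apply w, ← h, ← Complex.coe_smul, ← Complex.coe_smul, map_smul]

/-! ### Overlaps of unit vectors -/

section Overlap

variable {E : Type*} [NormedAddCommGroup E] [InnerProductSpace ℂ E]

lemma norm_sub_inner_smul_sq {w u : E} (hw : ‖w‖ = 1) (hu : ‖u‖ = 1) :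
    ‖u - inner ℂ w u • w‖ ^ 2 = 1 - ‖inner ℂ w u‖ ^ 2 := by
  have h := norm_sub_sq (𝕜 := ℂ) u (inner ℂ w u • w)
  rw [inner_smul_right, norm_smul, hw, hu, mul_one] at h
  have h2 : RCLike.re (inner ℂ w u * inner ℂ u w) = ‖inner ℂ w u‖ ^ 2 := by
    rw [← inner_conj_symm u w, RCLike.mul_conj]
    norm_cast
  rw [h2] at h
  rw [h]; ring

/-- Two states that are close to a third one overlap. -/
lemma overlap_of_close {w u v : E} (hw : ‖w‖ = 1) (hu : ‖u‖ = 1) (hv : ‖v‖ = 1) {ε : ℝ}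
    (h1 : ε ≤ 1)
    (hwu : 1 - ε < ‖inner ℂ u w‖ ^ 2) (hwv : 1 - ε < ‖inner ℂ v w‖ ^ 2) :
    1 - 2 * ε ≤ ‖inner ℂ u v‖ := by
  rw [norm_inner_symm] at hwu hwv
  have hu' := norm_sub_inner_smul_sq hw hu
  have hv' := norm_sub_inner_smul_sq hw hv
  -- Split `u` and `v` along `w`. The parts orthogonal to `w` have squared norm below ε and so
  -- contribute at most ε to the overlap, while the parts along `w` contribute at least 1 - ε.
  have hin : inner ℂ (u - inner ℂ w u • w) (v - inner ℂ w v • w) =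
      inner ℂ u v - inner ℂ u w * inner ℂ w v := by
    rw [inner_sub_left, inner_sub_right, inner_sub_right, inner_smul_left, inner_smul_left,
      inner_smul_right, inner_smul_right, inner_self_eq_norm_sq_to_K, hw, inner_conj_symm]
    simp; ring
  have hcs := norm_inner_le_norm (𝕜 := ℂ) (u - inner ℂ w u • w) (v - inner ℂ w v • w)
  rw [hin] at hcs
  have h2 : ‖inner ℂ u w * inner ℂ w v‖ = ‖inner ℂ w u‖ * ‖inner ℂ w v‖ := by
    rw [norm_mul, norm_inner_symm]
  have h3 : ‖u - inner ℂ w u • w‖ * ‖v - inner ℂ w v • w‖ ≤ ε := by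
    nlinarith [sq_nonneg (‖u - inner ℂ w u • w‖ - ‖v - inner ℂ w v • w‖)]
  have h4 : 1 - ε ≤ ‖inner ℂ w u‖ * ‖inner ℂ w v‖ := by
    refine abs_le_of_sq_le_sq' ?_ (by positivity) |>.2
    rw [mul_pow]
    nlinarith
  have h5 := norm_sub_norm_le (inner ℂ u w * inner ℂ w v) (inner ℂ u v)
  rw [norm_sub_rev, h2] at h5
  linarith

end Overlap

/-! ### Haar measure of caps and moments of the overlap -/

variable {bot : EuclideanSpace ℂ (Fin n → Bool)}

lemma exists_orthonormalBasis_apply_eq (v : EuclideanSpace ℂ (Fin n → Bool)) (hv : ‖v‖ = 1)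
    (i : Fin n → Bool) :
    ∃ b : OrthonormalBasis (Fin n → Bool) ℂ (EuclideanSpace ℂ (Fin n → Bool)), b i = v := by
  obtain ⟨b, hb⟩ := Orthonormal.exists_orthonormalBasis_extension_of_card_eq (𝕜 := ℂ)
    (E := EuclideanSpace ℂ (Fin n → Bool)) (ι := Fin n → Bool) (by simp)
    (v := fun _ => v) (s := {i}) ⟨fun _ => hv, fun j k hjk => absurd (Subsingleton.elim j k) hjk⟩
  exact ⟨b, hb i rfl⟩

lemma exists_unitary_apply_eq {u v : EuclideanSpace ℂ (Fin n → Bool)} (hu : ‖u‖ = 1)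
    (hv : ‖v‖ = 1) :
    ∃ U : EuclideanSpace ℂ (Fin n → Bool) ≃ₗᵢ[ℂ] EuclideanSpace ℂ (Fin n → Bool), U u = v := by
  obtain ⟨b, hb⟩ := exists_orthonormalBasis_apply_eq u hu fun _ => false
  obtain ⟨c, hc⟩ := exists_orthonormalBasis_apply_eq v hv fun _ => false
  refine ⟨b.equiv c (Equiv.refl _), ?_⟩
  rw [← hb, ← hc, OrthonormalBasis.equiv_apply_basis]; rfl

/-- The states with overlap more than `1 - ε` with a given one. -/
def stateCap (b : EuclideanSpace ℂ (Fin n → Bool)) (ε : ℝ) :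
    Set (Metric.sphere (0 : EuclideanSpace ℂ (Fin n → Bool)) 1) :=
  {v | 1 - ε < ‖inner ℂ b v.1‖ ^ 2}

lemma measurableSet_stateCap (b : EuclideanSpace ℂ (Fin n → Bool)) (ε : ℝ) :
    MeasurableSet (stateCap b ε) := by
  refine (isOpen_lt continuous_const ?_).measurableSet
  fun_prop

/-- Unitaries act transitively on unit vectors and preserve the Haar measure. -/
lemma haarState_stateCap_eq {u v : EuclideanSpace ℂ (Fin n → Bool)} (hu : ‖u‖ = 1)
    (hv : ‖v‖ = 1) (ε : ℝ) :
    haarState n (stateCap u ε) = haarState n (stateCap v ε) := by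
  obtain ⟨U, hU⟩ := exists_unitary_apply_eq hu hv
  rw [← (measurePreserving_sphereMap U).measure_preimage
    (measurableSet_stateCap v ε).nullMeasurableSet]
  congr 1
  ext w
  simp [stateCap, sphereMap, ← hU]

/-- A packing argument: N disjoint caps of equal measure fit on the sphere. Their centres lie on a
quarter circle from `bot` towards an orthogonal vector, which exists because n ≠ 0 makes the
dimension at least 2. -/
lemma haarState_stateCap_le (hn : n ≠ 0) (hb : ‖bot‖ = 1) {N : ℕ} (hN : N ≠ 0) :
    (haarState n).real (stateCap bot (1 / (8 * N ^ 2))) ≤ 1 / N := by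
  have hN0 : (0 : ℝ) < N := by positivity
  have hN1 : (1 : ℝ) ≤ N := by exact_mod_cast Nat.one_le_iff_ne_zero.2 hN
  obtain ⟨c, hc⟩ := exists_orthonormalBasis_apply_eq bot hb fun _ => false
  let e := c fun _ => true
  have hne : (fun _ : Fin n => false) ≠ fun _ => true := fun h => by
    simpa using congrFun h ⟨0, Nat.pos_of_ne_zero hn⟩
  have he : ‖e‖ = 1 := c.norm_eq_one _
  have hbe : inner ℂ bot e = 0 := by rw [← hc]; exact c.inner_eq_zero hne
  have heb : inner ℂ e bot = 0 := by rw [← hc]; exact c.inner_eq_zero hne.symm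
  -- Angles in steps of π/(2N) stay below π/2 for j < N, so the overlaps of distinct centres are
  -- nonnegative cosines. They are at most 1 - (2/π²)(π/(2N))² = 1 - 4ε, below the value 1 - 2ε that
  -- intersecting caps would force.
  let θ : ℕ → ℝ := fun j => Real.pi * j / (2 * N)
  let b : ℕ → EuclideanSpace ℂ (Fin n → Bool) := fun j =>
    (Real.cos (θ j) : ℂ) • bot + (Real.sin (θ j) : ℂ) • e
  have hin : ∀ i j, inner ℂ (b i) (b j) = (Real.cos (θ i - θ j) : ℂ) := by
    intro i j
    simp only [b, inner_add_left, inner_add_right, inner_smul_left, inner_smul_right, hbe, heb,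
      inner_self_eq_norm_sq_to_K, hb, he, Complex.conj_ofReal, Real.cos_sub]
    push_cast
    simp
    ring
  have hbn : ∀ j, ‖b j‖ = 1 := by
    intro j
    have h := hin j j
    rw [inner_self_eq_norm_sq_to_K, sub_self, Real.cos_zero] at h
    have h2 : ‖b j‖ ^ 2 = 1 := by
      rw [← Complex.ofReal_inj, Complex.ofReal_pow]; exact h
    exact (pow_eq_one_iff_of_nonneg (norm_nonneg _) two_ne_zero).1 h2
  set ε : ℝ := 1 / (8 * N ^ 2) with hε
  have hε1 : ε ≤ 1 := by
    rw [hε, div_le_one (by positivity)]; nlinarith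
  have hlt : ∀ i j : ℕ, i < j → j < N → Real.cos (θ i - θ j) < 1 - 2 * ε ∧
      0 ≤ Real.cos (θ i - θ j) := by
    intro i j hij hj
    have hd : θ j - θ i = Real.pi * (j - i : ℝ) / (2 * N) := by simp only [θ]; ring
    have h1 : (1 : ℝ) ≤ j - i := by
      have : (i : ℝ) + 1 ≤ j := by exact_mod_cast hij
      linarith
    have h2 : (j - i : ℝ) ≤ N := by
      have : (j : ℝ) ≤ N := by exact_mod_cast hj.le
      linarith [Nat.cast_nonneg (α := ℝ) i]
    have hpi := Real.pi_pos
    have hd1 : Real.pi / (2 * N) ≤ θ j - θ i := by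
      rw [hd]; gcongr; nlinarith
    have hd2 : θ j - θ i ≤ Real.pi / 2 := by
      rw [hd, div_le_div_iff₀ (by positivity) (by norm_num)]; nlinarith
    have hd0 : 0 ≤ θ j - θ i := le_trans (by positivity) hd1
    rw [← Real.cos_neg, neg_sub]
    refine ⟨?_, Real.cos_nonneg_of_mem_Icc ⟨by linarith, hd2⟩⟩
    refine (Real.cos_le_one_sub_mul_cos_sq
      (abs_le.2 ⟨by linarith, by linarith⟩)).trans_lt ?_
    have h3 : 2 / Real.pi ^ 2 * (Real.pi / (2 * N)) ^ 2 ≤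
        2 / Real.pi ^ 2 * (θ j - θ i) ^ 2 := by gcongr
    have h4 : 2 / Real.pi ^ 2 * (Real.pi / (2 * N)) ^ 2 = 4 * ε := by
      rw [hε]; field_simp; norm_num
    have h5 : 0 < ε := by positivity
    linarith
  have hdisj : (↑(Finset.range N) : Set ℕ).PairwiseDisjoint fun j => stateCap (b j) ε := by
    have key : ∀ i j : ℕ, i < j → j < N → Disjoint (stateCap (b i) ε) (stateCap (b j) ε) := by
      intro i j hij hj
      rw [Set.disjoint_left]
      intro w hwi hwj
      have h := overlap_of_close (by simp) (hbn i) (hbn j) hε1 hwi hwj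
      obtain ⟨h1, h2⟩ := hlt i j hij hj
      rw [hin, Complex.norm_real, Real.norm_of_nonneg h2] at h
      linarith
    intro i hi j hj hij
    simp only [Finset.coe_range, Set.mem_Iio] at hi hj
    rcases lt_or_gt_of_ne hij with h | h
    · exact key i j h hj
    · exact (key j i h hi).symm
  have hsum := measureReal_biUnion_finset (μ := haarState n) hdisj
    fun j _ => measurableSet_stateCap (b j) ε
  have heq : ∀ j, (haarState n).real (stateCap (b j) ε) = (haarState n).real (stateCap bot ε) :=
    fun j => by rw [measureReal_def, measureReal_def, haarState_stateCap_eq (hbn j) hb]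
  simp only [heq, Finset.sum_const, Finset.card_range, nsmul_eq_mul] at hsum
  rw [le_div_iff₀ hN0, mul_comm, ← hsum]
  exact measureReal_le_one

/-- High moments of the overlap of a Haar random state with a fixed one are small. -/
lemma integral_overlap_pow_le (hn : n ≠ 0) (hb : ‖bot‖ = 1) {N : ℕ} (hN : N ≠ 0) :
    ∫ v, (‖inner ℂ bot v.1‖ ^ 2) ^ (8 * N ^ 3) ∂haarState n ≤ 2 / N := by
  have hN0 : (0 : ℝ) < N := by positivity
  set ε : ℝ := 1 / (8 * N ^ 2) with hε
  have hε1 : ε ≤ 1 := by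
    have hN1 : (1 : ℝ) ≤ N := by exact_mod_cast Nat.one_le_iff_ne_zero.2 hN
    rw [hε, div_le_one (by positivity)]; nlinarith
  -- The exponent is chosen so that ε · 8N³ = N: outside the cap the power is at most exp(-N), which
  -- is below 1/N. Inside the cap it is bounded by 1, and the cap has measure at most 1/N.
  have hpow : (1 - ε) ^ (8 * N ^ 3) ≤ 1 / N := by
    have h1 : 1 - ε ≤ Real.exp (-ε) := by linarith [Real.add_one_le_exp (-ε)]
    calc (1 - ε) ^ (8 * N ^ 3) ≤ Real.exp (-ε) ^ (8 * N ^ 3) :=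
          pow_le_pow_left₀ (by linarith) h1 _
      _ = (Real.exp N)⁻¹ := by
          rw [← Real.exp_nat_mul, ← Real.exp_neg]
          congr 1
          rw [hε]; push_cast; field_simp
      _ ≤ 1 / N := by
          rw [one_div]
          exact inv_anti₀ hN0 (by linarith [Real.add_one_le_exp (N : ℝ)])
  have hle : ∀ v : Metric.sphere (0 : EuclideanSpace ℂ (Fin n → Bool)) 1,
      ‖inner ℂ bot v.1‖ ^ 2 ≤ 1 := by
    intro v
    have := norm_inner_le_norm (𝕜 := ℂ) bot v.1
    rw [hb, norm_eq_of_mem_sphere v, mul_one] at this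
    exact pow_le_one₀ (norm_nonneg _) this
  have hpt : ∀ v : Metric.sphere (0 : EuclideanSpace ℂ (Fin n → Bool)) 1,
      (‖inner ℂ bot v.1‖ ^ 2) ^ (8 * N ^ 3) ≤ (stateCap bot ε).indicator (fun _ => (1 : ℝ)) v + 1 / N := by
    intro v
    by_cases hv : v ∈ stateCap bot ε
    · rw [Set.indicator_of_mem hv]
      have := pow_le_one₀ (n := 8 * N ^ 3) (by positivity) (hle v)
      have h2 : (0 : ℝ) ≤ 1 / N := by positivity
      linarith
    · rw [Set.indicator_of_notMem hv, zero_add]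
      refine le_trans (pow_le_pow_left₀ (by positivity) ?_ _) hpow
      exact not_lt.1 hv
  have hi1 : Integrable ((stateCap bot ε).indicator fun _ => (1 : ℝ)) (haarState n) :=
    (integrable_const (1 : ℝ)).indicator (measurableSet_stateCap bot ε)
  have hi2 : Integrable (fun _ => (1 / N : ℝ)) (haarState n) := integrable_const _
  calc _ ≤ ∫ v, ((stateCap bot ε).indicator (fun _ => (1 : ℝ)) v + 1 / N) ∂haarState n := by
        refine integral_mono_of_nonneg (Filter.Eventually.of_forall fun v => by positivity)
          (hi1.add hi2) (Filter.Eventually.of_forall hpt)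
    _ = (haarState n).real (stateCap bot ε) + 1 / N := by
        rw [integral_add hi1 hi2, integral_indicator_const _ (measurableSet_stateCap bot ε)]
        simp
    _ ≤ 1 / N + 1 / N := by
        have := haarState_stateCap_le hn hb hN
        gcongr
    _ = 2 / N := by ring

end Haar

/-! ### Polynomial bounds and negligible functions -/

section Asymptotics

open Filter Asymptotics

lemma PolyBounded.mono {f g : ℕ → ℕ} (hg : PolyBounded g) (h : ∀ lam, f lam ≤ g lam) :
    PolyBounded f :=
  hg.imp fun _ hp lam => (h lam).trans (hp lam)

lemma PolyBounded.const (c : ℕ) : PolyBounded fun _ => c :=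
  ⟨Polynomial.C c, fun lam => by simp⟩

lemma PolyBounded.id : PolyBounded fun lam => lam :=
  ⟨Polynomial.X, fun lam => by simp⟩

lemma PolyBounded.add {f g : ℕ → ℕ} (hf : PolyBounded f) (hg : PolyBounded g) :
    PolyBounded fun lam => f lam + g lam := by
  obtain ⟨p, hp⟩ := hf
  obtain ⟨q, hq⟩ := hg
  exact ⟨p + q, fun lam => by rw [Polynomial.eval_add]; exact add_le_add (hp lam) (hq lam)⟩

lemma PolyBounded.mul {f g : ℕ → ℕ} (hf : PolyBounded f) (hg : PolyBounded g) :
    PolyBounded fun lam => f lam * g lam := by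
  obtain ⟨p, hp⟩ := hf
  obtain ⟨q, hq⟩ := hg
  exact ⟨p * q, fun lam => by rw [Polynomial.eval_mul]; exact Nat.mul_le_mul (hp lam) (hq lam)⟩

lemma PolyBounded.pow {f : ℕ → ℕ} (hf : PolyBounded f) (k : ℕ) :
    PolyBounded fun lam => f lam ^ k := by
  obtain ⟨p, hp⟩ := hf
  exact ⟨p ^ k, fun lam => by rw [Polynomial.eval_pow]; exact Nat.pow_le_pow_left (hp lam) k⟩

lemma PolyBounded.two_pow {n : ℕ → ℕ}
    (hn : (fun lam : ℕ => (n lam : ℝ)) =O[atTop] fun lam : ℕ => Real.log lam) :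
    PolyBounded fun lam => 2 ^ n lam := by
  obtain ⟨C, hC⟩ := hn.bound
  obtain ⟨N, hN⟩ := eventually_atTop.1 hC
  obtain ⟨k, hk⟩ := exists_nat_ge C
  -- The power of λ handles large λ; the constant absorbs the finitely many small λ where the
  -- asymptotic bound need not hold.
  refine ⟨Polynomial.X ^ k + Polynomial.C (∑ i ∈ Finset.range (N + 1), 2 ^ n i), fun lam => ?_⟩
  simp only [Polynomial.eval_add, Polynomial.eval_pow, Polynomial.eval_X, Polynomial.eval_C]
  by_cases h : lam < N + 1
  · refine le_trans ?_ (Nat.le_add_left _ _)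
    exact Finset.single_le_sum (f := fun i => 2 ^ n i) (fun _ _ => Nat.zero_le _)
      (Finset.mem_range.2 h)
  · refine le_trans ?_ (Nat.le_add_right _ _)
    have hl : (1 : ℝ) ≤ lam := by exact_mod_cast (by omega : 1 ≤ lam)
    have hlog := Real.log_nonneg hl
    have h1 := hN lam (by omega)
    rw [Real.norm_of_nonneg (Nat.cast_nonneg _), Real.norm_of_nonneg hlog] at h1
    have h2 : (n lam : ℝ) * Real.log 2 ≤ k * Real.log lam := by
      have hl2 : Real.log 2 ≤ 1 := by linarith [Real.log_two_lt_d9]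
      calc (n lam : ℝ) * Real.log 2 ≤ n lam * 1 := by gcongr
        _ ≤ C * Real.log lam := by rw [mul_one]; exact h1
        _ ≤ k * Real.log lam := by gcongr
    rw [← Real.log_pow, ← Real.log_pow] at h2
    have h3 := (Real.log_le_log_iff (by positivity) (by positivity)).1 h2
    exact_mod_cast h3

lemma Negligible.of_abs_le {f g : ℕ → ℝ} (hg : Negligible g) (h : ∀ lam, |f lam| ≤ |g lam|) :
    Negligible f :=
  SuperpolynomialDecay.trans_abs_le hg h

lemma Negligible.add {f g : ℕ → ℝ} (hf : Negligible f) (hg : Negligible g) :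
    Negligible fun lam => f lam + g lam :=
  SuperpolynomialDecay.add hf hg

lemma Negligible.const_mul {f : ℕ → ℝ} (hf : Negligible f) (c : ℝ) :
    Negligible fun lam => c * f lam :=
  SuperpolynomialDecay.const_mul hf c

lemma PolyBounded.mul_negligible {f : ℕ → ℕ} {g : ℕ → ℝ} (hf : PolyBounded f)
    (hg : Negligible g) : Negligible fun lam => f lam * g lam := by
  obtain ⟨p, hp⟩ := hf
  refine Negligible.of_abs_le (SuperpolynomialDecay.polynomial_mul hg (p.map (Nat.castRingHom ℝ)))
    fun lam => ?_
  have h : (p.map (Nat.castRingHom ℝ)).eval (lam : ℝ) = ((p.eval lam : ℕ) : ℝ) := by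
    rw [Polynomial.eval_natCast_map]; simp
  simp only [h, abs_mul, Nat.abs_cast]
  exact mul_le_mul_of_nonneg_right (by exact_mod_cast hp lam) (abs_nonneg _)

/-- The error `g` may depend on the exponent `c`. This is needed because the distinguisher that
bounds the abort probability uses more copies for a better inverse polynomial. -/
lemma negligible_of_forall_pow {f : ℕ → ℝ} (h0 : ∀ lam, 0 ≤ f lam)
    (h : ∀ c : ℕ, ∃ g, Negligible g ∧ ∀ lam, f lam ≤ 2 / ((lam + 1) ^ c : ℕ) + g lam) :
    Negligible f := by
  intro k
  -- One power more than the decay to be shown leaves a factor 1/(λ + 1), which tends to 0.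
  obtain ⟨g, hg, hfg⟩ := h (k + 1)
  have h1 : Tendsto (fun lam : ℕ => 2 * (1 / ((lam : ℝ) + 1)) + (lam : ℝ) ^ k * g lam) atTop
      (nhds (2 * 0 + 0)) :=
    (tendsto_one_div_add_atTop_nhds_zero_nat.const_mul 2).add (hg k)
  rw [mul_zero, add_zero] at h1
  refine squeeze_zero (fun lam => mul_nonneg (by positivity) (h0 lam)) (fun lam => ?_) h1
  have h2 : (lam : ℝ) ^ k * (2 / ((lam + 1) ^ (k + 1) : ℕ)) ≤ 2 * (1 / ((lam : ℝ) + 1)) := by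
    push_cast
    rw [pow_succ, mul_div_assoc', mul_one_div, div_le_div_iff₀ (by positivity) (by positivity)]
    have : (lam : ℝ) ^ k ≤ (lam + 1) ^ k := by gcongr; linarith
    nlinarith [mul_le_mul_of_nonneg_right this (by positivity : (0 : ℝ) ≤ lam + 1)]
  calc (lam : ℝ) ^ k * f lam ≤ (lam : ℝ) ^ k * (2 / ((lam + 1) ^ (k + 1) : ℕ) + g lam) := by
        gcongr; exact hfg lam
    _ ≤ _ := by rw [mul_add]; linarith

end Asymptotics

/-! ### Swap tests on challenges -/

section Tests

lemma trace_pure_mul_pure {Q : Type} [Fintype Q] [DecidableEq Q]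
    (u v : EuclideanSpace ℂ (Q → Bool)) :
    (QOp.pure u * QOp.pure v).trace = ((‖inner ℂ u v‖ ^ 2 : ℝ) : ℂ) := by
  have : inner ℂ u v = ∑ x, (starRingEnd ℂ) (u x) * v x := by
    rw [PiLp.inner_apply]
    exact Finset.sum_congr rfl fun x _ => by simp [mul_comm]
  rw [← Complex.normSq_eq_norm_sq, ← Complex.mul_conj, this, map_sum, Finset.sum_mul_sum,
    Matrix.trace, Finset.sum_comm]
  simp only [Matrix.diag_apply, Matrix.mul_apply, QOp.pure, Matrix.of_apply, map_mul,
    Complex.conj_conj]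
  exact Finset.sum_congr rfl fun _ _ => Finset.sum_congr rfl fun _ _ => by ring

lemma exists_swapTest_after {A X R : Type} [Fintype A] [Fintype X] [Fintype R] [DecidableEq A]
    [DecidableEq X] [DecidableEq R] (e : A ≃ X ⊕ (R ⊕ R)) :
    ∃ D : QCircuit A Unit, D.size ≤ 44 * Fintype.card A + 4 ∧
      ∀ (τ : QOp A) (ξ : QOp X) (ρ σ : QOp R), ξ.trace = 1 →
        (∀ u v, τ (u ∘ e) (v ∘ e) = QOp.tensor ξ (QOp.tensor ρ σ) u v) →
        (D.run τ).probOne = (ρ.trace * σ.trace - (ρ * σ).trace).re / 2 := by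
  obtain ⟨D₁, hs₁, hr₁⟩ := QCircuit.exists_relabel e
  obtain ⟨D₂, hs₂, hr₂⟩ := QCircuit.exists_discard X (R ⊕ R)
  obtain ⟨D₃, hs₃, hr₃⟩ := QCircuit.exists_swapTest R
  obtain ⟨D₄, hs₄, hr₄⟩ := QCircuit.exists_seq D₁ D₂
  obtain ⟨D, hs, hr⟩ := QCircuit.exists_seq D₄ D₃
  refine ⟨D, ?_, fun τ ξ ρ σ hξ hτ => ?_⟩
  · have := Fintype.card_congr e
    simp only [Fintype.card_sum] at this hs₂
    omega
  · have : D₁.run τ = QOp.tensor ξ (QOp.tensor ρ σ) := by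
      rw [hr₁]; ext u v; exact hτ u v
    rw [hr, hr₄, this, hr₂, hξ, one_smul, hr₃]

/-- Splitting a challenge with two copies of a single state. -/
def purityEquiv (d n : ℕ) : ((Fin 1 × Fin d) ⊕ (Fin 1 × (Fin 2 × Fin n))) ⊕ Fin 0 ≃
    (Fin 1 × Fin d) ⊕ (Fin n ⊕ Fin n) :=
  (Equiv.sumEmpty _ (Fin 0)).trans ((Equiv.refl _).sumCongr
    ((Equiv.uniqueProd _ (Fin 1)).trans
      ((finTwoEquiv.prodCongr (Equiv.refl (Fin n))).trans (Equiv.boolProdEquivSum (Fin n)))))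

/-- The test of whether a state is pure. -/
lemma exists_purityTest (d n : ℕ) :
    ∃ D : QCircuit (((Fin 1 × Fin d) ⊕ (Fin 1 × (Fin 2 × Fin n))) ⊕ Fin 0) Unit,
      D.size ≤ 44 * (d + 2 * n) + 4 ∧
      ∀ (x : Fin 1 → Fin d → Bool) (σ : Fin 1 → QOp (Fin n)), (σ 0).IsDensity →
        (D.run (challenge (t := 2) x σ (QOp.basis Fin.elim0))).probOne =
          (1 - (σ 0 * σ 0).trace.re) / 2 := by
  obtain ⟨D, hs, hr⟩ := exists_swapTest_after (purityEquiv d n)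
  refine ⟨D, by simpa using hs, fun x σ hσ => ?_⟩
  rw [hr _ (QOp.basis fun q : Fin 1 × Fin d => x q.1 q.2) (σ 0) (σ 0) (QOp.IsDensity.basis _).2,
    hσ.2]
  · simp
  · intro u v
    simp only [challenge, QOp.tensor, QOp.tensorFamily, Matrix.of_apply, Fin.prod_univ_two,
      Fin.prod_univ_one]
    have h0 : QOp.basis (Fin.elim0 : Fin 0 → Bool) ((u ∘ purityEquiv d n) ∘ Sum.inr)
        ((v ∘ purityEquiv d n) ∘ Sum.inr) = 1 := by
      rw [QOp.basis_apply, if_pos ⟨Subsingleton.elim _ _, Subsingleton.elim _ _⟩]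
    rw [h0, mul_one]
    rfl

/-- Splitting a challenge and an advice register of the same size. -/
def overlapEquiv (d n t : ℕ) : ((Fin 1 × Fin d) ⊕ (Fin 1 × (Fin t × Fin n))) ⊕ Fin (t * n) ≃
    (Fin 1 × Fin d) ⊕ ((Fin t × Fin n) ⊕ (Fin t × Fin n)) :=
  (Equiv.sumAssoc _ _ _).trans ((Equiv.refl _).sumCongr
    ((Equiv.uniqueProd _ (Fin 1)).sumCongr finProdFinEquiv.symm))

/-- Copies of a pure state, as an advice state. -/
noncomputable def copiesAdvice {n : ℕ} (t : ℕ) (bot : EuclideanSpace ℂ (Fin n → Bool)) :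
    QOp (Fin (t * n)) :=
  Matrix.submatrix (QOp.tensorFamily fun _ : Fin t => QOp.pure bot)
    (fun x => x ∘ finProdFinEquiv) fun x => x ∘ finProdFinEquiv

lemma copiesAdvice_isDensity {n : ℕ} (t : ℕ) {bot : EuclideanSpace ℂ (Fin n → Bool)}
    (hb : ‖bot‖ = 1) : (copiesAdvice t bot).IsDensity :=
  (QOp.IsDensity.tensorFamily fun _ : Fin t => QOp.IsDensity.pure hb).submatrix finProdFinEquiv

/-- The test of the overlap of a state with the advice state, to a high power. -/
lemma exists_overlapTest (d n t : ℕ) :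
    ∃ D : QCircuit (((Fin 1 × Fin d) ⊕ (Fin 1 × (Fin t × Fin n))) ⊕ Fin (t * n)) Unit,
      D.size ≤ 44 * (d + t * n + t * n) + 4 ∧
      ∀ (x : Fin 1 → Fin d → Bool) (σ : Fin 1 → QOp (Fin n))
        (bot : EuclideanSpace ℂ (Fin n → Bool)) (f : ℝ), ‖bot‖ = 1 → (σ 0).IsDensity →
        (σ 0 * QOp.pure bot).trace = f →
        (D.run (challenge x σ (copiesAdvice t bot))).probOne = (1 - f ^ t) / 2 := by
  obtain ⟨D, hs, hr⟩ := exists_swapTest_after (overlapEquiv d n t)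
  refine ⟨D, by simpa using hs, fun x σ bot f hb hσ hf => ?_⟩
  rw [hr _ (QOp.basis fun q : Fin 1 × Fin d => x q.1 q.2)
    (QOp.tensorFamily fun _ : Fin t => σ 0) (QOp.tensorFamily fun _ : Fin t => QOp.pure bot)
    (QOp.IsDensity.basis _).2, tensorFamily_mul, tensorFamily_trace, tensorFamily_trace,
    tensorFamily_trace, hσ.2, (QOp.IsDensity.pure hb).2, hf]
  · simp only [Finset.prod_const, Finset.card_univ, Fintype.card_fin, one_pow, one_mul]
    rw [← Complex.ofReal_pow, Complex.sub_re, Complex.one_re, Complex.ofReal_re]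
  · intro u v
    simp only [challenge, QOp.tensor, QOp.tensorFamily, Matrix.of_apply, Fin.prod_univ_one,
      copiesAdvice, Matrix.submatrix_apply]
    rw [mul_assoc]
    have h : ∀ w : (Fin 1 × Fin d) ⊕ ((Fin t × Fin n) ⊕ (Fin t × Fin n)) → Bool,
        (((w ∘ overlapEquiv d n t) ∘ Sum.inr) ∘ finProdFinEquiv : Fin t × Fin n → Bool) =
        (w ∘ Sum.inr) ∘ Sum.inr := by
      intro w
      funext q
      simp [overlapEquiv]
    rw [h, h]
    rfl

end Tests

/-! ### Aborts are rare -/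

section Abort

open MeasureTheory

/-- With w = |⟨ψ|bot⟩|², the overlap with bot is f = 1 - η(1 - w), and (1 - tr ρ²)/2 = η(1 - η)(1 -
w). Bernoulli's inequality gives f^t ≥ 1 - tη(1 - w); multiplying by 1 - η ≤ 1 turns the loss into t
times the impurity. -/
lemma abort_le {n : ℕ} {bot ψ : EuclideanSpace ℂ (Fin n → Bool)} (hb : ‖bot‖ = 1) (hψ : ‖ψ‖ = 1)
    {η : ℝ} (h0 : 0 ≤ η) (h1 : η ≤ 1) (t : ℕ) (ρ : QOp (Fin n))
    (hρ : ρ = (η : ℂ) • QOp.pure ψ + ((1 - η : ℝ) : ℂ) • QOp.pure bot) :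
    ∃ f : ℝ, (ρ * QOp.pure bot).trace = f ∧
      1 - η ≤ f ^ t + t * ((1 - (ρ * ρ).trace.re) / 2) := by
  set w : ℝ := ‖inner ℂ ψ bot‖ ^ 2 with hw
  have hw0 : 0 ≤ w := by positivity
  have hw1 : w ≤ 1 := by
    have := norm_inner_le_norm (𝕜 := ℂ) ψ bot
    rw [hb, hψ, mul_one] at this
    exact pow_le_one₀ (norm_nonneg _) this
  have hψb : (QOp.pure ψ * QOp.pure bot).trace = (w : ℂ) := trace_pure_mul_pure ψ bot
  have hbψ : (QOp.pure bot * QOp.pure ψ).trace = (w : ℂ) := by rw [Matrix.trace_mul_comm, hψb]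
  have hbb : (QOp.pure bot * QOp.pure bot).trace = 1 := by
    rw [trace_pure_mul_pure, inner_self_eq_norm_sq_to_K, hb]; simp
  have hψψ : (QOp.pure ψ * QOp.pure ψ).trace = 1 := by
    rw [trace_pure_mul_pure, inner_self_eq_norm_sq_to_K, hψ]; simp
  have hf : (ρ * QOp.pure bot).trace = ((η * w + (1 - η) : ℝ) : ℂ) := by
    rw [hρ, Matrix.add_mul, Matrix.trace_add, Matrix.smul_mul, Matrix.smul_mul, Matrix.trace_smul,
      Matrix.trace_smul, hψb, hbb]
    push_cast
    simp
  have hp : (ρ * ρ).trace = ((η ^ 2 + (1 - η) ^ 2 + 2 * η * (1 - η) * w : ℝ) : ℂ) := by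
    rw [hρ]
    simp only [Matrix.add_mul, Matrix.mul_add, Matrix.trace_add, Matrix.smul_mul, Matrix.mul_smul,
      Matrix.trace_smul, hψb, hbψ, hbb, hψψ, smul_eq_mul]
    push_cast
    ring
  refine ⟨_, hf, ?_⟩
  rw [hp, Complex.ofReal_re]
  have hbern := one_add_mul_le_pow (a := η * w + (1 - η) - 1) (by nlinarith) t
  rw [add_sub_cancel] at hbern
  have hf0 : 0 ≤ (η * w + (1 - η)) ^ t := by
    have : 0 ≤ 1 - η := by linarith
    positivity
  have hkey : (1 - η) * (1 + t * (η * w + (1 - η) - 1)) ≤ (η * w + (1 - η)) ^ t :=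
    (mul_le_mul_of_nonneg_left hbern (by linarith)).trans (by nlinarith)
  nlinarith

lemma integral_pi_fin_one {n : ℕ}
    (g : Metric.sphere (0 : EuclideanSpace ℂ (Fin n → Bool)) 1 → ℝ) (hg : Continuous g) :
    ∫ v, g (v 0) ∂(Measure.pi fun _ : Fin 1 => haarState n) = ∫ v, g v ∂haarState n := by
  have h := (measurePreserving_eval (fun _ : Fin 1 => haarState n) 0).map_eq
  conv_rhs => rw [← h]
  rw [integral_map (measurable_pi_apply 0).aemeasurable hg.aestronglyMeasurable]

/-- Averaging `abort_le` over k leaves two terms, each the acceptance statistic of a swap test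
against the PRFS; on Haar states the first is at most 2/N and the second is 0. The case n = 0 is set
aside: in dimension 1 the tests cannot tell an abort from any other state. -/
theorem abort_negligible {d n : ℕ → ℕ} {G : StateGenerator d fun lam => Fin (n lam)}
    (hG : IsPRFS G) (hd : PolyBounded d) (hn : PolyBounded n)
    (bot : ∀ lam, EuclideanSpace ℂ (Fin (n lam) → Bool)) (hb : ∀ lam, ‖bot lam‖ = 1)
    (η : ∀ lam, (Fin lam → Bool) → (Fin (d lam) → Bool) → ℝ)
    (ψ : ∀ lam, (Fin lam → Bool) → (Fin (d lam) → Bool) →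
      EuclideanSpace ℂ (Fin (n lam) → Bool))
    (h0 : ∀ lam k x, 0 ≤ η lam k x) (h1 : ∀ lam k x, η lam k x ≤ 1)
    (hψ : ∀ lam k x, ‖ψ lam k x‖ = 1)
    (hgen : ∀ lam k x, G.gen lam k x = (η lam k x : ℂ) • QOp.pure (ψ lam k x) +
      ((1 - η lam k x : ℝ) : ℂ) • QOp.pure (bot lam))
    (x : ∀ lam, Fin (d lam) → Bool) :
    Negligible fun lam => if n lam = 0 then 0 else
      (∑ k : Fin lam → Bool, (1 - η lam k (x lam))) / 2 ^ lam := by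
  have hdens : ∀ lam k x, (G.gen lam k x).IsDensity := fun lam k x => by
    rw [hgen]
    exact (QOp.IsDensity.pure (hψ lam k x)).convex (QOp.IsDensity.pure (hb lam)) (h0 lam k x)
      (h1 lam k x)
  choose D₁ hs₁ hr₁ using fun lam => exists_purityTest (d lam) (n lam)
  have hp := hG.2 (fun _ => 1) (fun _ => 2) (fun _ => 0) (PolyBounded.const 1) (PolyBounded.const 2)
    (fun lam _ => x lam) (fun lam _ _ _ => Subsingleton.elim _ _) D₁
    ((((PolyBounded.const 44).mul (hd.add ((PolyBounded.const 2).mul hn))).add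
      (PolyBounded.const 4)).mono hs₁) (fun _ => QOp.basis Fin.elim0)
    (fun _ => QOp.IsDensity.basis _)
  refine negligible_of_forall_pow (fun lam => ?_) fun c => ?_
  · split_ifs
    · exact le_rfl
    · refine div_nonneg (Finset.sum_nonneg fun k _ => ?_) (by positivity)
      linarith [h1 lam k (x lam)]
  let N : ℕ → ℕ := fun lam => (lam + 1) ^ c
  have hN : PolyBounded N := (PolyBounded.id.add (PolyBounded.const 1)).pow c
  -- The exponent of `integral_overlap_pow_le`; it is polynomial for each fixed c, so the overlap
  -- test is QPT.
  let t : ℕ → ℕ := fun lam => 8 * N lam ^ 3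
  have ht : PolyBounded t := (PolyBounded.const 8).mul (hN.pow 3)
  choose D₂ hs₂ hr₂ using fun lam => exists_overlapTest (d lam) (n lam) (t lam)
  have ho := hG.2 (fun _ => 1) t (fun lam => t lam * n lam) (PolyBounded.const 1) ht
    (fun lam _ => x lam) (fun lam _ _ _ => Subsingleton.elim _ _) D₂
    ((((PolyBounded.const 44).mul ((hd.add (ht.mul hn)).add (ht.mul hn))).add
      (PolyBounded.const 4)).mono hs₂) (fun lam => copiesAdvice (t lam) (bot lam))
    (fun lam => copiesAdvice_isDensity _ (hb lam))
  refine ⟨_, (ho.const_mul 2).add (ht.mul_negligible hp), fun lam => ?_⟩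
  have hhaar : ∀ v : Fin 1 → Metric.sphere (0 : EuclideanSpace ℂ (Fin (n lam) → Bool)) 1,
      ((D₁ lam).run (challenge (fun _ : Fin 1 => x lam) (fun i => QOp.pure (v i).1)
        (QOp.basis Fin.elim0))).probOne = 0 := by
    intro v
    have hv : ‖(v 0).1‖ = 1 := by simp
    rw [hr₁ lam _ _ (QOp.IsDensity.pure hv), trace_pure_mul_pure, inner_self_eq_norm_sq_to_K, hv]
    simp
  have hhaar₂ : ∀ v : Fin 1 → Metric.sphere (0 : EuclideanSpace ℂ (Fin (n lam) → Bool)) 1,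
      ((D₂ lam).run (challenge (fun _ : Fin 1 => x lam) (fun i => QOp.pure (v i).1)
        (copiesAdvice (t lam) (bot lam)))).probOne =
      (1 - (‖inner ℂ (bot lam) (v 0).1‖ ^ 2) ^ t lam) / 2 := by
    intro v
    have hv : ‖(v 0).1‖ = 1 := by simp
    refine hr₂ lam _ _ _ _ (hb lam) (QOp.IsDensity.pure hv) ?_
    rw [trace_pure_mul_pure, norm_inner_symm]
  choose f hf hle using fun k => abort_le (hb lam) (hψ lam k (x lam)) (h0 lam k (x lam))
    (h1 lam k (x lam)) (t lam) (G.gen lam k (x lam)) (hgen lam k (x lam))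
  have hgen₁ : ∀ k, ((D₁ lam).run (challenge (fun _ : Fin 1 => x lam)
      (fun _ => G.gen lam k (x lam)) (QOp.basis Fin.elim0))).probOne =
      (1 - (G.gen lam k (x lam) * G.gen lam k (x lam)).trace.re) / 2 :=
    fun k => hr₁ lam _ _ (hdens lam k (x lam))
  have hgen₂ : ∀ k, ((D₂ lam).run (challenge (fun _ : Fin 1 => x lam)
      (fun _ => G.gen lam k (x lam)) (copiesAdvice (t lam) (bot lam)))).probOne =
      (1 - f k ^ t lam) / 2 :=
    fun k => hr₂ lam _ _ _ _ (hb lam) (hdens lam k (x lam)) (hf k)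
  simp only [hhaar, hhaar₂, hgen₁, hgen₂, integral_zero, sub_zero]
  have hcont : Continuous fun v : Metric.sphere (0 : EuclideanSpace ℂ (Fin (n lam) → Bool)) 1 =>
      (‖inner ℂ (bot lam) v.1‖ ^ 2) ^ t lam := by fun_prop
  have hint : Integrable (fun v : Metric.sphere (0 : EuclideanSpace ℂ (Fin (n lam) → Bool)) 1 =>
      (‖inner ℂ (bot lam) v.1‖ ^ 2) ^ t lam) (haarState (n lam)) :=
    (BoundedContinuousFunction.mkOfCompact ⟨_, hcont⟩).integrable _
  rw [integral_pi_fin_one (fun v => (1 - (‖inner ℂ (bot lam) v.1‖ ^ 2) ^ t lam) / 2)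
    (by fun_prop), integral_div, integral_sub (integrable_const _) hint]
  simp only [integral_const, probReal_univ, smul_eq_mul, mul_one]
  split_ifs with hn0
  · positivity
  have hbound := integral_overlap_pow_le hn0 (hb lam) (N := N lam) (by positivity)
  set I := ∫ v, (‖inner ℂ (bot lam) v.1‖ ^ 2) ^ t lam ∂haarState (n lam)
  have h2 : (0 : ℝ) < 2 ^ lam := by positivity
  have hsum : (∑ k : Fin lam → Bool, (1 - η lam k (x lam))) / 2 ^ lam ≤
      1 - 2 * ((∑ k : Fin lam → Bool, (1 - f k ^ t lam) / 2) / 2 ^ lam) + t lam *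
      ((∑ k : Fin lam → Bool,
        (1 - (G.gen lam k (x lam) * G.gen lam k (x lam)).trace.re) / 2) / 2 ^ lam) := by
    rw [div_le_iff₀ h2]
    calc _ ≤ ∑ k : Fin lam → Bool, (1 - 2 * ((1 - f k ^ t lam) / 2) + t lam *
          ((1 - (G.gen lam k (x lam) * G.gen lam k (x lam)).trace.re) / 2)) :=
          Finset.sum_le_sum fun k _ => by linarith [hle k]
      _ = 2 ^ lam - 2 * (∑ k : Fin lam → Bool, (1 - f k ^ t lam) / 2) + t lam *
          ∑ k : Fin lam → Bool,
            (1 - (G.gen lam k (x lam) * G.gen lam k (x lam)).trace.re) / 2 := by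
          rw [Finset.sum_add_distrib, Finset.sum_sub_distrib, ← Finset.mul_sum, ← Finset.mul_sum]
          simp
      _ = _ := by field_simp
  -- Only one side of each PRFS bound is needed: a generated state must not overlap with bot more,
  -- nor be less pure, than a Haar state on average.
  have ha := abs_le.1 (le_refl |(∑ k : Fin lam → Bool, (1 - f k ^ t lam) / 2) / 2 ^ lam -
    (1 - I) / 2|)
  have hb' := le_abs_self ((∑ k : Fin lam → Bool,
    (1 - (G.gen lam k (x lam) * G.gen lam k (x lam)).trace.re) / 2) / 2 ^ lam)
  have hc := mul_le_mul_of_nonneg_left hb' (Nat.cast_nonneg (α := ℝ) (t lam))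
  change _ ≤ 2 / (N lam : ℝ) + _
  linarith [ha.1]

end Abort

/-! ### The reduction -/

section Reduction

open MeasureTheory

/-- Lets the reduction perform the committer's separate measurements as one measurement of the whole
register. -/
lemma measured_tensorFamily {J Q : Type} [Fintype J] [Fintype Q] [DecidableEq J] [DecidableEq Q]
    (ρ : J → QOp Q) :
    (QOp.tensorFamily ρ).measured = QOp.tensorFamily fun j => (ρ j).measured := by
  ext x y
  simp only [QOp.measured, QOp.tensorFamily, Matrix.diagonal_apply, Matrix.of_apply]
  by_cases h : x = y
  · subst h; simp
  · rw [if_neg h]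
    obtain ⟨⟨j, q⟩, hj⟩ := Function.ne_iff.1 h
    refine (Finset.prod_eq_zero (Finset.mem_univ j) (if_neg fun h' => hj ?_)).symm
    exact congrFun h' q

lemma tensor_sum_right {ι A B : Type} (s : Finset ι) (ρ : QOp A) (σ : ι → QOp B) :
    QOp.tensor ρ (∑ i ∈ s, σ i) = ∑ i ∈ s, QOp.tensor ρ (σ i) := by
  ext x y
  simp [QOp.tensor, Matrix.sum_apply, Finset.mul_sum]

lemma tensor_smul_right {A B : Type} (c : ℂ) (ρ : QOp A) (σ : QOp B) :
    QOp.tensor ρ (c • σ) = c • QOp.tensor ρ σ := by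
  ext x y
  simp [QOp.tensor, mul_left_comm]

lemma tensor_smul_left {A B : Type} (c : ℂ) (ρ : QOp A) (σ : QOp B) :
    QOp.tensor (c • ρ) σ = c • QOp.tensor ρ σ := by
  ext x y
  simp [QOp.tensor, mul_assoc]

lemma tensor_add_right {A B : Type} (ρ : QOp A) (σ σ' : QOp B) :
    QOp.tensor ρ (σ + σ') = QOp.tensor ρ σ + QOp.tensor ρ σ' := by
  ext x y
  simp [QOp.tensor, mul_add]

lemma traceLeft_tensor {A B : Type} [Fintype A] [DecidableEq A] (ρ : QOp A) (σ : QOp B) :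
    (QOp.tensor ρ σ).traceLeft = ρ.trace • σ := by
  ext x y
  simp [QOp.traceLeft, QOp.tensor, Matrix.trace, Finset.sum_mul]

/-- The end of the receiver's attack, as a circuit that gets the states the committer measures. -/
lemma exists_attack {X : Type} [Fintype X] [DecidableEq X] {L n u r o : ℕ}
    (T : QCircuit (Fin L × (Unit ⊕ Fin n)) (Fin u)) (R₂ : QCircuit (Fin r ⊕ (X × Fin u)) (Fin o))
    (D : QCircuit (Fin o) Unit) (P : X × (Fin n × Fin 2) → Bool) (b : Bool) :
    ∃ C : QCircuit (Fin r ⊕ (X × (Fin L × (Unit ⊕ Fin n)))) Unit,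
      C.size ≤ Fintype.card X * (L * (16 * n + 2)) + Fintype.card X * (6 * T.size) +
        3 * R₂.size + D.size ∧
      ∀ (τ : QOp (Fin r)) (σ : X → Fin L → QOp (Unit ⊕ Fin n)),
        C.run (QOp.tensor τ (QOp.tensorFamily fun x => QOp.tensorFamily (σ x))) =
        D.run (R₂.run (QOp.tensor τ (QOp.tensorFamily fun x => (T.run (QOp.tensorFamily fun l =>
          pauliMask (fun q => P (x, q)) b * σ x l * pauliMask (fun q => P (x, q)) b)).measured)))
    := by
  -- The message P and the bit b are hardwired: they determine which gates occur, and no register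
  -- carries them.
  let l : List (QGate (X × (Fin L × (Unit ⊕ Fin n)))) := familyGates fun x =>
    familyGates fun _ : Fin L => pauliMaskGates (fun q => P (x, q)) b
  have hl : l.length ≤ Fintype.card X * (L * (14 * n)) :=
    length_familyGates_le _ _ fun x =>
      (length_familyGates_le _ _ fun _ => length_pauliMaskGates _ _).trans (by simp)
  obtain ⟨C₁, hs₁, hr₁⟩ := QCircuit.exists_gates l
  obtain ⟨C₂, hs₂, hr₂⟩ := QCircuit.exists_family X T
  obtain ⟨C₃, hs₃, hr₃⟩ := QCircuit.exists_measured (X × Fin u)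
  obtain ⟨C₄, hs₄, hr₄⟩ := QCircuit.exists_seq C₁ C₂
  obtain ⟨C₅, hs₅, hr₅⟩ := QCircuit.exists_seq C₄ C₃
  obtain ⟨C₆, hs₆, hr₆⟩ := QCircuit.exists_idle (Fin r) C₅
  obtain ⟨C₇, hs₇, hr₇⟩ := QCircuit.exists_seq C₆ R₂
  obtain ⟨C, hs, hr⟩ := QCircuit.exists_seq C₇ D
  refine ⟨C, ?_, fun τ σ => ?_⟩
  · have hu : u ≤ T.size := by
      have := Fintype.card_le_of_embedding T.output
      simp only [Fintype.card_fin] at this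
      simp only [QCircuit.size]; omega
    have hrr : r ≤ R₂.size := by
      have := Fintype.card_le_of_embedding R₂.input
      simp only [Fintype.card_fin, Fintype.card_sum] at this
      simp only [QCircuit.size]; omega
    simp only [Fintype.card_prod, Fintype.card_sum, Fintype.card_fin, Fintype.card_unit] at *
    have h5 : 5 * (Fintype.card X * u) ≤ Fintype.card X * (5 * T.size) := by nlinarith
    have e1 : Fintype.card X * (L * (14 * n)) + 2 * (Fintype.card X * (L * (1 + n))) =
        Fintype.card X * (L * (16 * n + 2)) := by ring
    have e2 : Fintype.card X * T.size + Fintype.card X * (5 * T.size) =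
        Fintype.card X * (6 * T.size) := by ring
    omega
  · have hl' : gatesOp l = QOp.tensorFamily fun x => QOp.tensorFamily fun _ : Fin L =>
        pauliMask (fun q => P (x, q)) b := by
      simp only [l, gatesOp_familyGates, gatesOp_pauliMaskGates]
    rw [hr, hr₇, hr₆, hr₅, hr₄, hr₁, hl', tensorFamily_conjTranspose]
    simp only [tensorFamily_conjTranspose, pauliMask_conjTranspose, tensorFamily_mul]
    rw [hr₂, hr₃, measured_tensorFamily]

/-- Preparing the input of the attack from a challenge. -/
lemma exists_prepare {X : Type} [Fintype X] [DecidableEq X] {s d L n r : ℕ} (e : Fin s ≃ X) :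
    ∃ C : QCircuit (((Fin s × Fin d) ⊕ (Fin s × (Fin L × Fin n))) ⊕ Fin r)
        (Fin r ⊕ (X × (Fin L × (Unit ⊕ Fin n)))),
      C.size ≤ 4 * (s * d + s * (L * n) + r) + s * (L * (2 * (1 + n))) + 2 * r ∧
      ∀ (x : Fin s → Fin d → Bool) (σ : Fin s → QOp (Fin n)) (ρ : QOp (Fin r)),
        C.run (challenge x σ ρ) = QOp.tensor ρ (QOp.tensorFamily fun y => QOp.tensorFamily
          fun _ : Fin L => QOp.tensor (QOp.basis fun _ : Unit => false) (σ (e.symm y))) := by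
  let f : ((Fin s × Fin d) ⊕ (Fin s × (Fin L × Fin n))) ⊕ Fin r ≃
      (Fin s × Fin d) ⊕ (Fin r ⊕ (X × (Fin L × Fin n))) :=
    (Equiv.sumAssoc _ _ _).trans ((Equiv.refl _).sumCongr
      ((Equiv.sumComm _ _).trans ((Equiv.refl _).sumCongr (e.prodCongr (Equiv.refl _)))))
  obtain ⟨C₁, hs₁, hr₁⟩ := QCircuit.exists_relabel f
  obtain ⟨C₂, hs₂, hr₂⟩ := QCircuit.exists_discard (Fin s × Fin d)
    (Fin r ⊕ (X × (Fin L × Fin n)))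
  obtain ⟨C₃, hs₃, hr₃⟩ := QCircuit.exists_flag (Fin n)
  obtain ⟨C₄, hs₄, hr₄⟩ := QCircuit.exists_family (Fin L) C₃
  obtain ⟨C₅, hs₅, hr₅⟩ := QCircuit.exists_family X C₄
  obtain ⟨C₆, hs₆, hr₆⟩ := QCircuit.exists_idle (Fin r) C₅
  obtain ⟨C₇, hs₇, hr₇⟩ := QCircuit.exists_seq C₁ C₂
  obtain ⟨C, hs, hr⟩ := QCircuit.exists_seq C₇ C₆
  refine ⟨C, ?_, fun x σ ρ => ?_⟩
  · have hX : Fintype.card X = s := by rw [← Fintype.card_congr e, Fintype.card_fin]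
    simp only [Fintype.card_prod, Fintype.card_sum, Fintype.card_fin, hX] at *
    have h4 : C₄.size ≤ L * (2 * (1 + n)) := hs₄.trans (by gcongr)
    have h5 : C₅.size ≤ s * (L * (2 * (1 + n))) := hs₅.trans (by gcongr)
    omega
  · have h : C₁.run (challenge x σ ρ) =
        QOp.tensor (QOp.basis fun q : Fin s × Fin d => x q.1 q.2)
          (QOp.tensor ρ (QOp.tensorFamily fun y => QOp.tensorFamily
            fun _ : Fin L => σ (e.symm y))) := by
      rw [hr₁]
      ext v w
      simp only [challenge, QOp.tensor, QOp.tensorFamily, Matrix.of_apply]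
      rw [← Equiv.prod_comp e]
      simp only [Equiv.symm_apply_apply]
      rw [mul_assoc, mul_comm (∏ i, _) (ρ _ _)]
      rfl
    rw [hr, hr₇, h, hr₂, (QOp.IsDensity.basis _).2, one_smul, hr₆, hr₅]
    simp only [hr₄, hr₃]

/-- The operator `P ^ b`. -/
noncomputable def pauliPow {n : ℕ} (p : Fin n × Fin 2 → Bool) (b : Bool) : QOp (Fin n) :=
  if b then pauliOp p else 1

lemma pauliPow_mul_self {n : ℕ} (p : Fin n × Fin 2 → Bool) (b : Bool) :
    pauliPow p b * pauliPow p b = 1 := by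
  cases b <;> simp [pauliPow, pauliOp_mul_self]

lemma pauliPow_conjTranspose {n : ℕ} (p : Fin n × Fin 2 → Bool) (b : Bool) :
    (pauliPow p b).conjTranspose = pauliPow p b := by
  cases b <;> simp [pauliPow, pauliOp_conjTranspose]

lemma pure_mulVec {Q : Type} [Fintype Q] (M : QOp Q) [DecidableEq Q]
    (v : EuclideanSpace ℂ (Q → Bool)) :
    QOp.pure (WithLp.toLp 2 (M.mulVec v.ofLp)) = M * QOp.pure v * M.conjTranspose := by
  rw [QOp.pure_eq_vecMulVec, QOp.pure_eq_vecMulVec, Matrix.mul_vecMulVec, Matrix.vecMulVec_mul,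
    Matrix.star_mulVec]

/-- The unitary of the operator `P ^ b`. -/
noncomputable def pauliUnitary {n : ℕ} (p : Fin n × Fin 2 → Bool) (b : Bool) :
    EuclideanSpace ℂ (Fin n → Bool) ≃ₗᵢ[ℂ] EuclideanSpace ℂ (Fin n → Bool) where
  toLinearEquiv := LinearEquiv.ofInvolutive (Matrix.toEuclideanLin (pauliPow p b)) fun v => by
    ext i
    simp [Matrix.toLpLin_apply, Matrix.mulVec_mulVec, pauliPow_mul_self]
  norm_map' v := by
    have h := congrArg Matrix.trace (pure_mulVec (pauliPow p b) v)
    rw [Matrix.trace_mul_comm, ← Matrix.mul_assoc, pauliPow_conjTranspose, pauliPow_mul_self,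
      Matrix.one_mul, QOp.pure_trace, QOp.pure_trace, Complex.ofReal_inj] at h
    exact (pow_left_inj₀ (norm_nonneg _) (norm_nonneg _) two_ne_zero).1 h

lemma pure_pauliUnitary {n : ℕ} (p : Fin n × Fin 2 → Bool) (b : Bool)
    (v : EuclideanSpace ℂ (Fin n → Bool)) :
    QOp.pure (pauliUnitary p b v) = pauliPow p b * QOp.pure v * pauliPow p b := by
  conv_rhs => rw [← pauliPow_conjTranspose, pauliPow_conjTranspose p b]
  have := pure_mulVec (pauliPow p b) v
  rw [pauliPow_conjTranspose] at this
  exact this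

lemma pauliMask_flag_pure {n : ℕ} (p : Fin n × Fin 2 → Bool) (b : Bool)
    (v : EuclideanSpace ℂ (Fin n → Bool)) :
    pauliMask p b * QOp.tensor (QOp.basis fun _ : Unit => false) (QOp.pure v) * pauliMask p b =
      QOp.tensor (QOp.basis fun _ : Unit => false) (QOp.pure (pauliUnitary p b v)) := by
  rw [pure_pauliUnitary, pauliMask, tensor_mul, tensor_mul, Matrix.one_mul, Matrix.mul_one]
  rfl

/-- Applying Pauli operators to independent Haar random states does not change an expectation. -/
lemma integral_pauliUnitary {n s : ℕ} (p : Fin s → Fin n × Fin 2 → Bool) (b : Bool)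
    (g : (Fin s → Metric.sphere (0 : EuclideanSpace ℂ (Fin n → Bool)) 1) → ℝ) :
    ∫ v, g (fun i => sphereMap (pauliUnitary (p i) b) (v i))
      ∂(Measure.pi fun _ : Fin s => haarState n) =
    ∫ v, g v ∂(Measure.pi fun _ : Fin s => haarState n) := by
  have hm := measurePreserving_pi (fun _ : Fin s => haarState n) (fun _ => haarState n)
    fun i => measurePreserving_sphereMap (pauliUnitary (p i) b)
  let h : ∀ i, Metric.sphere (0 : EuclideanSpace ℂ (Fin n → Bool)) 1 ≃ₜ
      Metric.sphere (0 : EuclideanSpace ℂ (Fin n → Bool)) 1 := fun i =>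
    { toFun := sphereMap (pauliUnitary (p i) b)
      invFun := sphereMap (pauliUnitary (p i) b).symm
      left_inv := fun v => Subtype.ext (by simp [sphereMap])
      right_inv := fun v => Subtype.ext (by simp [sphereMap])
      continuous_toFun := continuous_sphereMap _
      continuous_invFun := continuous_sphereMap _ }
  -- As a homeomorphism the product map is a measurable embedding, so no measurability of `g` is
  -- required.
  exact hm.integral_comp (Homeomorph.piCongrRight h).measurableEmbedding g

/-! ### Replacing the states one at a time -/

/-- A tensor product is linear in each factor, and circuits and acceptance probabilities are linear.
This isolates a single copy for the replacement argument below. -/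
lemma probOne_slot {X K Q R : Type} [Fintype X] [Fintype K] [Fintype Q] [Fintype R]
    [DecidableEq X] [DecidableEq K] [DecidableEq Q] [DecidableEq R]
    (C : QCircuit (R ⊕ (X × (K × Q))) Unit) (τ : QOp R) (ρ : X × K → QOp Q) (j : X × K)
    (a c : ℝ) (M N : QOp Q) :
    (C.run (QOp.tensor τ (QOp.tensorFamily fun x => QOp.tensorFamily fun l =>
      Function.update ρ j ((a : ℂ) • M + (c : ℂ) • N) (x, l)))).probOne =
    a * (C.run (QOp.tensor τ (QOp.tensorFamily fun x => QOp.tensorFamily fun l =>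
      Function.update ρ j M (x, l)))).probOne +
    c * (C.run (QOp.tensor τ (QOp.tensorFamily fun x => QOp.tensorFamily fun l =>
      Function.update ρ j N (x, l)))).probOne := by
  have h : (QOp.tensorFamily fun x => QOp.tensorFamily fun l =>
      Function.update ρ j ((a : ℂ) • M + (c : ℂ) • N) (x, l)) =
      (a : ℂ) • (QOp.tensorFamily fun x => QOp.tensorFamily fun l =>
        Function.update ρ j M (x, l)) +
      (c : ℂ) • (QOp.tensorFamily fun x => QOp.tensorFamily fun l =>
        Function.update ρ j N (x, l)) := by
    ext v w
    have hprod : ∀ M' : QOp Q, (QOp.tensorFamily fun x => QOp.tensorFamily fun l =>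
        Function.update ρ j M' (x, l)) v w =
        M' (fun q => v (j.1, (j.2, q))) (fun q => w (j.1, (j.2, q))) *
        ∏ i ∈ ({j} : Finset (X × K))ᶜ,
          ρ i (fun q => v (i.1, (i.2, q))) (fun q => w (i.1, (i.2, q))) := by
      intro M'
      simp only [QOp.tensorFamily, Matrix.of_apply]
      rw [← Fintype.prod_prod_type' fun x l => Function.update ρ j M' (x, l)
        (fun q => v (x, (l, q))) (fun q => w (x, (l, q))), Fintype.prod_eq_mul_prod_compl j]
      congr 1
      · simp
      · refine Finset.prod_congr rfl fun i hi => ?_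
        have : i ≠ j := by simpa using hi
        simp [Function.update_of_ne this]
    refine (hprod _).trans (Eq.trans ?_ (congrArg₂ (fun p q => (a : ℂ) * p + (c : ℂ) * q)
      (hprod M).symm (hprod N).symm))
    change ((a : ℂ) * M _ _ + (c : ℂ) * N _ _) * _ = (a : ℂ) * _ + (c : ℂ) * _
    ring
  rw [h, tensor_add_right, tensor_smul_right, tensor_smul_right, QCircuit.run_add,
    QCircuit.run_smul, QCircuit.run_smul, QOp.probOne_add, QOp.probOne_smul, QOp.probOne_smul]

/-- Replacing the second component of mixtures on independent registers changes an acceptance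
probability by at most the total weight of the second components. -/
lemma abs_probOne_sub_le {X K Q R : Type} [Fintype X] [Fintype K] [Fintype Q] [Fintype R]
    [DecidableEq X] [DecidableEq K] [DecidableEq Q] [DecidableEq R]
    (C : QCircuit (R ⊕ (X × (K × Q))) Unit) {τ : QOp R} (hτ : τ.IsDensity)
    {η : X → ℝ} (h0 : ∀ x, 0 ≤ η x) (h1 : ∀ x, η x ≤ 1) {M N N' : X → QOp Q}
    (hM : ∀ x, (M x).IsDensity) (hN : ∀ x, (N x).IsDensity) (hN' : ∀ x, (N' x).IsDensity) :
    |(C.run (QOp.tensor τ (QOp.tensorFamily fun x => QOp.tensorFamily fun _ : K =>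
        (η x : ℂ) • M x + ((1 - η x : ℝ) : ℂ) • N x))).probOne -
      (C.run (QOp.tensor τ (QOp.tensorFamily fun x => QOp.tensorFamily fun _ : K =>
        (η x : ℂ) • M x + ((1 - η x : ℝ) : ℂ) • N' x))).probOne| ≤
      Fintype.card K * ∑ x, (1 - η x) := by
  let F : (X × K → QOp Q) → ℝ := fun ρ =>
    (C.run (QOp.tensor τ (QOp.tensorFamily fun x => QOp.tensorFamily fun l => ρ (x, l)))).probOne
  let σ : X × K → QOp Q := fun i => (η i.1 : ℂ) • M i.1 + ((1 - η i.1 : ℝ) : ℂ) • N i.1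
  let σ' : X × K → QOp Q := fun i => (η i.1 : ℂ) • M i.1 + ((1 - η i.1 : ℝ) : ℂ) • N' i.1
  have hσ : ∀ i, (σ i).IsDensity := fun i => (hM _).convex (hN _) (h0 _) (h1 _)
  have hσ' : ∀ i, (σ' i).IsDensity := fun i => (hM _).convex (hN' _) (h0 _) (h1 _)
  have hF : ∀ ρ : X × K → QOp Q, (∀ i, (ρ i).IsDensity) → 0 ≤ F ρ ∧ F ρ ≤ 1 := by
    intro ρ hρ
    have : (C.run (QOp.tensor τ (QOp.tensorFamily fun x => QOp.tensorFamily
        fun l => ρ (x, l)))).IsDensity :=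
      (hτ.tensor (QOp.IsDensity.tensorFamily fun x => QOp.IsDensity.tensorFamily
        fun l => hρ (x, l))).run C
    exact ⟨this.probOne_nonneg, this.probOne_le_one⟩
  -- A hybrid argument over the set S of copies already replaced. At each new copy the first
  -- components of the two mixtures cancel, and the second ones, of weight 1 - η, differ by at most
  -- 1 in acceptance probability.
  have key : ∀ S : Finset (X × K), |F σ - F (fun i => if i ∈ S then σ' i else σ i)| ≤
      ∑ i ∈ S, (1 - η i.1) := by
    intro S
    induction S using Finset.induction_on with
    | empty => simp
    | insert j S hj ih =>
      let ρ : X × K → QOp Q := fun i => if i ∈ S then σ' i else σ i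
      have hρ : ∀ i, (ρ i).IsDensity := fun i => by
        simp only [ρ]; split_ifs
        · exact hσ' i
        · exact hσ i
      have hup : ∀ M' : QOp Q, M'.IsDensity → ∀ i, (Function.update ρ j M' i).IsDensity := by
        intro M' hM' i
        by_cases h : i = j
        · subst h; simpa using hM'
        · rw [Function.update_of_ne h]; exact hρ i
      have e1 : ρ = Function.update ρ j (σ j) := by
        rw [eq_comm, Function.update_eq_self_iff]
        simp [ρ, hj]
      have e2 : (fun i => if i ∈ insert j S then σ' i else σ i) = Function.update ρ j (σ' j) := by
        funext i
        by_cases h : i = j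
        · subst h; simp
        · simp [h, ρ]
      rw [Finset.sum_insert hj, e2]
      have s1 : F ρ = η j.1 * F (Function.update ρ j (M j.1)) +
          (1 - η j.1) * F (Function.update ρ j (N j.1)) := by
        conv_lhs => rw [e1]
        exact probOne_slot C τ ρ j _ _ _ _
      have s2 : F (Function.update ρ j (σ' j)) = η j.1 * F (Function.update ρ j (M j.1)) +
          (1 - η j.1) * F (Function.update ρ j (N' j.1)) := probOne_slot C τ ρ j _ _ _ _
      have b1 := hF _ (hup _ (hN j.1))
      have b2 := hF _ (hup _ (hN' j.1))
      have hstep : |F ρ - F (Function.update ρ j (σ' j))| ≤ 1 - η j.1 := by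
        rw [s1, s2, add_sub_add_left_eq_sub, ← mul_sub, abs_mul,
          abs_of_nonneg (sub_nonneg.2 (h1 j.1))]
        refine mul_le_of_le_one_right (sub_nonneg.2 (h1 j.1)) (abs_le.2 ⟨?_, ?_⟩) <;> linarith
      have := abs_sub_le (F σ) (F ρ) (F (Function.update ρ j (σ' j)))
      linarith
  have h := key Finset.univ
  simp only [Finset.mem_univ, if_true] at h
  refine h.trans (le_of_eq ?_)
  rw [Fintype.sum_prod_type]
  simp only [Finset.sum_const, Finset.card_univ, nsmul_eq_mul, Finset.mul_sum]

end Reduction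

/-! ### Computational hiding -/

section Hiding

open MeasureTheory
open scoped ComplexOrder

lemma exists_isDensity_smul_eq {Q : Type} [Fintype Q] [DecidableEq Q] {ρ : QOp Q}
    (hρ : ρ.PosSemidef) : ∃ τ : QOp Q, τ.IsDensity ∧ ρ = (ρ.trace.re : ℂ) • τ := by
  have htr : (ρ.trace.re : ℂ) = ρ.trace := (Complex.eq_re_of_ofReal_le hρ.trace_nonneg).symm
  by_cases h : ρ.trace = 0
  -- A positive operator of trace 0 vanishes, so any density matrix will do.
  · exact ⟨QOp.basis fun _ => false, QOp.IsDensity.basis _, by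
      rw [htr, h, zero_smul]; exact hρ.trace_eq_zero_iff.1 h⟩
  · refine ⟨ρ.trace⁻¹ • ρ, ⟨hρ.smul ?_, ?_⟩, ?_⟩
    · exact inv_nonneg.2 hρ.trace_nonneg
    · rw [Matrix.trace_smul, smul_eq_mul, inv_mul_cancel₀ h]
    · rw [htr, smul_smul, mul_inv_cancel₀ h, one_smul]

/-- Among the outcomes of a measurement there is one whose conditional value is at least as large
as the average value. -/
lemma exists_message {M Q : Type} [Fintype M] [DecidableEq M] [Fintype Q] [DecidableEq Q]
    {ω : QOp (M ⊕ Q)} (hω : ω.IsDensity) (f : (M → Bool) → QOp Q → ℝ)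
    (hf : ∀ m (c : ℝ) ρ, f m ((c : ℂ) • ρ) = c * f m ρ) :
    ∃ m τ, τ.IsDensity ∧ |∑ m, f m (ω.postMeasure m)| ≤ |f m τ| := by
  have hpos : ∀ m, (ω.postMeasure m).PosSemidef := fun m => hω.1.submatrix (Sum.elim m)
  choose τ hτ hpost using fun m => exists_isDensity_smul_eq (hpos m)
  let p : (M → Bool) → ℝ := fun m => (ω.postMeasure m).trace.re
  have hp0 : ∀ m, 0 ≤ p m := fun m => (Complex.nonneg_iff.1 (hpos m).trace_nonneg).1
  have hp1 : ∑ m, p m = 1 := by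
    have h := congrArg Complex.re hω.2
    rw [Matrix.trace, sum_sum_type, Complex.re_sum] at h
    exact h
  obtain ⟨m, -, hm⟩ := Finset.exists_max_image Finset.univ (fun m => |f m (τ m)|)
    ⟨fun _ => false, Finset.mem_univ _⟩
  refine ⟨m, τ m, hτ m, ?_⟩
  calc |∑ m, f m (ω.postMeasure m)| = |∑ m, p m * f m (τ m)| := by
        congr 1
        refine Finset.sum_congr rfl fun m _ => ?_
        rw [← hf, ← hpost]
    _ ≤ ∑ m', p m' * |f m' (τ m')| := (Finset.abs_sum_le_sum_abs _ _).trans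
        (Finset.sum_le_sum fun m' _ => by rw [abs_mul, abs_of_nonneg (hp0 m')])
    _ ≤ ∑ m', p m' * |f m (τ m)| := Finset.sum_le_sum fun m' _ =>
        mul_le_mul_of_nonneg_left (hm m' (Finset.mem_univ _)) (hp0 m')
    _ = _ := by rw [← Finset.sum_mul, hp1, one_mul]

/-- The acceptance probability of an attack, as a function of the receiver's private state and of
the states on which the committer runs the tomography procedure. -/
noncomputable def attackProb {X : Type} [Fintype X] [DecidableEq X] {L n u r o : ℕ}
    (T : QCircuit (Fin L × (Unit ⊕ Fin n)) (Fin u)) (R₂ : QCircuit (Fin r ⊕ (X × Fin u)) (Fin o))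
    (D : QCircuit (Fin o) Unit) (τ : QOp (Fin r)) (σ : X → QOp (Unit ⊕ Fin n)) : ℝ :=
  (D.run (R₂.run (QOp.tensor τ (QOp.tensorFamily fun x =>
    (T.run (QOp.tensorFamily fun _ : Fin L => σ x)).measured)))).probOne

/-- The reduction: a distinguisher against the state generator that simulates the attack. -/
lemma exists_distinguisher {X : Type} [Fintype X] [DecidableEq X] {s d L n u r o : ℕ}
    (T : QCircuit (Fin L × (Unit ⊕ Fin n)) (Fin u)) (R₂ : QCircuit (Fin r ⊕ (X × Fin u)) (Fin o))
    (D : QCircuit (Fin o) Unit) (P : X × (Fin n × Fin 2) → Bool) (b : Bool) (e : Fin s ≃ X) :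
    ∃ C : QCircuit (((Fin s × Fin d) ⊕ (Fin s × (Fin L × Fin n))) ⊕ Fin r) Unit,
      C.size ≤ (4 * (s * d + s * (L * n) + r) + s * (L * (2 * (1 + n))) + 2 * r) +
        (s * (L * (16 * n + 2)) + s * (6 * T.size) + 3 * R₂.size + D.size) ∧
      ∀ (x : Fin s → Fin d → Bool) (τ : QOp (Fin r)),
        (τ.IsDensity → ∀ (η : X → ℝ) (ψ : X → EuclideanSpace ℂ (Fin n → Bool))
          (bot : EuclideanSpace ℂ (Fin n → Bool)), (∀ y, 0 ≤ η y) → (∀ y, η y ≤ 1) →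
          (∀ y, ‖ψ y‖ = 1) → ‖bot‖ = 1 →
          |attackProb T R₂ D τ (fun y => pauliMask (fun q => P (y, q)) b *
            ((η y : ℂ) • QOp.tensor (QOp.basis fun _ : Unit => false) (QOp.pure (ψ y)) +
              ((1 - η y : ℝ) : ℂ) •
                QOp.tensor (QOp.basis fun _ : Unit => true) (QOp.pure bot)) *
            pauliMask (fun q => P (y, q)) b) -
          (C.run (challenge x (fun i => (η (e i) : ℂ) • QOp.pure (ψ (e i)) +
            ((1 - η (e i) : ℝ) : ℂ) • QOp.pure bot) τ)).probOne| ≤ L * ∑ y, (1 - η y)) ∧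
        ∫ v, (C.run (challenge x (fun i => QOp.pure (v i).1) τ)).probOne
          ∂(Measure.pi fun _ : Fin s => haarState n) =
        ∫ v, attackProb T R₂ D τ (fun y =>
          QOp.tensor (QOp.basis fun _ : Unit => false) (QOp.pure (v (e.symm y)).1))
          ∂(Measure.pi fun _ : Fin s => haarState n) := by
  obtain ⟨C₁, hs₁, hr₁⟩ := exists_prepare (d := d) (L := L) (n := n) (r := r) e
  obtain ⟨C₂, hs₂, hr₂⟩ := exists_attack T R₂ D P b
  obtain ⟨C, hs, hr⟩ := QCircuit.exists_seq C₁ C₂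
  have hX : Fintype.card X = s := by rw [← Fintype.card_congr e, Fintype.card_fin]
  rw [hX] at hs₂
  refine ⟨C, hs.trans (add_le_add hs₁ hs₂), fun x τ => ⟨fun hτ η ψ bot h0 h1 hψ hb => ?_, ?_⟩⟩
  · have hflag : ∀ (c : Bool) {v : EuclideanSpace ℂ (Fin n → Bool)}, ‖v‖ = 1 →
        (QOp.tensor (QOp.basis fun _ : Unit => c) (QOp.pure v)).IsDensity := fun c v hv =>
      (QOp.IsDensity.basis _).tensor (QOp.IsDensity.pure hv)
    -- The attack sees bot with flag 1, the simulation sees it with flag 0; the ψ components agree.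
    have h := abs_probOne_sub_le (K := Fin L) C₂ hτ h0 h1 (fun y => hflag false (hψ y))
      (fun _ => hflag true hb) (fun _ => hflag false hb)
    rw [Fintype.card_fin, hr₂] at h
    rw [hr, hr₁]
    simp only [Equiv.apply_symm_apply, tensor_add_right, tensor_smul_right]
    exact h
  -- On pure states with flag 0 the masks act as unitaries, which the Haar measure absorbs. The
  -- right-hand side mentions neither P nor b.
  · conv_rhs => rw [← integral_pauliUnitary (fun i q => P (e i, q)) b]
    refine integral_congr_ae (Filter.Eventually.of_forall fun v => ?_)
    simp only [hr, hr₁, hr₂, pauliMask_flag_pure]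
    simp only [attackProb, sphereMap, Equiv.apply_symm_apply]

lemma PolyBounded.of_isBigO {n : ℕ → ℕ}
    (hn : (fun lam : ℕ => (n lam : ℝ)) =O[Filter.atTop] fun lam : ℕ => Real.log lam) :
    PolyBounded n :=
  (PolyBounded.two_pow hn).mono fun _ => Nat.lt_two_pow_self.le

lemma PolyBounded.tomographyCopies {n : ℕ → ℕ}
    (hn : (fun lam : ℕ => (n lam : ℝ)) =O[Filter.atTop] fun lam : ℕ => Real.log lam) :
    PolyBounded (tomographyCopies n) := by
  refine (((PolyBounded.const (3 ^ 8 * 2 ^ 5)).mul ((PolyBounded.two_pow hn).pow 3)).mul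
    PolyBounded.id).mono fun lam => le_of_eq ?_
  rw [_root_.tomographyCopies, pow_add, mul_comm 3 (n lam), pow_mul]
  ring

/-- An empty product of Pauli matrices is 1, so without qubits the two commitments coincide. This
covers the case in which aborts are not controlled. -/
lemma pauliMask_eq_of_zero {n : ℕ} (h : n = 0) (p : Fin n × Fin 2 → Bool) (b : Bool) :
    pauliMask p b = pauliMask p false := by
  subst h
  have : pauliOp p = 1 := by
    ext x y
    rw [Subsingleton.elim y x]
    simp [pauliOp]
  cases b <;> simp [pauliMask, this]

lemma probOne_receiverState {d n u : ℕ → ℕ} {lam a r o : ℕ}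
    (Ghat : StateGenerator d fun lam => Unit ⊕ Fin (n lam)) (T : Tomography n u) (b : Bool)
    (ρ : QOp (Fin a))
    (R₁ : QCircuit (Fin a) (((Fin (d lam) → Bool) × (Fin (n lam) × Fin 2)) ⊕ Fin r))
    (R₂ : QCircuit (Fin r ⊕ ((Fin (d lam) → Bool) × Fin (u lam))) (Fin o))
    (D : QCircuit (Fin o) Unit) :
    (D.run (receiverState (tomographyCommitment Ghat T lam b) ρ R₁ R₂)).probOne =
      ∑ m, (∑ k, attackProb (T lam) R₂ D ((R₁.run ρ).postMeasure m)
        (fun x => maskedState Ghat lam (fun q => m (x, q)) k x b)) / 2 ^ lam := by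
  rw [receiverState, QCircuit.run_sum, QCircuit.run_sum, QOp.probOne_sum]
  refine Finset.sum_congr rfl fun m _ => ?_
  have h2 : ((2 : ℂ) ^ lam)⁻¹ = (((2 ^ lam)⁻¹ : ℝ) : ℂ) := by push_cast; rfl
  rw [tomographyCommitment, tensor_smul_right, QCircuit.run_smul, QCircuit.run_smul, h2,
    QOp.probOne_smul, tensor_sum_right, QCircuit.run_sum, QCircuit.run_sum, QOp.probOne_sum,
    div_eq_inv_mul]
  rfl

end Hiding

/-! ### The hybrid argument -/

theorem mainTheorem11 (d n u : ℕ → ℕ)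
    (hd : (fun lam : ℕ => (d lam : ℝ)) =O[Filter.atTop] fun lam : ℕ => Real.log lam)
    (hn : (fun lam : ℕ => (n lam : ℝ)) =O[Filter.atTop] fun lam : ℕ => Real.log lam)
    (G : StateGenerator d fun lam => Fin (n lam)) (hG : IsPRFS G)
    (Ghat : StateGenerator d fun lam => Unit ⊕ Fin (n lam)) (hGhat : RecognizableAbort G Ghat)
    (T : Tomography n u) (hT : IsQPT T) :
    ComputationallyHiding (tomographyCommitment Ghat T) := by
  intro a r o ρ hρ R₁ hR₁ R₂ hR₂ D hD
  choose bot hb hbot using hGhat.2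
  choose hη hgen' using hbot
  choose η ψ h0 h1 hψ hghat using hη
  have hgen : ∀ lam k x, G.gen lam k x = (η lam k x : ℂ) • QOp.pure (ψ lam k x) +
      ((1 - η lam k x : ℝ) : ℂ) • QOp.pure (bot lam) := by
    intro lam k x
    rw [hgen', hghat, ← tensor_smul_right, ← tensor_smul_right]
    have hadd : ∀ A B : QOp (Unit ⊕ Fin (n lam)),
        (A + B).traceLeft = A.traceLeft + B.traceLeft := fun A B => by
      ext x y; simp [QOp.traceLeft, Finset.sum_add_distrib]
    rw [hadd, traceLeft_tensor, traceLeft_tensor, (QOp.IsDensity.basis _).2,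
      (QOp.IsDensity.basis _).2, one_smul, one_smul]
  let Δ : ∀ lam, ((Fin (d lam) → Bool) × (Fin (n lam) × Fin 2) → Bool) → QOp (Fin (r lam)) → Bool →
      (Fin lam → Bool) → ℝ := fun lam P τ b k =>
    attackProb (T lam) (R₂ lam) (D lam) τ
      (fun x => maskedState Ghat lam (fun q => P (x, q)) k x b)
  -- The first stage of the receiver is absorbed into a best choice of message and private state,
  -- which then serve as non-uniform advice.
  have hmsg : ∀ lam, ∃ P τ, τ.IsDensity ∧
      |((D lam).run (receiverState (tomographyCommitment Ghat T lam false) (ρ lam) (R₁ lam)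
        (R₂ lam))).probOne - ((D lam).run (receiverState (tomographyCommitment Ghat T lam true)
        (ρ lam) (R₁ lam) (R₂ lam))).probOne| ≤
      |(∑ k, Δ lam P τ false k) / 2 ^ lam - (∑ k, Δ lam P τ true k) / 2 ^ lam| := by
    intro lam
    obtain ⟨P, τ, hτ, h⟩ := exists_message ((hρ lam).run (R₁ lam)) (fun P τ =>
      (∑ k, Δ lam P τ false k) / 2 ^ lam - (∑ k, Δ lam P τ true k) / 2 ^ lam) (by
        intro P c τ
        have : ∀ b, ∑ k, Δ lam P ((c : ℂ) • τ) b k = c * ∑ k, Δ lam P τ b k := fun b => by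
          rw [Finset.mul_sum]
          refine Finset.sum_congr rfl fun k _ => ?_
          simp only [Δ, attackProb, tensor_smul_left, QCircuit.run_smul, QOp.probOne_smul]
        rw [this, this]
        ring)
    refine ⟨P, τ, hτ, le_trans (le_of_eq ?_) h⟩
    rw [probOne_receiverState, probOne_receiverState, Finset.sum_sub_distrib]
  choose P τ hτ hdiff using hmsg
  let e : ∀ lam, Fin (2 ^ d lam) ≃ (Fin (d lam) → Bool) := fun lam =>
    (Fintype.equivFinOfCardEq (by simp)).symm
  choose C hCs hC using fun b lam => exists_distinguisher (d := d lam) (T lam) (R₂ lam) (D lam)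
    (P lam) b (e lam)
  have hd' := PolyBounded.of_isBigO hd
  have hn' := PolyBounded.of_isBigO hn
  have hL := PolyBounded.tomographyCopies hn
  have h2d := PolyBounded.two_pow hd
  -- The private register becomes the distinguisher's advice. Its size is polynomial because it is
  -- fed into wires of `R₂`.
  have hr : PolyBounded r := PolyBounded.mono hR₂ fun lam => by
    have := Fintype.card_le_of_embedding (R₂ lam).input
    simp only [Fintype.card_fin, Fintype.card_sum] at this
    simp only [QCircuit.size]; omega
  have hCQPT : ∀ b, IsQPT (C b) := fun b => PolyBounded.mono
    (((((PolyBounded.const 4).mul (((h2d.mul hd').add (h2d.mul (hL.mul hn'))).add hr)).add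
      (h2d.mul (hL.mul ((PolyBounded.const 2).mul ((PolyBounded.const 1).add hn'))))).add
      ((PolyBounded.const 2).mul hr)).add
    ((((h2d.mul (hL.mul (((PolyBounded.const 16).mul hn').add (PolyBounded.const 2)))).add
      (h2d.mul ((PolyBounded.const 6).mul hT))).add ((PolyBounded.const 3).mul hR₂)).add hD))
    (hCs b)
  -- The enumeration `e` itself is the family of queries: every input occurs exactly once.
  have hprfs := fun b => hG.2 _ _ r h2d hL (fun lam => e lam) (fun lam => (e lam).injective) (C b)
    (hCQPT b) τ hτ
  -- Taking, for each λ, an input with the largest abort weight gives one negligible function that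
  -- bounds all inputs at once.
  choose x _ hx using fun lam => Finset.exists_max_image Finset.univ
    (fun x => ∑ k, (1 - η lam k x)) ⟨fun _ : Fin (d lam) => false, Finset.mem_univ _⟩
  have habort := abort_negligible hG hd' hn' bot hb η ψ h0 h1 hψ hgen x
  refine Negligible.of_abs_le (((((PolyBounded.const 2).mul (hL.mul h2d)).mul_negligible
    habort).add (hprfs false)).add (hprfs true)) fun lam => ?_
  rw [abs_abs]
  refine (hdiff lam).trans (le_trans ?_ (le_abs_self _))
  split_ifs with hn0
  · have : ∀ k, Δ lam (P lam) (τ lam) true k = Δ lam (P lam) (τ lam) false k := fun k => by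
      simp only [Δ, maskedState, pauliMask_eq_of_zero hn0 _ true]
    simp only [this, sub_self, abs_zero]
    positivity
  set H := ∫ v, attackProb (T lam) (R₂ lam) (D lam) (τ lam) (fun y =>
    QOp.tensor (QOp.basis fun _ : Unit => false) (QOp.pure (v ((e lam).symm y)).1))
    ∂(MeasureTheory.Measure.pi fun _ : Fin (2 ^ d lam) => haarState (n lam)) with hH
  let A : Bool → ℝ := fun b => (∑ k, ((C b lam).run (challenge (e lam)
    (fun i => G.gen lam k (e lam i)) (τ lam))).probOne) / 2 ^ lam
  set ε := (∑ k, (1 - η lam k (x lam))) / 2 ^ lam with hε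
  have h2 : (0 : ℝ) < 2 ^ lam := by positivity
  -- Passing from the attack to its simulation costs L times the abort weight of each of the 2^d
  -- inputs, averaged over k.
  have hhyb : ∀ b, |(∑ k, Δ lam (P lam) (τ lam) b k) / 2 ^ lam - A b| ≤
      tomographyCopies n lam * (2 ^ d lam * ε) := by
    intro b
    rw [← sub_div, ← Finset.sum_sub_distrib, abs_div, abs_of_pos h2, div_le_iff₀ h2]
    calc _ ≤ ∑ k, tomographyCopies n lam * ∑ y, (1 - η lam k y) := by
          refine (Finset.abs_sum_le_sum_abs _ _).trans (Finset.sum_le_sum fun k _ => ?_)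
          have := (hC b lam (e lam) (τ lam)).1 (hτ lam) (η lam k) (ψ lam k) (bot lam)
            (h0 lam k) (h1 lam k) (hψ lam k) (hb lam)
          simpa only [Δ, maskedState, hghat, hgen] using this
      _ = tomographyCopies n lam * ∑ y, ∑ k, (1 - η lam k y) := by
          rw [← Finset.mul_sum, Finset.sum_comm]
      _ ≤ tomographyCopies n lam * ∑ y : Fin (d lam) → Bool, ∑ k, (1 - η lam k (x lam)) := by
          gcongr tomographyCopies n lam * ?_
          exact Finset.sum_le_sum fun y _ => hx lam y (Finset.mem_univ _)
      _ = _ := by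
          rw [Finset.sum_const, hε]
          simp
          field_simp
  have hHb : ∀ b, ∫ v, ((C b lam).run (challenge (e lam) (fun i => QOp.pure (v i).1)
      (τ lam))).probOne ∂(MeasureTheory.Measure.pi fun _ : Fin (2 ^ d lam) => haarState (n lam)) =
      H := fun b => (hC b lam (e lam) (τ lam)).2
  rw [hHb, hHb]
  -- The chain is: attack on b = 0, its simulation `A false`, the common Haar value `H`, the
  -- simulation `A true`, attack on b = 1. The outer two links account for the factor 2 in the abort
  -- term.
  have t0 := hhyb false
  have t1 := hhyb true
  have t2 := abs_sub_le ((∑ k, Δ lam (P lam) (τ lam) false k) / 2 ^ lam) (A false)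
    ((∑ k, Δ lam (P lam) (τ lam) true k) / 2 ^ lam)
  have t3 := abs_sub_le (A false) H ((∑ k, Δ lam (P lam) (τ lam) true k) / 2 ^ lam)
  have t4 := abs_sub_le H (A true) ((∑ k, Δ lam (P lam) (τ lam) true k) / 2 ^ lam)
  rw [abs_sub_comm (A true), abs_sub_comm H (A true)] at t4
  push_cast
  change _ ≤ _ + |A false - H| + |A true - H|
  linarith
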